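/- **Setting.** Let $m\ge 1$ and consider $$x'(t)=-a(t)x(t)+\sum_{i=1}^m\Big[\frac{b_i(t)}{1+x^{\alpha_i}(t-\tau_i(t))}+c_i(t)\int_0^T\frac{v_i(s)}{1+x^{\beta_i}(t-s)}\,ds-H_i(t,x(t-\sigma_i(t)))\Big],\quad t\ne t_k,$$ $$x(t_k^+)-x(t_k^-)=\gamma_kx(t_k^-)+\delta_k,\quad k\in\mathbb Z, \qquad (1.6)$$ where $\tau_i,\sigma_i\ge0$, $\alpha_i,\beta_i>0$, $T>0$, $v_i\ge 0$ is integrable on $[0,T]$ with $\int_0^Tv_i=1$, and $(t_k)_{k\in\mathbb Z}$ is strictly increasing with $t_k\to\pm\infty$ as $k\to\pm\infty$. *Almost periodicity.* For functions on $\mathbb R$ it is meant in the sense of Bohr, and similarly for sequences on $\mathbb Z$. Put $t_k^p=t_{k+p}-t_k$; the family $\{t^p_k\}$ is uniformly almost periodic if for each $\epsilon>0$ there is a relatively dense set of $q\in\mathbb Z$ with $|t^p_{k+q}-t^p_k|<\epsilon$ for all $k,p\in\mathbb Z$. For an interval $X$, $PLC(X)$ is the set of functions on $X$ that are left continuous,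 have right limits, and are continuous except possibly at the points $t_k$. A function $\phi\in PLC(\mathbb R)$ is almost periodic if $\{t_k^p\}$ is uniformly almost periodic; for each $\epsilon>0$ there is $\delta>0$ such that $|\phi(s)-\phi(s')|<\epsilon$ whenever $s,s'$ lie in the same interval $(t_k,t_{k+1}]$ and $|s-s'|<\delta$; and for each $\epsilon>0$ there is a relatively dense set of $\omega\in\mathbb R$ such that $|\phi(s+\omega)-\phi(s)|<\epsilon$ for all $s$ with $|s-t_k|>\epsilon$ for every $k$. *Notation.* For a bounded function $f$ on $\mathbb R$ or sequence on $\mathbb Z$, $f_L$ and $f_M$ denote its infimum and supremum; $H_{iL},H_{iM}$ are those of $H_i$ over $\mathbb R\times[0,\infty)$. Let $\Gamma(q,p)=\prod_{i=q}^p(1+\gamma_i)$ for $q\le p$, $\Gamma_M=\sup_{q\le p}\Gamma(q,p)$, $\Gamma_L=\inf_{q\le p}\Gamma(q,p)$, $A=\max\{\Gamma_M,1\}$, $B=\min\{\Gamma_L,1\}$, $\eta=\inf_k(t_{k+1}-t_k)$, $\overline\eta=\sup_k(t_{k+1}-t_k)$, $\sigma=\max_i\{T,\tau_{iM},\sigma_{iM}\}$,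 $$M_1=\frac A{a_L}\sum_{i=1}^m(b_{iM}+c_{iM}-H_{iL})+\frac{A\max\{\delta_M,0\}}{1-e^{-a_L\eta}},$$ $$M_2=\frac B{a_M}\sum_{i=1}^m\Big(\frac{b_{iL}}{1+M_1^{\alpha_i}}+\frac{c_{iL}}{1+M_1^{\beta_i}}-H_{iM}\Big)+\begin{cases}\dfrac{B\delta_Le^{-a_M\overline\eta}}{1-e^{-a_M\overline\eta}},&\delta_L\ge0,\\[2mm]\dfrac{A\delta_L}{1-e^{-a_L\eta}},&\delta_L<0,\end{cases}$$ $$K_i^*=\sup_{M_2\le x\le M_1}\alpha_ix^{\alpha_i-1},\qquad G_i^*=\sup_{M_2\le x\le M_1}\beta_ix^{\beta_i-1}.$$ *Assumptions.* (A1) $a$ is almost periodic and $a_L>0$. (A2) $b_i,c_i$ are nonnegative and almost periodic. (A3) On $\mathbb R\times[0,\infty)$, $H_i$ is nonnegative and bounded, it is continuous and almost periodic in $t$ uniformly for $x$ in compact subsets of $[0,\infty)$, and there is a constant $L_i>0$ with $|H_i(t,x)-H_i(t,y)|\le L_i|x-y|$. (A4) $\tau_i,\sigma_i$ are almost periodic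 and differentiable with bounded derivatives, and $\inf_t(1-\tau_i'(t))>0$, $\inf_t(1-\sigma_i'(t))>0$. (A5) $(\delta_k)$ is almost periodic. (A6) $(\gamma_k)$ is almost periodic, $\gamma_L>-1$, $\Gamma_M<\infty$, $\Gamma_L>0$. (A7) $\{t_k^p\}$ is uniformly almost periodic and $\eta>0$. *Solutions.* A solution of (1.6) on $\mathbb R$ is a function $x\in PLC(\mathbb R)$ with values in $[0,\infty)$ that satisfies the impulse condition at every $t_k$ and the differential equation at every $t\ne t_k$ for which none of the delayed times $t-\tau_i(t)$, $t-\sigma_i(t)$ is an impulse time. Let $t_0\in\mathbb R$ and let $\xi\in PLC([t_0-\sigma,t_0])$ satisfy $\xi\ge0$ on $[t_0-\sigma,t_0)$ and $\xi(t_0)>0$. A solution $x(t;t_0,\xi)$ is a function $x\in PLC([t_0-\sigma,\infty))$ that equals $\xi$ on $[t_0-\sigma,t_0]$, is nonnegative on $[t_0,\infty)$, satisfies the impulse condition at every $t_k\ge t_0$, and satisfies the differential equation at every such $t>t_0$. **Theorem 3.3.** Assume (A1)–(A7), $M_1\ge0$, $M_2>0$, $\sigma\le\eta$ and $$\frac1{a_L}\max\{A,(\gamma_L+1)^{-1}\}\sum_{i=1}^m\big(b_{iM}K_i^*+c_{iM}G_i^*+L_i\big)<1.$$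 Then (1.6) has a unique positive almost periodic solution $x^*$. Moreover there is $\lambda>0$ such that for all $t_0$, all $\xi$ as above and every solution $x=x(\cdot;t_0,\xi)$ there is a constant $C$ with $|x(t)-x^*(t)|\le Ce^{-\lambda(t-t_0)}$ for all $t\ge t_0$. -/

import Mathlib

open Set Filter Topology
open scoped NNReal

/-- A subset of an ordered group (here `ℝ` or `ℤ`) is relatively dense if some length `l > 0` is
such that every interval `[x, x + l]` meets it. -/
def RelativelyDense {G : Type*} [AddCommGroup G] [LinearOrder G] (S : Set G) : Prop :=
  ∃ l : G, 0 < l ∧ ∀ x : G, ∃ w ∈ S, x ≤ w ∧ w ≤ x + l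

/-- Almost periodic functions in the sense of Bohr. -/
def BohrAlmostPeriodic (f : ℝ → ℝ) : Prop :=
  Continuous f ∧ ∀ ε : ℝ, 0 < ε → RelativelyDense {w : ℝ | ∀ t : ℝ, |f (t + w) - f t| < ε}

/-- `F t x` is Bohr almost periodic in `t`, uniformly for `x` in (compact subsets of) `[0, ∞)`. -/
def BohrAlmostPeriodicUniformly (F : ℝ → ℝ → ℝ) : Prop :=
  ContinuousOn (fun p : ℝ × ℝ => F p.1 p.2) (univ ×ˢ Ici 0) ∧
    ∀ K : Set ℝ, IsCompact K → K ⊆ Ici 0 → ∀ ε : ℝ, 0 < ε →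
      RelativelyDense {w : ℝ | ∀ t : ℝ, ∀ x ∈ K, |F (t + w) x - F t x| < ε}

/-- Almost periodic two-sided sequences. -/
def AlmostPeriodicSeq (z : ℤ → ℝ) : Prop :=
  ∀ ε : ℝ, 0 < ε → RelativelyDense {q : ℤ | ∀ k : ℤ, |z (k + q) - z k| < ε}

/-- The sequences `k ↦ t (k + p) - t k`, `p ∈ ℤ`, are uniformly almost periodic: for every `ε > 0`
there is a relatively dense set of `ε`-almost periods common to all of them. -/
def UniformlyAlmostPeriodicGaps (t : ℤ → ℝ) : Prop :=
  ∀ ε : ℝ, 0 < ε → RelativelyDense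
    {q : ℤ | ∀ p k : ℤ, |(t (k + q + p) - t (k + q)) - (t (k + p) - t k)| < ε}

/-- `PLC t X φ`: on `X`, the function `φ` is left continuous, has right limits, and is continuous
at every point that is not one of the `t k`. -/
def PLC (t : ℤ → ℝ) (X : Set ℝ) (φ : ℝ → ℝ) : Prop :=
  ∀ s ∈ X,
    ContinuousWithinAt φ (X ∩ Iic s) s ∧
    (∃ r : ℝ, Tendsto φ (𝓝[X ∩ Ioi s] s) (𝓝 r)) ∧
    ((∀ k : ℤ, s ≠ t k) → ContinuousWithinAt φ X s)

/-- Almost periodic piecewise left continuous functions on `ℝ` with jumps at the points `t k`. -/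
def PLCAlmostPeriodic (t : ℤ → ℝ) (φ : ℝ → ℝ) : Prop :=
  PLC t univ φ ∧
  UniformlyAlmostPeriodicGaps t ∧
  (∀ ε : ℝ, 0 < ε → ∃ d : ℝ, 0 < d ∧ ∀ k : ℤ,
    ∀ s ∈ Ioc (t k) (t (k + 1)), ∀ s' ∈ Ioc (t k) (t (k + 1)), |s - s'| < d →
      |φ s - φ s'| < ε) ∧
  (∀ ε : ℝ, 0 < ε → RelativelyDense
    {w : ℝ | ∀ s : ℝ, (∀ k : ℤ, ε < |s - t k|) → |φ (s + w) - φ s| < ε})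

/-- The data of the impulsive hematopoiesis model
`x'(t) = -a(t) x(t) + ∑ i, [b i (t) / (1 + x(t - tau i (t)) ^ alpha i)
   + c i (t) ∫ s in 0..T, v i s / (1 + x(t - s) ^ beta i) - H i (t, x(t - sig i (t)))]`, `t ≠ t k`,
`x(t k +) - x(t k -) = gamma k * x(t k -) + delta k`. -/
structure HematopoiesisModel (m : ℕ) where
  a : ℝ → ℝ
  b : Fin m → ℝ → ℝ
  c : Fin m → ℝ → ℝ
  H : Fin m → ℝ → ℝ → ℝ
  tau : Fin m → ℝ → ℝ
  sig : Fin m → ℝ → ℝ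
  alpha : Fin m → ℝ
  beta : Fin m → ℝ
  T : ℝ
  v : Fin m → ℝ → ℝ
  gamma : ℤ → ℝ
  delta : ℤ → ℝ
  t : ℤ → ℝ

namespace HematopoiesisModel

variable {m : ℕ} (P : HematopoiesisModel m)

/-- The general requirements on the data that are part of the description of the model. -/
structure Admissible : Prop where
  tau_nonneg : ∀ i s, 0 ≤ P.tau i s
  sig_nonneg : ∀ i s, 0 ≤ P.sig i s
  alpha_pos : ∀ i, 0 < P.alpha i
  beta_pos : ∀ i, 0 < P.beta i
  T_pos : 0 < P.T
  v_nonneg : ∀ i, ∀ s ∈ Icc 0 P.T, 0 ≤ P.v i s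
  v_integrable : ∀ i, IntervalIntegrable (P.v i) MeasureTheory.volume 0 P.T
  v_integral : ∀ i, ∫ s in (0 : ℝ)..P.T, P.v i s = 1
  t_strictMono : StrictMono P.t
  t_atTop : Tendsto P.t atTop atTop
  t_atBot : Tendsto P.t atBot atBot

/-! ### Constants -/

noncomputable def aL : ℝ := ⨅ s, P.a s
noncomputable def aM : ℝ := ⨆ s, P.a s
noncomputable def bL (i : Fin m) : ℝ := ⨅ s, P.b i s
noncomputable def bM (i : Fin m) : ℝ := ⨆ s, P.b i s
noncomputable def cL (i : Fin m) : ℝ := ⨅ s, P.c i s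
noncomputable def cM (i : Fin m) : ℝ := ⨆ s, P.c i s
noncomputable def HL (i : Fin m) : ℝ := ⨅ p : ℝ × ℝ≥0, P.H i p.1 p.2
noncomputable def HM (i : Fin m) : ℝ := ⨆ p : ℝ × ℝ≥0, P.H i p.1 p.2
noncomputable def gammaL : ℝ := ⨅ k, P.gamma k
noncomputable def deltaL : ℝ := ⨅ k, P.delta k
noncomputable def deltaM : ℝ := ⨆ k, P.delta k

/-- The minimal gap between consecutive impulse times. -/
noncomputable def eta : ℝ := ⨅ k : ℤ, (P.t (k + 1) - P.t k)

/-- The maximal gap between consecutive impulse times. -/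
noncomputable def etaBar : ℝ := ⨆ k : ℤ, (P.t (k + 1) - P.t k)

/-- The maximal delay, i.e. the maximum of `T` and of the suprema of all the delays. -/
noncomputable def maxDelay : ℝ := max P.T (⨆ i, max (⨆ s, P.tau i s) (⨆ s, P.sig i s))

/-- The set of all the products `∏_{i = q}^{p} (1 + gamma i)`, `q ≤ p`. -/
def gammaProducts : Set ℝ :=
  {y | ∃ q p : ℤ, q ≤ p ∧ y = ∏ i ∈ Finset.Icc q p, (1 + P.gamma i)}

noncomputable def GammaM : ℝ := sSup P.gammaProducts
noncomputable def GammaL : ℝ := sInf P.gammaProducts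
noncomputable def A : ℝ := max P.GammaM 1
noncomputable def B : ℝ := min P.GammaL 1

noncomputable def M₁ : ℝ :=
  P.A / P.aL * ∑ i, (P.bM i + P.cM i - P.HL i)
    + P.A * max P.deltaM 0 / (1 - Real.exp (-(P.aL * P.eta)))

noncomputable def M₂ : ℝ :=
  P.B / P.aM * ∑ i, (P.bL i / (1 + P.M₁ ^ P.alpha i) + P.cL i / (1 + P.M₁ ^ P.beta i) - P.HM i)
    + if 0 ≤ P.deltaL then
        P.B * P.deltaL * Real.exp (-(P.aM * P.etaBar)) / (1 - Real.exp (-(P.aM * P.etaBar)))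
      else P.A * P.deltaL / (1 - Real.exp (-(P.aL * P.eta)))

noncomputable def KStar (i : Fin m) : ℝ :=
  sSup ((fun x : ℝ => P.alpha i * x ^ (P.alpha i - 1)) '' Icc P.M₂ P.M₁)

noncomputable def GStar (i : Fin m) : ℝ :=
  sSup ((fun x : ℝ => P.beta i * x ^ (P.beta i - 1)) '' Icc P.M₂ P.M₁)

/-! ### Assumptions -/

def DecayAssumption : Prop := BohrAlmostPeriodic P.a ∧ 0 < P.aL

def ProductionAssumption : Prop :=
  ∀ i, (∀ s, 0 ≤ P.b i s) ∧ (∀ s, 0 ≤ P.c i s) ∧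
    BohrAlmostPeriodic (P.b i) ∧ BohrAlmostPeriodic (P.c i)

/-- The harvesting terms are nonnegative, bounded, almost periodic in time, and Lipschitz in the
state variable with constants `L i`, on `ℝ × [0, ∞)`. -/
def HarvestAssumption (L : Fin m → ℝ) : Prop :=
  ∀ i, (∀ s x, 0 ≤ x → 0 ≤ P.H i s x) ∧
    (∃ C : ℝ, ∀ s x, 0 ≤ x → P.H i s x ≤ C) ∧
    BohrAlmostPeriodicUniformly (P.H i) ∧
    0 < L i ∧
    ∀ s x y, 0 ≤ x → 0 ≤ y → |P.H i s x - P.H i s y| ≤ L i * |x - y|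

/-- A delay that is almost periodic and differentiable, with bounded derivative, and such that
`inf (1 - d') > 0`. -/
def IsRegularDelay (d : ℝ → ℝ) : Prop :=
  BohrAlmostPeriodic d ∧ Differentiable ℝ d ∧ (∃ C : ℝ, ∀ s, |deriv d s| ≤ C) ∧
    0 < ⨅ s, (1 - deriv d s)

def DelayAssumption : Prop := ∀ i, IsRegularDelay (P.tau i) ∧ IsRegularDelay (P.sig i)

def ImpulseShiftAssumption : Prop := AlmostPeriodicSeq P.delta

def ImpulseFactorAssumption : Prop :=
  AlmostPeriodicSeq P.gamma ∧ -1 < P.gammaL ∧ BddAbove P.gammaProducts ∧ 0 < P.GammaL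

def ImpulseTimeAssumption : Prop := UniformlyAlmostPeriodicGaps P.t ∧ 0 < P.eta

/-! ### Solutions -/

/-- The right-hand side of the differential equation, for a function `x` at time `s`. -/
noncomputable def rhs (x : ℝ → ℝ) (s : ℝ) : ℝ :=
  -(P.a s * x s) + ∑ i, (P.b i s / (1 + x (s - P.tau i s) ^ P.alpha i)
    + P.c i s * (∫ r in (0 : ℝ)..P.T, P.v i r / (1 + x (s - r) ^ P.beta i))
    - P.H i s (x (s - P.sig i s)))

/-- The times `s` at which neither `s` nor one of the delayed times `s - tau i s`, `s - sig i s` is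
an impulse time. At the (isolated) other times the right-hand side of the equation may jump. -/
def RegularTime (s : ℝ) : Prop :=
  ∀ k, s ≠ P.t k ∧ ∀ i, s - P.tau i s ≠ P.t k ∧ s - P.sig i s ≠ P.t k

/-- The impulse condition at `t k`; functions are left continuous, so `x (t k -) = x (t k)`. -/
def ImpulseAt (x : ℝ → ℝ) (k : ℤ) : Prop :=
  ∃ r : ℝ, Tendsto x (𝓝[>] (P.t k)) (𝓝 r) ∧
    r - x (P.t k) = P.gamma k * x (P.t k) + P.delta k

/-- Solutions on the whole line. Solutions take values in `[0, ∞)`, where the real powers and the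
harvesting terms of the equation are meant. -/
structure IsSolution (x : ℝ → ℝ) : Prop where
  plc : PLC P.t univ x
  nonneg : ∀ s, 0 ≤ x s
  hasDerivAt : ∀ s, P.RegularTime s → HasDerivAt x (P.rhs x s) s
  impulse : ∀ k, P.ImpulseAt x k

/-- Initial functions `ξ` on `[t₀ - maxDelay, t₀]`: nonnegative, and positive at `t₀`. -/
structure IsInitialFunction (t₀ : ℝ) (ξ : ℝ → ℝ) : Prop where
  plc : PLC P.t (Icc (t₀ - P.maxDelay) t₀) ξ
  nonneg : ∀ s ∈ Ico (t₀ - P.maxDelay) t₀, 0 ≤ ξ s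
  pos : 0 < ξ t₀

/-- Solutions on `[t₀ - maxDelay, ∞)` of the initial value problem with initial function `ξ`. Only
the values of `x` on `[t₀ - maxDelay, ∞)` matter. -/
structure IsSolutionFrom (t₀ : ℝ) (ξ x : ℝ → ℝ) : Prop where
  plc : PLC P.t (Ici (t₀ - P.maxDelay)) x
  initial : EqOn x ξ (Icc (t₀ - P.maxDelay) t₀)
  nonneg : ∀ s, t₀ ≤ s → 0 ≤ x s
  hasDerivAt : ∀ s, t₀ < s → P.RegularTime s → HasDerivAt x (P.rhs x s) s
  impulse : ∀ k, t₀ ≤ P.t k → P.ImpulseAt x k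

/-- Positive almost periodic solutions. -/
def IsPositiveAlmostPeriodicSolution (x : ℝ → ℝ) : Prop :=
  P.IsSolution x ∧ PLCAlmostPeriodic P.t x ∧ ∀ s, 0 < x s

end HematopoiesisModel

/-! ### Finite colourings and common almost periods -/

/-! Freeze the delayed terms along a nonnegative function φ. The model becomes a linear impulsive
equation u' = -a u + f, u(t_k+) = (1 + γ_k) u(t_k) + δ_k, with f the `forcing` of φ. Its solutions
are described by variation of constants on each interval (t_k, t_{k+1}] (`MildOn`), so f need only
be bounded and measurable; this matters because delayed states jump. As a ≥ a_L > 0 and products of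
the impulse factors stay in [B, A], the past is forgotten exponentially and a bounded solution on
the whole line exists (`exists_bounded_mildOn`).

The constants M₁ and M₂ come from telescoping. Transported to a final time s, u(s) is a remnant of
the past plus one pulse per interval (jump and forcing), weighted by the product of the later
impulse factors. If each weighted pulse is at most U(k + 1) - U(k), the sum telescopes
(`le_of_pulse_le`); suitable U give the bound M₁ for every input φ ≥ 0 and the bound M₂ for inputs
with 0 ≤ φ ≤ M₁. The delicate case is a negative upper bound for the forcing, where replacing
weights and decay rates by their extremes goes the wrong way; there M₂ > 0 still makes the
comparison pulses nonnegative (`upper_condition`, `pulse_le`).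

On [M₂, M₁] the forcing is Lipschitz, and the difference of two solutions solves a linear equation
without additive jumps. Hence φ ↦ u is a contraction in the supremum norm (`abs_mildOn_sub_le`,
`contraction_lt`). The fixed point is sought among all measurable functions with values in [M₂, M₁]
(`exists_mildOn_self`), not among almost periodic ones. An almost periodic solution is bounded at
the impulse times, hence lies in [M₂, M₁], hence equals the fixed point (`eq_of_mildOn_self`).

Almost periodicity is proved afterwards. Finite colourings and the pigeonhole principle provide real
almost periods w and index shifts q common to all the data (`relativelyDense_common`). Let θ be the
piecewise affine map with θ(t_k) = t_{k+q}. Then x ∘ θ jumps exactly at the times t_k and solves a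
perturbed linear equation (`mildOn_timeChange`). Its forcing differs from that of x by a small
amount, except when a delayed argument is close to an impulse time. Such arguments occupy little
time, because s - τ(s) has slope bounded below, and little mass of the kernels v_i, by absolute
continuity of the integral. So D = sup |x ∘ θ - x| satisfies D ≤ κ D + small with κ < 1
(`exists_abs_timeChange_sub_le`).

For stability, a solution of an initial value problem eventually enters [M₂ - e, M₁ + e]
(`eventually_mem`), where e is so small that the contraction constant stays below 1; a supremum with
exponential weight then closes the estimate (`exists_exp_decay`). -/

/-- `X` can be partitioned into finitely many classes on each of which `R` holds. -/
def FinitelyColored {X : Type*} (R : X → X → Prop) : Prop :=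
  ∃ (κ : Type) (_ : Finite κ) (c : X → κ), ∀ x y, c x = c y → R x y

theorem FinitelyColored.and {X : Type*} {R S : X → X → Prop} (hR : FinitelyColored R)
    (hS : FinitelyColored S) : FinitelyColored fun x y => R x y ∧ S x y := by
  obtain ⟨κ, _, c, hc⟩ := hR
  obtain ⟨κ', _, c', hc'⟩ := hS
  exact ⟨κ × κ', inferInstance, fun x => (c x, c' x), fun x y h =>
    ⟨hc x y (congrArg Prod.fst h), hc' x y (congrArg Prod.snd h)⟩⟩

theorem FinitelyColored.forall_fin {X : Type*} {m : ℕ} {R : Fin m → X → X → Prop}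
    (hR : ∀ i, FinitelyColored (R i)) : FinitelyColored fun x y => ∀ i, R i x y := by
  choose κ hκ c hc using hR
  exact ⟨∀ i, κ i, inferInstance, fun x i => c i x, fun x y h i => hc i x y (congrFun h i)⟩

theorem FinitelyColored.comp {X Y : Type*} {R : X → X → Prop} (hR : FinitelyColored R)
    (f : Y → X) : FinitelyColored fun x y => R (f x) (f y) := by
  obtain ⟨κ, hκ, c, hc⟩ := hR
  exact ⟨κ, hκ, c ∘ f, fun x y h => hc _ _ h⟩

/-- Bohr almost periodic maps with values in a metric space. -/
def AlmostPeriodicMap {E : Type*} [PseudoMetricSpace E] (f : ℝ → E) : Prop :=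
  Continuous f ∧ ∀ ε : ℝ, 0 < ε → RelativelyDense {w : ℝ | ∀ t : ℝ, dist (f (t + w)) (f t) < ε}

theorem BohrAlmostPeriodic.almostPeriodicMap {f : ℝ → ℝ} (h : BohrAlmostPeriodic f) :
    AlmostPeriodicMap f :=
  ⟨h.1, fun ε hε => by simpa only [Real.dist_eq] using h.2 ε hε⟩

/-- Uniformity in the state is absorbed into the target: as a map into the metric space C([0, M]),
H_i is an ordinary almost periodic function and is treated like the other coefficients. -/
theorem BohrAlmostPeriodicUniformly.almostPeriodicMap {F : ℝ → ℝ → ℝ}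
    (h : BohrAlmostPeriodicUniformly F) (M : ℝ) :
    ∃ f : ℝ → C(Icc (0 : ℝ) M, ℝ), AlmostPeriodicMap f ∧ ∀ s x, f s x = F s x := by
  have hc : Continuous fun p : ℝ × Icc (0 : ℝ) M => F p.1 p.2 := by
    have : Continuous fun p : ℝ × Icc (0 : ℝ) M => (p.1, (p.2 : ℝ)) := by fun_prop
    exact h.1.comp_continuous this fun p => ⟨mem_univ _, p.2.2.1⟩
  let f : C(ℝ, C(Icc (0 : ℝ) M, ℝ)) := ContinuousMap.curry ⟨_, hc⟩
  have hf : ∀ s x, f s x = F s x := fun s x => rfl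
  refine ⟨f, ⟨f.continuous, fun ε hε => ?_⟩, hf⟩
  obtain ⟨l, hl, H⟩ := h.2 (Icc 0 M) isCompact_Icc (fun x hx => hx.1) ε hε
  refine ⟨l, hl, fun x => ?_⟩
  obtain ⟨w, hw, hw'⟩ := H x
  refine ⟨w, fun t => ?_, hw'⟩
  rw [ContinuousMap.dist_lt_iff hε]
  intro x
  rw [hf, hf, Real.dist_eq]
  exact hw t x x.2

section

variable {E : Type*} [PseudoMetricSpace E] {f : ℝ → E}

/-- One almost period moves both points into a fixed compact interval, where uniform continuity
holds. -/
theorem AlmostPeriodicMap.uniform (h : AlmostPeriodicMap f) {ε : ℝ} (hε : 0 < ε) :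
    ∃ d : ℝ, 0 < d ∧ ∀ s s', |s - s'| < d → dist (f s) (f s') < ε := by
  obtain ⟨l, hl, H⟩ := h.2 (ε / 3) (by positivity)
  have hu := (isCompact_Icc (a := (-1 : ℝ)) (b := l + 1)).uniformContinuousOn_of_continuous
    h.1.continuousOn
  obtain ⟨d, hd, hd'⟩ := Metric.uniformContinuousOn_iff.1 hu (ε / 3) (by positivity)
  refine ⟨min d 1, by positivity, fun s s' hs => ?_⟩
  obtain ⟨w, hw, h1, h2⟩ := H (-s)
  have h3 := abs_lt.1 (hs.trans_le (min_le_right _ _))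
  have h4 := hd' (s + w) ⟨by linarith, by linarith⟩ (s' + w) ⟨by linarith, by linarith⟩
    (by rw [Real.dist_eq, add_sub_add_right_eq_sub]; exact hs.trans_le (min_le_left _ _))
  have h5 := hw s
  have h6 := hw s'
  rw [dist_comm] at h5
  have := dist_triangle4 (f s) (f (s + w)) (f (s' + w)) (f s')
  linarith

/-- This is total boundedness of the set of translates. Subtracting an almost period reduces each
shift to a remainder in [0, l]; remainders in the same cell of a fine grid give close translates. -/
theorem AlmostPeriodicMap.finitelyColored (h : AlmostPeriodicMap f) {ε : ℝ} (hε : 0 < ε) :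
    FinitelyColored fun s s' : ℝ => ∀ t, dist (f (t + s)) (f (t + s')) < ε := by
  obtain ⟨d, hd, hd'⟩ := h.uniform (ε := ε / 3) (by positivity)
  obtain ⟨l, hl, H⟩ := h.2 (ε / 3) (by positivity)
  choose w hw h1 h2 using fun s => H (s - l)
  have hN : ∀ s, ⌊(s - w s) / d⌋₊ < ⌊l / d⌋₊ + 1 := fun s => by
    have : (s - w s) / d ≤ l / d := by
      gcongr; linarith [h1 s]
    exact Nat.lt_succ_of_le (Nat.floor_mono this)
  refine ⟨Fin (⌊l / d⌋₊ + 1), inferInstance, fun s => ⟨_, hN s⟩, fun s s' hs t => ?_⟩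
  have hs : ⌊(s - w s) / d⌋₊ = ⌊(s' - w s') / d⌋₊ := by simpa using hs
  have e1 : |(s - w s) - (s' - w s')| < d := by
    have p1 : 0 ≤ (s - w s) / d := div_nonneg (by linarith [h2 s]) hd.le
    have p2 : 0 ≤ (s' - w s') / d := div_nonneg (by linarith [h2 s']) hd.le
    have a1 := Nat.floor_le p1
    have a2 := Nat.lt_floor_add_one ((s - w s) / d)
    have b1 := Nat.floor_le p2
    have b2 := Nat.lt_floor_add_one ((s' - w s') / d)
    rw [hs] at a1 a2
    have : |((s - w s) - (s' - w s')) / d| < 1 := by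
      rw [sub_div, abs_lt]; constructor <;> linarith
    rwa [abs_div, abs_of_pos hd, div_lt_one hd] at this
  have e2 := hd' (t + (s - w s)) (t + (s' - w s')) (by rwa [add_sub_add_left_eq_sub])
  have e3 := hw s (t + (s - w s))
  have e4 := hw s' (t + (s' - w s'))
  rw [show t + (s - w s) + w s = t + s by ring] at e3
  rw [show t + (s' - w s') + w s' = t + s' by ring, dist_comm] at e4
  have := dist_triangle4 (f (t + s)) (f (t + (s - w s))) (f (t + (s' - w s'))) (f (t + s'))
  linarith

end

theorem BohrAlmostPeriodic.bounded {f : ℝ → ℝ} (h : BohrAlmostPeriodic f) :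
    ∃ C : ℝ, ∀ s, |f s| ≤ C := by
  obtain ⟨l, hl, H⟩ := h.2 1 one_pos
  obtain ⟨C, hC⟩ := (isCompact_Icc (a := (0 : ℝ)) (b := l)).exists_bound_of_continuousOn
    h.1.continuousOn
  refine ⟨C + 1, fun s => ?_⟩
  obtain ⟨w, hw, h1, h2⟩ := H (-s)
  have h3 := hC (s + w) ⟨by linarith, by linarith⟩
  have h4 := hw s
  rw [Real.norm_eq_abs] at h3
  rw [abs_lt] at h4
  rw [abs_le] at h3 ⊢
  constructor <;> linarith

theorem AlmostPeriodicSeq.finitelyColored {z : ℤ → ℝ} (h : AlmostPeriodicSeq z) {ε : ℝ}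
    (hε : 0 < ε) : FinitelyColored fun n n' : ℤ => ∀ k, |z (k + n) - z (k + n')| < ε := by
  obtain ⟨l, hl, H⟩ := h (ε / 2) (by positivity)
  choose w hw h1 h2 using fun s => H (s - l)
  refine ⟨Icc (0 : ℤ) l, inferInstance,
    fun s => ⟨s - w s, by linarith [h2 s], by linarith [h1 s]⟩, fun s s' hs t => ?_⟩
  have hs : s - w s = s' - w s' := congrArg Subtype.val hs
  have e3 := hw s (t + (s - w s))
  have e4 := hw s' (t + (s' - w s'))
  rw [show t + (s - w s) + w s = t + s by ring] at e3
  rw [show t + (s' - w s') + w s' = t + s' by ring, ← hs] at e4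
  rw [abs_lt] at *
  constructor <;> linarith

theorem AlmostPeriodicSeq.bounded {z : ℤ → ℝ} (h : AlmostPeriodicSeq z) :
    ∃ C : ℝ, ∀ k, |z k| ≤ C := by
  obtain ⟨κ, _, c, hc⟩ := h.finitelyColored one_pos
  have hfin : (range c).Finite := toFinite _
  choose r hr using fun x : range c => x.2
  have : Finite (range c) := hfin
  obtain ⟨C, hC⟩ := (finite_range fun x => |z (r x)|).bddAbove
  refine ⟨C + 1, fun k => ?_⟩
  have h1 := hc k (r ⟨c k, mem_range_self k⟩) (hr ⟨c k, mem_range_self k⟩).symm 0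
  have h2 := hC ⟨⟨c k, mem_range_self k⟩, rfl⟩
  simp only [zero_add] at h1 h2
  rw [abs_lt] at h1
  rw [abs_le] at h2 ⊢
  constructor <;> linarith

theorem UniformlyAlmostPeriodicGaps.finitelyColored {t : ℤ → ℝ}
    (h : UniformlyAlmostPeriodicGaps t) {ε : ℝ} (hε : 0 < ε) :
    FinitelyColored fun n n' : ℤ => ∀ p, |(t (n + p) - t n) - (t (n' + p) - t n')| < ε := by
  obtain ⟨l, hl, H⟩ := h (ε / 2) (by positivity)
  choose w hw h1 h2 using fun s => H (s - l)
  refine ⟨Icc (0 : ℤ) l, inferInstance,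
    fun s => ⟨s - w s, by linarith [h2 s], by linarith [h1 s]⟩, fun s s' hs p => ?_⟩
  have hs : s - w s = s' - w s' := congrArg Subtype.val hs
  have e3 := hw s p (s - w s)
  have e4 := hw s' p (s' - w s')
  rw [show (s - w s) + w s = s by ring] at e3
  rw [show (s' - w s') + w s' = s' by ring, ← hs] at e4
  rw [abs_lt] at *
  constructor <;> linarith

theorem UniformlyAlmostPeriodicGaps.almostPeriodicSeq {t : ℤ → ℝ}
    (h : UniformlyAlmostPeriodicGaps t) : AlmostPeriodicSeq fun k => t (k + 1) - t k := by
  intro ε hε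
  obtain ⟨l, hl, H⟩ := h ε hε
  refine ⟨l, hl, fun x => ?_⟩
  obtain ⟨w, hw, hw'⟩ := H x
  exact ⟨w, fun k => hw 1 k, hw'⟩

/-- Almost periods common to the impulse times, to a property of real shifts and to a property of
integer shifts. -/
theorem relativelyDense_common {t : ℤ → ℝ} (ht : UniformlyAlmostPeriodicGaps t) {G : ℝ}
    (hgap : ∀ k, t (k + 1) - t k ≤ G) (htop : Tendsto t atTop atTop) (hbot : Tendsto t atBot atBot)
    (hmono : StrictMono t) {R : ℝ → ℝ → Prop} (hR : FinitelyColored R) {S : ℤ → ℤ → Prop}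
    (hS : FinitelyColored S) {ε : ℝ} (hε : 0 < ε) :
    RelativelyDense {w : ℝ | ∃ (q n n' : ℤ) (s s' : ℝ), q = n - n' ∧ w = s - s' ∧ R s s' ∧ S n n' ∧
      ∀ k, |t (k + q) - t k - w| < ε} := by
  -- Each index n is coloured by the real shift t n, the integer shift n and the gap sequence seen
  -- from n. Two indices of one colour give the coupled pair w = t n - t n', q = n - n'.
  obtain ⟨κ, _, c, hc⟩ := ((hR.comp t).and hS).and (ht.finitelyColored hε)
  choose r hr using fun x : range c => x.2
  obtain ⟨C, hC⟩ := (finite_range fun x => |t (r x)|).bddAbove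
  have hC' : ∀ x, |t (r x)| ≤ C := fun x => hC ⟨x, rfl⟩
  have hC0 : 0 ≤ C := (abs_nonneg _).trans (hC' ⟨c 0, mem_range_self 0⟩)
  have hG0 : 0 < G := (sub_pos.2 (hmono (lt_add_one 0))).trans_le (hgap 0)
  -- The finitely many colour representatives have times in [-C, C], and bounded gaps put some t n
  -- into [x + C, x + C + G]; the difference then lies in [x, x + 2C + G].
  refine ⟨2 * C + G, by positivity, fun x => ?_⟩
  obtain ⟨n, hn1, hn2⟩ : ∃ n, x + C ≤ t n ∧ t n ≤ x + C + G := by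
    obtain ⟨n, hn, hmin⟩ := Int.exists_least_of_bdd (P := fun n => x + C ≤ t n)
      (by
        obtain ⟨b, hb⟩ := (hbot.eventually (eventually_lt_atBot (x + C))).exists
        exact ⟨b, fun z hz => by
          by_contra! h
          exact absurd (hmono h) (by linarith)⟩)
      (htop.eventually (eventually_ge_atTop (x + C))).exists
    refine ⟨n, hn, ?_⟩
    have h1 : t (n - 1) < x + C := by
      by_contra! h
      have := hmin _ h
      lia
    have h2 := hgap (n - 1)
    rw [sub_add_cancel] at h2
    linarith
  set n' := r ⟨c n, mem_range_self n⟩ with hn'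
  obtain ⟨⟨h1, h2⟩, h3⟩ := hc n n' (hr ⟨c n, mem_range_self n⟩).symm
  have h4 := abs_le.1 (hC' ⟨c n, mem_range_self n⟩)
  refine ⟨t n - t n', ⟨n - n', n, n', t n, t n', rfl, rfl, h1, h2, fun k => ?_⟩, ?_, ?_⟩
  · have := h3 (k - n')
    rw [show n + (k - n') = k + (n - n') by ring, show n' + (k - n') = k by ring] at this
    rwa [show t (k + (n - n')) - t k - (t n - t n') = t (k + (n - n')) - t n - (t k - t n') by ring]
  · linarith
  · linarith

/-! ### Linear impulsive equations -/

/-- The coefficients of the linear impulsive equation `u' = -a u`, `u (t k +) = (1 + γ k) u (t k)`,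
together with bounds for them. -/
structure LinearImpulsive (a : ℝ → ℝ) (t γ : ℤ → ℝ) (aL aM η η' A B : ℝ) : Prop where
  cont : Continuous a
  aL_pos : 0 < aL
  aL_le : ∀ s, aL ≤ a s
  le_aM : ∀ s, a s ≤ aM
  eta_pos : 0 < η
  eta_le : ∀ k, η ≤ t (k + 1) - t k
  le_eta' : ∀ k, t (k + 1) - t k ≤ η'
  tendsto_atTop : Tendsto t atTop atTop
  tendsto_atBot : Tendsto t atBot atBot
  factor_pos : ∀ k, 0 < 1 + γ k
  B_pos : 0 < B
  B_le_one : B ≤ 1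
  one_le_A : 1 ≤ A
  le_prod : ∀ q p : ℤ, q ≤ p → B ≤ ∏ i ∈ Finset.Icc q p, (1 + γ i)
  prod_le : ∀ q p : ℤ, q ≤ p → ∏ i ∈ Finset.Icc q p, (1 + γ i) ≤ A

/-- `expDecay a r s = exp (-∫ r..s a)`. -/
noncomputable def expDecay (a : ℝ → ℝ) (r s : ℝ) : ℝ := Real.exp (-∫ z in r..s, a z)

/-- The variation of constants formula on the interval `(t k, t (k + 1)]` for the equation
`u' = -a u + f`, `u (t k +) = (1 + γ k) u (t k) + d k`. -/
def MildOn (a : ℝ → ℝ) (t γ : ℤ → ℝ) (f : ℝ → ℝ) (d : ℤ → ℝ) (u : ℝ → ℝ) (k : ℤ) : Prop :=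
  ∀ s ∈ Ioc (t k) (t (k + 1)),
    u s = expDecay a (t k) s * ((1 + γ k) * u (t k) + d k) + ∫ r in t k..s, expDecay a r s * f r

/-- Bounded measurable functions. -/
def BddMeas (f : ℝ → ℝ) : Prop := Measurable f ∧ ∃ C, ∀ s, |f s| ≤ C

theorem BddMeas.neg {f : ℝ → ℝ} (h : BddMeas f) : BddMeas fun s => -f s :=
  ⟨h.1.neg, h.2.imp fun _ hC s => by rw [abs_neg]; exact hC s⟩

theorem BddMeas.add {f g : ℝ → ℝ} (hf : BddMeas f) (hg : BddMeas g) :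
    BddMeas fun s => f s + g s := by
  obtain ⟨C, hC⟩ := hf.2
  obtain ⟨D, hD⟩ := hg.2
  exact ⟨hf.1.add hg.1, C + D, fun s => (abs_add_le _ _).trans (add_le_add (hC s) (hD s))⟩

theorem BddMeas.sub {f g : ℝ → ℝ} (hf : BddMeas f) (hg : BddMeas g) :
    BddMeas fun s => f s - g s := by
  simpa only [sub_eq_add_neg] using hf.add hg.neg

theorem BddMeas.mul {f g : ℝ → ℝ} (hf : BddMeas f) (hg : BddMeas g) :
    BddMeas fun s => f s * g s := by
  obtain ⟨C, hC⟩ := hf.2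
  obtain ⟨D, hD⟩ := hg.2
  exact ⟨hf.1.mul hg.1, C * D, fun s => by
    rw [abs_mul]
    exact mul_le_mul (hC s) (hD s) (abs_nonneg _) ((abs_nonneg _).trans (hC s))⟩

theorem bddMeas_const (c : ℝ) : BddMeas fun _ => c := ⟨measurable_const, |c|, fun _ => le_rfl⟩

theorem BddMeas.sum {m : ℕ} {f : Fin m → ℝ → ℝ} (hf : ∀ i, BddMeas (f i)) :
    BddMeas fun s => ∑ i, f i s := by
  choose h1 C hC using hf
  exact ⟨Finset.measurable_sum _ fun i _ => h1 i, ∑ i, C i, fun s =>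
    (Finset.abs_sum_le_sum_abs _ _).trans (Finset.sum_le_sum fun i _ => hC i s)⟩

theorem BddMeas.abs {f : ℝ → ℝ} (h : BddMeas f) : BddMeas fun s => |f s| :=
  ⟨h.1.abs, h.2.imp fun _ hC s => by rw [abs_abs]; exact hC s⟩

theorem BddMeas.comp {f g : ℝ → ℝ} (h : BddMeas f) (hg : Measurable g) :
    BddMeas fun s => f (g s) :=
  ⟨h.1.comp hg, h.2.imp fun _ hC _ => hC _⟩

theorem BddMeas.intervalIntegrable_mul {f g : ℝ → ℝ} (h : BddMeas f) (hg : Continuous g)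
    (x y : ℝ) : IntervalIntegrable (fun s => g s * f s) MeasureTheory.volume x y := by
  obtain ⟨hm, C, hC⟩ := h
  obtain ⟨D, hD⟩ := (isCompact_uIcc (a := x) (b := y)).exists_bound_of_continuousOn hg.continuousOn
  have hi : IntervalIntegrable (fun _ : ℝ => D * C) MeasureTheory.volume x y :=
    intervalIntegrable_const
  refine hi.mono_fun' (hg.measurable.mul hm).aestronglyMeasurable ?_
  refine (MeasureTheory.ae_restrict_iff' measurableSet_uIoc).2 (.of_forall fun s hs => ?_)
  beta_reduce
  rw [norm_mul]
  exact mul_le_mul (hD s (uIoc_subset_uIcc hs)) (hC s) (norm_nonneg _)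
    ((norm_nonneg _).trans (hD s (uIoc_subset_uIcc hs)))

theorem BddMeas.intervalIntegrable {f : ℝ → ℝ} (h : BddMeas f) (x y : ℝ) :
    IntervalIntegrable f MeasureTheory.volume x y := by
  simpa using h.intervalIntegrable_mul (continuous_const (y := (1 : ℝ))) x y

theorem expDecay_pos (a : ℝ → ℝ) (r s : ℝ) : 0 < expDecay a r s := Real.exp_pos _

theorem expDecay_self (a : ℝ → ℝ) (s : ℝ) : expDecay a s s = 1 := by simp [expDecay]

theorem expDecay_mul {a : ℝ → ℝ} (ha : Continuous a) (r s t : ℝ) :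
    expDecay a r s * expDecay a s t = expDecay a r t := by
  rw [expDecay, expDecay, expDecay, ← Real.exp_add, ← neg_add,
    intervalIntegral.integral_add_adjacent_intervals (ha.intervalIntegrable _ _)
      (ha.intervalIntegrable _ _)]

theorem continuous_expDecay {a : ℝ → ℝ} (ha : Continuous a) (s : ℝ) :
    Continuous fun r => expDecay a r s := by
  have h : (fun r => expDecay a r s) = fun r => Real.exp (∫ z in s..r, a z) := by
    ext r; rw [expDecay, intervalIntegral.integral_symm, neg_neg]
  rw [h]
  exact Real.continuous_exp.comp
    (intervalIntegral.continuous_primitive (fun x y => ha.intervalIntegrable x y) s)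

theorem hasDerivAt_expDecay {a : ℝ → ℝ} (ha : Continuous a) (r s : ℝ) :
    HasDerivAt (fun s => expDecay a r s) (-(a s * expDecay a r s)) s := by
  have h : HasDerivAt (fun s => expDecay a r s) (expDecay a r s * -a s) s :=
    (intervalIntegral.integral_hasDerivAt_right (ha.intervalIntegrable r s)
    ha.aestronglyMeasurable.stronglyMeasurableAtFilter ha.continuousAt).neg.exp
  exact h.congr_deriv (by ring)

theorem hasDerivAt_expDecay_left {a : ℝ → ℝ} (ha : Continuous a) (r s : ℝ) :
    HasDerivAt (fun r => expDecay a r s) (a r * expDecay a r s) r := by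
  have h : HasDerivAt (fun r => expDecay a r s) (expDecay a r s * - -a r) r :=
    (intervalIntegral.integral_hasDerivAt_left (ha.intervalIntegrable r s)
    ha.aestronglyMeasurable.stronglyMeasurableAtFilter ha.continuousAt).neg.exp
  exact h.congr_deriv (by ring)

theorem expDecay_const (c r s : ℝ) : expDecay (fun _ => c) r s = Real.exp (-(c * (s - r))) := by
  rw [expDecay]; simp [mul_comm]

theorem expDecay_le_expDecay {a b : ℝ → ℝ} (ha : Continuous a) (hb : Continuous b)
    (h : ∀ s, a s ≤ b s) {r s : ℝ} (hrs : r ≤ s) : expDecay b r s ≤ expDecay a r s := by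
  rw [expDecay, expDecay, Real.exp_le_exp, neg_le_neg_iff]
  exact intervalIntegral.integral_mono hrs (ha.intervalIntegrable _ _) (hb.intervalIntegrable _ _) h

theorem integral_mul_expDecay {a : ℝ → ℝ} (ha : Continuous a) (x y s : ℝ) :
    ∫ r in x..y, a r * expDecay a r s = expDecay a y s - expDecay a x s :=
  intervalIntegral.integral_eq_sub_of_hasDerivAt (fun r _ => hasDerivAt_expDecay_left ha r s)
    ((ha.mul (continuous_expDecay ha s)).intervalIntegrable _ _)

theorem integral_expDecay_const {c : ℝ} (hc : c ≠ 0) (x y s : ℝ) :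
    ∫ r in x..y, expDecay (fun _ => c) r s =
      (expDecay (fun _ => c) y s - expDecay (fun _ => c) x s) / c := by
  rw [← integral_mul_expDecay continuous_const, intervalIntegral.integral_const_mul,
    mul_div_cancel_left₀ _ hc]

theorem integral_expDecay_const_mul {c : ℝ} (hc : c ≠ 0) (x y s S : ℝ) :
    ∫ r in x..y, expDecay (fun _ => c) r s * S =
      S / c * (expDecay (fun _ => c) y s - expDecay (fun _ => c) x s) := by
  rw [intervalIntegral.integral_mul_const, integral_expDecay_const hc]; ring

theorem MildOn.sub {a : ℝ → ℝ} (ha : Continuous a) {t γ : ℤ → ℝ} {f f' : ℝ → ℝ} {d d' : ℤ → ℝ}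
    {u u' : ℝ → ℝ} {k : ℤ} (hf : BddMeas f) (hf' : BddMeas f') (h : MildOn a t γ f d u k)
    (h' : MildOn a t γ f' d' u' k) :
    MildOn a t γ (fun s => f s - f' s) (fun k => d k - d' k) (fun s => u s - u' s) k := by
  intro s hs
  have e := intervalIntegral.integral_sub
    (hf.intervalIntegrable_mul (continuous_expDecay ha s) (t k) s)
    (hf'.intervalIntegrable_mul (continuous_expDecay ha s) (t k) s)
  simp only [h s hs, h' s hs, mul_sub]
  rw [e]; ring

theorem MildOn.neg {a : ℝ → ℝ} {t γ : ℤ → ℝ} {f : ℝ → ℝ} {d : ℤ → ℝ} {u : ℝ → ℝ} {k : ℤ}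
    (h : MildOn a t γ f d u k) :
    MildOn a t γ (fun s => -f s) (fun k => -d k) (fun s => -u s) k := by
  intro s hs
  simp only [h s hs, mul_neg, intervalIntegral.integral_neg]
  ring

/-- The fundamental multiplier of the impulses. -/
theorem exists_multiplier {γ : ℤ → ℝ} {A B : ℝ} (hpos : ∀ k, 0 < 1 + γ k) (hA : 1 ≤ A) (hB : B ≤ 1)
    (hBp : ∀ q p : ℤ, q ≤ p → B ≤ ∏ i ∈ Finset.Icc q p, (1 + γ i))
    (hAp : ∀ q p : ℤ, q ≤ p → ∏ i ∈ Finset.Icc q p, (1 + γ i) ≤ A) :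
    ∃ g : ℤ → ℝ, (∀ k, 0 < g k) ∧ (∀ k, g (k + 1) = (1 + γ k) * g k) ∧
      ∀ j k, j ≤ k → g k / g j ∈ Icc B A := by
  have hstep : ∀ q p : ℤ, q ≤ p → ∏ i ∈ Finset.Ico q (p + 1), (1 + γ i) =
      (∏ i ∈ Finset.Ico q p, (1 + γ i)) * (1 + γ p) := by
    intro q p hqp
    have : Finset.Ico q (p + 1) = insert p (Finset.Ico q p) := by ext; simp; lia
    rw [this, Finset.prod_insert (by simp), mul_comm]
  have hprod : ∀ q p : ℤ, 0 < ∏ i ∈ Finset.Ico q p, (1 + γ i) := fun q p =>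
    Finset.prod_pos fun i _ => hpos i
  have hcons : ∀ q p r : ℤ, q ≤ p → p ≤ r → (∏ i ∈ Finset.Ico q p, (1 + γ i)) *
      ∏ i ∈ Finset.Ico p r, (1 + γ i) = ∏ i ∈ Finset.Ico q r, (1 + γ i) := by
    intro q p r h1 h2
    rw [← Finset.prod_union]
    · congr 1; ext; simp; lia
    · rw [Finset.disjoint_left]; intro x; simp; lia
  -- For every k at least one of the two products is empty, so g k is a product of factors for k ≥ 0
  -- and the reciprocal of one for k ≤ 0.
  let g : ℤ → ℝ := fun k => (∏ i ∈ Finset.Ico 0 k, (1 + γ i)) / ∏ i ∈ Finset.Ico k 0, (1 + γ i)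
  have hg : ∀ k, 0 < g k := fun k => div_pos (hprod _ _) (hprod _ _)
  have hgg : ∀ j k, j ≤ k → g k = (∏ i ∈ Finset.Ico j k, (1 + γ i)) * g j := by
    intro j k hjk
    have e1 : ∀ x y : ℤ, y ≤ x → ∏ i ∈ Finset.Ico x y, (1 + γ i) = 1 := fun x y h => by
      rw [Finset.Ico_eq_empty (by lia), Finset.prod_empty]
    simp only [g]
    rcases le_total 0 j with h | h
    · rw [e1 j 0 h, e1 k 0 (h.trans hjk), ← hcons 0 j k h hjk]; ring
    · rcases le_total 0 k with h' | h'
      · rw [e1 k 0 h', e1 0 j h, ← hcons j 0 k h h']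
        have := (hprod j 0).ne'
        field_simp
      · rw [e1 0 k h', e1 0 j h, ← hcons j k 0 hjk h']
        have := (hprod j k).ne'
        have := (hprod k 0).ne'
        field_simp
  refine ⟨g, hg, fun k => ?_, fun j k hjk => ?_⟩
  · rw [hgg k (k + 1) (by lia), hstep k k le_rfl]; simp
  · rw [hgg j k hjk, mul_div_cancel_right₀ _ (hg j).ne']
    rcases hjk.eq_or_lt with rfl | h
    -- No impulse lies between: the ratio is 1, which is why A and B are compared with 1.
    · simpa using ⟨hB, hA⟩
    · have : Finset.Ico j k = Finset.Icc j (k - 1) := by ext; simp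
      rw [this]
      exact ⟨hBp _ _ (by lia), hAp _ _ (by lia)⟩

/-! ### Telescoping estimates for linear impulsive equations -/

namespace LinearImpulsive

variable {a : ℝ → ℝ} {t γ : ℤ → ℝ} {aL aM η η' A B : ℝ}

theorem strictMono (h : LinearImpulsive a t γ aL aM η η' A B) : StrictMono t :=
  strictMono_int_of_lt_succ fun k => by linarith [h.eta_le k, h.eta_pos]

theorem A_pos (h : LinearImpulsive a t γ aL aM η η' A B) : 0 < A := one_pos.trans_le h.one_le_A

theorem aM_pos (h : LinearImpulsive a t γ aL aM η η' A B) : 0 < aM :=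
  h.aL_pos.trans_le ((h.aL_le 0).trans (h.le_aM 0))

theorem expDecay_le (h : LinearImpulsive a t γ aL aM η η' A B) {r s : ℝ} (hrs : r ≤ s) :
    expDecay a r s ≤ expDecay (fun _ => aL) r s :=
  expDecay_le_expDecay continuous_const h.cont h.aL_le hrs

theorem le_expDecay (h : LinearImpulsive a t γ aL aM η η' A B) {r s : ℝ} (hrs : r ≤ s) :
    expDecay (fun _ => aM) r s ≤ expDecay a r s :=
  expDecay_le_expDecay h.cont continuous_const h.le_aM hrs

/-- One-sided estimates of solutions of linear impulsive equations by telescoping sums. -/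
theorem le_of_pulse_le (h : LinearImpulsive a t γ aL aM η η' A B) {f : ℝ → ℝ} {d : ℤ → ℝ}
    {u : ℝ → ℝ} {N n : ℤ} (hN : N ≤ n) {s : ℝ} (hs : s ∈ Ioc (t n) (t (n + 1)))
    (hu : ∀ k, N ≤ k → k ≤ n → MildOn a t γ f d u k) (U : ℤ → ℝ)
    (hU : ∀ k, N ≤ k → k ≤ n → ∀ x ∈ Icc B A,
      x * (expDecay a (t k) s * d k + ∫ r in t k..min (t (k + 1)) s, expDecay a r s * f r) ≤
        U (k + 1) - U k) :
    ∃ x ∈ Icc B A, u s ≤ x * expDecay a (t N) s * u (t N) + (U (n + 1) - U N) := by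
  obtain ⟨g, hg, hg1, hgr⟩ := exists_multiplier h.factor_pos h.one_le_A h.B_le_one h.le_prod
    h.prod_le
  -- Multiplying by `expDecay a s' s` transports values to the final time s. Exponentials then
  -- compose, and the pulse of interval k acquires the weight g (n + 1) / g (k + 1) in [B, A], the
  -- product of the impulse factors after it.
  have hstep : ∀ k, ∀ s' ∈ Ioc (t k) (t (k + 1)), MildOn a t γ f d u k →
      expDecay a s' s * u s' = expDecay a (t k) s * ((1 + γ k) * u (t k)) +
        (expDecay a (t k) s * d k + ∫ r in t k..s', expDecay a r s * f r) := by
    intro k s' hs' hk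
    have := hk s' hs'
    rw [this, mul_add, ← intervalIntegral.integral_const_mul, ← mul_assoc,
      mul_comm (expDecay a s' s), expDecay_mul h.cont]
    simp_rw [← mul_assoc, mul_comm (expDecay a s' s), expDecay_mul h.cont]
    ring
  have hmono := h.strictMono
  -- the contribution of the values at the impulse times
  have key : ∀ j, N ≤ j → j ≤ n →
      g (n + 1) / g j * expDecay a (t j) s * u (t j) ≤
        g (n + 1) / g N * expDecay a (t N) s * u (t N) + (U j - U N) := by
    intro j hj
    induction j, hj using Int.leInduction with
    | base => intro _; simp
    | succ j hj ih =>
      intro hjn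
      have e := hstep j (t (j + 1)) ⟨hmono (by lia), le_rfl⟩ (hu j hj (by lia))
      have hmin : min (t (j + 1)) s = t (j + 1) :=
        min_eq_left ((hmono.monotone hjn).trans hs.1.le)
      have e2 := hU j hj (by lia) _ (hgr (j + 1) (n + 1) (by lia))
      rw [hmin] at e2
      have e3 : g (n + 1) / g (j + 1) * (1 + γ j) = g (n + 1) / g j := by
        rw [hg1 j]
        have := (hg j).ne'
        have := (h.factor_pos j).ne'
        field_simp
      calc g (n + 1) / g (j + 1) * expDecay a (t (j + 1)) s * u (t (j + 1))
          = g (n + 1) / g (j + 1) * (expDecay a (t (j + 1)) s * u (t (j + 1))) := by ring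
        _ = (g (n + 1) / g (j + 1) * (1 + γ j)) * expDecay a (t j) s * u (t j) +
            g (n + 1) / g (j + 1) * (expDecay a (t j) s * d j +
              ∫ r in t j..t (j + 1), expDecay a r s * f r) := by rw [e]; ring
        _ ≤ _ := by rw [e3]; linarith [ih (by lia)]
  refine ⟨g (n + 1) / g N, hgr _ _ (by lia), ?_⟩
  have e := hstep n s hs (hu n hN le_rfl)
  rw [expDecay_self, one_mul] at e
  have e2 := hU n hN le_rfl _ (hgr (n + 1) (n + 1) le_rfl)
  rw [min_eq_right hs.2, div_self (hg _).ne', one_mul] at e2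
  have e3 : 1 + γ n = g (n + 1) / g n := by rw [hg1, mul_div_cancel_right₀ _ (hg n).ne']
  rw [e, e3]
  calc _ = g (n + 1) / g n * expDecay a (t n) s * u (t n) + (expDecay a (t n) s * d n +
              ∫ r in t n..s, expDecay a r s * f r) := by ring
    _ ≤ _ := by linarith [key n hN le_rfl]

end LinearImpulsive

theorem expDecay_const_le_one {c r s : ℝ} (hc : 0 ≤ c) (hrs : r ≤ s) :
    expDecay (fun _ => c) r s ≤ 1 := by
  rw [expDecay_const, Real.exp_le_one_iff, neg_nonpos]
  exact mul_nonneg hc (sub_nonneg.2 hrs)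

theorem expDecay_const_mono {c r r' s : ℝ} (hc : 0 ≤ c) (hr : r ≤ r') :
    expDecay (fun _ => c) r s ≤ expDecay (fun _ => c) r' s := by
  rw [expDecay_const, expDecay_const, Real.exp_le_exp, neg_le_neg_iff]
  gcongr

theorem one_sub_exp_pos {x : ℝ} (hx : 0 < x) : 0 < 1 - Real.exp (-x) := by
  rw [sub_pos, Real.exp_lt_one_iff, neg_lt_zero]; exact hx

namespace LinearImpulsive

variable {a : ℝ → ℝ} {t γ : ℤ → ℝ} {aL aM η η' A B : ℝ}

/-- Lower counterpart of `le_of_pulse_le`. -/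
theorem le_of_le_pulse (h : LinearImpulsive a t γ aL aM η η' A B) {f : ℝ → ℝ} {d : ℤ → ℝ}
    {u : ℝ → ℝ} {N n : ℤ} (hN : N ≤ n) {s : ℝ} (hs : s ∈ Ioc (t n) (t (n + 1)))
    (hu : ∀ k, N ≤ k → k ≤ n → MildOn a t γ f d u k) (U : ℤ → ℝ)
    (hU : ∀ k, N ≤ k → k ≤ n → ∀ x ∈ Icc B A, U (k + 1) - U k ≤
      x * (expDecay a (t k) s * d k + ∫ r in t k..min (t (k + 1)) s, expDecay a r s * f r)) :
    ∃ x ∈ Icc B A, x * expDecay a (t N) s * u (t N) + (U (n + 1) - U N) ≤ u s := by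
  obtain ⟨x, hx, h1⟩ := h.le_of_pulse_le hN hs (fun k h1 h2 => (hu k h1 h2).neg) (fun k => -U k)
    (fun k h1 h2 x hx => by
      have := hU k h1 h2 x hx
      simp only [mul_neg, intervalIntegral.integral_neg]
      linarith)
  exact ⟨x, hx, by linarith⟩

theorem mul_expDecay_le (h : LinearImpulsive a t γ aL aM η η' A B) {x r s : ℝ} (hx : x ∈ Icc B A)
    (hrs : r ≤ s) : x * expDecay a r s ≤ A * expDecay (fun _ => aL) r s :=
  mul_le_mul hx.2 (h.expDecay_le hrs) (expDecay_pos _ _ _).le h.A_pos.le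

theorem le_mul_expDecay (h : LinearImpulsive a t γ aL aM η η' A B) {x r s : ℝ} (hx : x ∈ Icc B A)
    (hrs : r ≤ s) : B * expDecay (fun _ => aM) r s ≤ x * expDecay a r s :=
  mul_le_mul hx.1 (h.le_expDecay hrs) (expDecay_pos _ _ _).le (h.B_pos.le.trans hx.1)

theorem mul_expDecay_nonneg (h : LinearImpulsive a t γ aL aM η η' A B) {x r s : ℝ}
    (hx : x ∈ Icc B A) : 0 ≤ x * expDecay a r s :=
  mul_nonneg (h.B_pos.le.trans hx.1) (expDecay_pos _ _ _).le

theorem mul_expDecay_mul_le (h : LinearImpulsive a t γ aL aM η η' A B) {x r s : ℝ}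
    (hx : x ∈ Icc B A) (hrs : r ≤ s) (y : ℝ) :
    x * expDecay a r s * y ≤ expDecay (fun _ => aL) r s * (A * |y|) := by
  calc x * expDecay a r s * y ≤ x * expDecay a r s * |y| :=
        mul_le_mul_of_nonneg_left (le_abs_self y) (h.mul_expDecay_nonneg hx)
    _ ≤ A * expDecay (fun _ => aL) r s * |y| :=
        mul_le_mul_of_nonneg_right (h.mul_expDecay_le hx hrs) (abs_nonneg _)
    _ = _ := by ring

theorem exp_eta_pos (h : LinearImpulsive a t γ aL aM η η' A B) :
    0 < 1 - Real.exp (-(aL * η)) := one_sub_exp_pos (mul_pos h.aL_pos h.eta_pos)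

theorem eta'_pos (h : LinearImpulsive a t γ aL aM η η' A B) : 0 < η' :=
  h.eta_pos.trans_le ((h.eta_le 0).trans (h.le_eta' 0))

theorem exp_eta'_pos (h : LinearImpulsive a t γ aL aM η η' A B) :
    0 < 1 - Real.exp (-(aM * η')) := one_sub_exp_pos (mul_pos h.aM_pos h.eta'_pos)

/-- Exponentials at consecutive impulse times dominate a telescoping difference. -/
theorem expDecay_le_telescope (h : LinearImpulsive a t γ aL aM η η' A B) (k : ℤ) (s : ℝ) :
    expDecay (fun _ => aL) (t k) s ≤ 1 / (1 - Real.exp (-(aL * η))) *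
      (expDecay (fun _ => aL) (t k) s - expDecay (fun _ => aL) (t (k - 1)) s) := by
  have h1 : expDecay (fun _ => aL) (t (k - 1)) (t k) ≤ Real.exp (-(aL * η)) := by
    have := h.eta_le (k - 1)
    rw [sub_add_cancel] at this
    rw [expDecay_const, Real.exp_le_exp, neg_le_neg_iff]
    exact mul_le_mul_of_nonneg_left this h.aL_pos.le
  have h2 := expDecay_mul (a := fun _ => aL) continuous_const (t (k - 1)) (t k) s
  have h3 := mul_le_mul_of_nonneg_right h1 (expDecay_pos (fun _ => aL) (t k) s).le
  rw [one_div, inv_mul_eq_div, le_div_iff₀ h.exp_eta_pos]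
  linarith

theorem mem_step (h : LinearImpulsive a t γ aL aM η η' A B) {n k : ℤ} {s : ℝ} (hk : k ≤ n)
    (hs : s ∈ Ioc (t n) (t (n + 1))) : min (t k) s = t k ∧ t k ≤ min (t (k + 1)) s ∧
      min (t (k + 1)) s ≤ s ∧ min (t (k + 1)) s ≤ t (k + 1) ∧ t k ≤ s := by
  have h1 : t k ≤ s := (h.strictMono.monotone hk).trans hs.1.le
  have h2 : t k ≤ t (k + 1) := h.strictMono.monotone (by lia)
  exact ⟨min_eq_left h1, le_min h2 h1, min_le_right _ _, min_le_left _ _, h1⟩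

/-- The same telescoping majorant serves u and -u. The forcing is kept inside the integral, so the
estimate also applies to forcings that are small only outside a short set of times. -/
theorem abs_le_of_mildOn (h : LinearImpulsive a t γ aL aM η η' A B) {f : ℝ → ℝ} {d : ℤ → ℝ}
    {u : ℝ → ℝ} (hf : BddMeas f) {N n : ℤ} (hN : N ≤ n) {s : ℝ} (hs : s ∈ Ioc (t n) (t (n + 1)))
    (hu : ∀ k, N ≤ k → k ≤ n → MildOn a t γ f d u k) {D : ℝ} (hd : ∀ k, |d k| ≤ D) :
    |u s| ≤ expDecay (fun _ => aL) (t N) s * (A * |u (t N)|) +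
      A * D / (1 - Real.exp (-(aL * η))) +
      A * ∫ r in t N..s, expDecay (fun _ => aL) r s * |f r| := by
  have hD : 0 ≤ D := (abs_nonneg _).trans (hd 0)
  have hi : ∀ x y, IntervalIntegrable (fun r => expDecay (fun _ => aL) r s * |f r|)
      MeasureTheory.volume x y :=
    fun x y => hf.abs.intervalIntegrable_mul (continuous_expDecay continuous_const s) x y
  -- The index k - 1 makes the increment equal to the telescoping majorant of the jump at t k; `min
  -- (t k) s` cuts the last interval at s.
  let U : ℤ → ℝ := fun k => A * D / (1 - Real.exp (-(aL * η))) *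
    expDecay (fun _ => aL) (t (k - 1)) s +
      A * ∫ r in t N..min (t k) s, expDecay (fun _ => aL) r s * |f r|
  have hU : ∀ (f' : ℝ → ℝ) (d' : ℤ → ℝ), (BddMeas f') → (∀ r, |f' r| = |f r|) →
      (∀ k, |d' k| = |d k|) → ∀ k, N ≤ k → k ≤ n → ∀ x ∈ Icc B A,
      x * (expDecay a (t k) s * d' k + ∫ r in t k..min (t (k + 1)) s, expDecay a r s * f' r) ≤
        U (k + 1) - U k := by
    intro f' d' hf' hff hdd k h1 h2 x hx
    obtain ⟨m1, m2, m3, m4, m5⟩ := h.mem_step h2 hs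
    have e1 : U (k + 1) - U k = A * D / (1 - Real.exp (-(aL * η))) *
        (expDecay (fun _ => aL) (t k) s - expDecay (fun _ => aL) (t (k - 1)) s) +
        A * ∫ r in t k..min (t (k + 1)) s, expDecay (fun _ => aL) r s * |f r| := by
      simp only [U, m1, add_sub_cancel_right]
      rw [← intervalIntegral.integral_add_adjacent_intervals (hi (t N) (t k))
        (hi (t k) (min (t (k + 1)) s))]
      ring
    rw [e1, mul_add, ← mul_assoc]
    refine add_le_add ?_ ?_
    · calc x * expDecay a (t k) s * d' k ≤ expDecay (fun _ => aL) (t k) s * (A * |d' k|) :=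
          h.mul_expDecay_mul_le hx m5 _
        _ ≤ expDecay (fun _ => aL) (t k) s * (A * D) := by
          have := (expDecay_pos (fun _ => aL) (t k) s).le
          have := h.A_pos.le
          gcongr
          rw [hdd]; exact hd k
        _ ≤ _ := by
          have := mul_le_mul_of_nonneg_right (h.expDecay_le_telescope k s)
            (mul_nonneg h.A_pos.le hD)
          refine this.trans_eq ?_
          ring
    · rw [← intervalIntegral.integral_const_mul, ← intervalIntegral.integral_const_mul]
      refine intervalIntegral.integral_mono_on m2 ?_ ((hi _ _).const_mul _) fun r hr => ?_
      · exact (hf'.intervalIntegrable_mul (continuous_expDecay h.cont s) _ _).const_mul _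
      · rw [← mul_assoc]
        refine (h.mul_expDecay_mul_le hx (hr.2.trans m3) _).trans_eq ?_
        rw [hff]; ring
  have hUN : 0 ≤ U N := by
    simp only [U, (h.mem_step hN hs).1, intervalIntegral.integral_same, mul_zero, add_zero]
    have := h.exp_eta_pos
    have := h.A_pos
    have := (expDecay_pos (fun _ => aL) (t (N - 1)) s).le
    positivity
  have hUn : U (n + 1) ≤ A * D / (1 - Real.exp (-(aL * η))) +
      A * ∫ r in t N..s, expDecay (fun _ => aL) r s * |f r| := by
    simp only [U, min_eq_right hs.2, add_sub_cancel_right]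
    have := h.exp_eta_pos
    have := h.A_pos
    gcongr
    exact mul_le_of_le_one_right (by positivity) (expDecay_const_le_one h.aL_pos.le hs.1.le)
  obtain ⟨x, hx, h1⟩ := h.le_of_pulse_le hN hs hu U (hU f d hf (fun _ => rfl) fun _ => rfl)
  obtain ⟨y, hy, h2⟩ := h.le_of_pulse_le hN hs (fun k h1 h2 => (hu k h1 h2).neg) U
    (hU _ _ hf.neg (fun _ => abs_neg _) fun _ => abs_neg _)
  have h3 := h.mul_expDecay_mul_le hx ((h.mem_step hN hs).2.2.2.2) (u (t N))
  have h4 := h.mul_expDecay_mul_le hy ((h.mem_step hN hs).2.2.2.2) (-u (t N))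
  rw [abs_neg] at h4
  rw [abs_le]
  constructor <;> linarith

/-- As a ≥ a_L, the quotient of the two exponentials with common endpoint s increases in the
starting time. It replaces the direct comparison when the forcing bound is negative. -/
theorem expDecay_cross_le (h : LinearImpulsive a t γ aL aM η η' A B) {p r s : ℝ} (hpr : p ≤ r) :
    expDecay a p s * expDecay (fun _ => aL) r s ≤ expDecay a r s * expDecay (fun _ => aL) p s := by
  rw [← expDecay_mul h.cont p r s, ← expDecay_mul continuous_const p r s]
  have := mul_le_mul_of_nonneg_right (h.expDecay_le hpr)
    (mul_nonneg (expDecay_pos a r s).le (expDecay_pos (fun _ => aL) r s).le)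
  linarith

theorem le_expDecay_cross (h : LinearImpulsive a t γ aL aM η η' A B) {p r s : ℝ} (hpr : p ≤ r) :
    expDecay a r s * expDecay (fun _ => aM) p s ≤ expDecay a p s * expDecay (fun _ => aM) r s := by
  rw [← expDecay_mul h.cont p r s, ← expDecay_mul continuous_const p r s]
  have := mul_le_mul_of_nonneg_right (h.le_expDecay hpr)
    (mul_nonneg (expDecay_pos a r s).le (expDecay_pos (fun _ => aM) r s).le)
  linarith

theorem exp_gap (c p r s : ℝ) :
    expDecay (fun _ => c) r s = expDecay (fun _ => c) p s * Real.exp (c * (r - p)) := by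
  rw [expDecay_const, expDecay_const, ← Real.exp_add]; ring_nf

/-- If S ≥ 0, every factor may be enlarged separately. If S < 0, the actual pulse is at most κ ≤ 1
times the pulse with constant rate a_L; that pulse is nonnegative by `hSD`, since a shorter interval
subtracts less, and only then may its weight x κ be enlarged to A. -/
theorem pulse_le (h : LinearImpulsive a t γ aL aM η η' A B) {f : ℝ → ℝ} (hf : BddMeas f)
    {S D d p r s x : ℝ} (hpr : p ≤ r) (hrs : r ≤ s) (hpr' : r - p ≤ η')
    (hfS : ∀ z, p < z → f z ≤ S) (hd : d ≤ D)
    (hSD : 0 ≤ S ∨ 0 ≤ D ∧ 0 ≤ D + S / aL * (Real.exp (aL * η') - 1)) (hx : x ∈ Icc B A) :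
    x * (expDecay a p s * d + ∫ z in p..r, expDecay a z s * f z) ≤
      A * (expDecay (fun _ => aL) p s * max D 0 + S / aL *
        (expDecay (fun _ => aL) r s - expDecay (fun _ => aL) p s)) := by
  have hx0 : 0 ≤ x := h.B_pos.le.trans hx.1
  have hp := (expDecay_pos a p s).le
  have hpL := expDecay_pos (fun _ => aL) p s
  have hfi := hf.intervalIntegrable_mul (continuous_expDecay h.cont s) p r
  have hEL : ∀ x y, IntervalIntegrable (fun z => expDecay (fun _ => aL) z s * S)
      MeasureTheory.volume x y :=
    fun x y => ((continuous_expDecay continuous_const s).mul continuous_const).intervalIntegrable _ _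
  have hsub : ∀ z ∈ Ioo p r, z ≤ s := fun z hz => hz.2.le.trans hrs
  rw [← integral_expDecay_const_mul h.aL_pos.ne']
  rcases le_or_gt 0 S with hS | hS
  · have i1 : ∫ z in p..r, expDecay a z s * f z ≤
        ∫ z in p..r, expDecay (fun _ => aL) z s * S :=
      intervalIntegral.integral_mono_on_of_le_Ioo hpr hfi (hEL _ _) fun z hz =>
        (mul_le_mul_of_nonneg_left (hfS z hz.1) (expDecay_pos _ _ _).le).trans
          (mul_le_mul_of_nonneg_right (h.expDecay_le (hsub z hz)) hS)
    have i2 : expDecay a p s * d ≤ expDecay (fun _ => aL) p s * max D 0 :=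
      (mul_le_mul_of_nonneg_left (hd.trans (le_max_left D 0)) hp).trans
        (mul_le_mul_of_nonneg_right (h.expDecay_le (hpr.trans hrs)) (le_max_right _ _))
    have i3 : 0 ≤ ∫ z in p..r, expDecay (fun _ => aL) z s * S :=
      intervalIntegral.integral_nonneg hpr fun z _ => mul_nonneg (expDecay_pos _ _ _).le hS
    exact (mul_le_mul_of_nonneg_left (add_le_add i2 i1) hx0).trans
      (mul_le_mul_of_nonneg_right hx.2
        (add_nonneg (mul_nonneg hpL.le (le_max_right _ _)) i3))
  · obtain ⟨hD, hSD⟩ := hSD.resolve_left hS.not_ge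
    rw [max_eq_left hD]
    set κ := expDecay a p s / expDecay (fun _ => aL) p s with hκ
    have hκ0 : 0 ≤ κ := div_nonneg hp hpL.le
    have hκ1 : κ ≤ 1 := (div_le_one hpL).2 (h.expDecay_le (hpr.trans hrs))
    have i1 : ∫ z in p..r, expDecay a z s * f z ≤
        κ * ∫ z in p..r, expDecay (fun _ => aL) z s * S := by
      rw [← intervalIntegral.integral_const_mul]
      refine intervalIntegral.integral_mono_on_of_le_Ioo hpr hfi ((hEL _ _).const_mul _)
        fun z hz => (mul_le_mul_of_nonneg_left (hfS z hz.1) (expDecay_pos _ _ _).le).trans ?_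
      rw [← mul_assoc]
      refine mul_le_mul_of_nonpos_right ?_ hS.le
      rw [hκ, div_mul_eq_mul_div, div_le_iff₀ hpL]
      exact h.expDecay_cross_le hz.1.le
    have i2 : expDecay a p s * d ≤ κ * (expDecay (fun _ => aL) p s * D) := by
      rw [hκ, ← mul_assoc, div_mul_cancel₀ _ hpL.ne']
      exact mul_le_mul_of_nonneg_left hd hp
    have i3 : 0 ≤ expDecay (fun _ => aL) p s * D +
        ∫ z in p..r, expDecay (fun _ => aL) z s * S := by
      rw [integral_expDecay_const_mul h.aL_pos.ne', exp_gap aL p r s]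
      have : D + S / aL * (Real.exp (aL * η') - 1) ≤
          D + S / aL * (Real.exp (aL * (r - p)) - 1) := by
        have h1 : Real.exp (aL * (r - p)) ≤ Real.exp (aL * η') :=
          Real.exp_le_exp.2 (mul_le_mul_of_nonneg_left hpr' h.aL_pos.le)
        have h2 : S / aL ≤ 0 := div_nonpos_of_nonpos_of_nonneg hS.le h.aL_pos.le
        have := mul_le_mul_of_nonpos_left (sub_le_sub_right h1 1) h2
        linarith
      have := mul_nonneg hpL.le (hSD.trans this)
      linarith
    calc _ ≤ x * (κ * (expDecay (fun _ => aL) p s * D +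
          ∫ z in p..r, expDecay (fun _ => aL) z s * S)) := by
          rw [mul_add κ]; exact mul_le_mul_of_nonneg_left (add_le_add i2 i1) hx0
      _ = x * κ * (expDecay (fun _ => aL) p s * D +
          ∫ z in p..r, expDecay (fun _ => aL) z s * S) := by ring
      _ ≤ _ := mul_le_mul_of_nonneg_right ((mul_le_of_le_one_right hx0 hκ1).trans hx.2) i3

/-- The upper bound for solutions with forcing at most `S` and impulses at most `D`. -/
theorem le_of_forcing_le (h : LinearImpulsive a t γ aL aM η η' A B) {S D : ℝ}
    (hSD : 0 ≤ S ∨ 0 ≤ D ∧ 0 ≤ D + S / aL * (Real.exp (aL * η') - 1)) {f : ℝ → ℝ} {d : ℤ → ℝ}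
    {u : ℝ → ℝ} (hf : BddMeas f) {N n : ℤ} (hN : N ≤ n) {s : ℝ} (hs : s ∈ Ioc (t n) (t (n + 1)))
    (hu : ∀ k, N ≤ k → k ≤ n → MildOn a t γ f d u k) (hfS : ∀ r, t N < r → f r ≤ S)
    (hd : ∀ k, d k ≤ D) :
    u s ≤ A / aL * S + A * max D 0 / (1 - Real.exp (-(aL * η))) +
      expDecay (fun _ => aL) (t N) s * (A * |u (t N)| + A / aL * |S|) := by
  let U : ℤ → ℝ := fun k => A / aL * S * expDecay (fun _ => aL) (min (t k) s) s +
    A * max D 0 / (1 - Real.exp (-(aL * η))) * expDecay (fun _ => aL) (t (k - 1)) s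
  have hA := h.A_pos
  have hL := h.aL_pos
  have hq := h.exp_eta_pos
  -- The forcing part of the pulse is already an increment of U; only the jump part needs the
  -- geometric bound over gaps of length at least η.
  obtain ⟨x, hx, h1⟩ := h.le_of_pulse_le hN hs hu U (by
    intro k h1 h2 x hx
    obtain ⟨m1, m2, m3, m4, m5⟩ := h.mem_step h2 hs
    refine (h.pulse_le hf m2 m3 (by linarith [h.le_eta' k]) (fun z hz => hfS z
      ((h.strictMono.monotone h1).trans_lt hz)) (hd k) hSD hx).trans ?_
    simp only [U, m1, add_sub_cancel_right]
    have := mul_le_mul_of_nonneg_right (h.expDecay_le_telescope k s)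
      (mul_nonneg hA.le (le_max_right D 0))
    have e : ∀ E1 E0 E2 : ℝ, A * (E1 * max D 0 + S / aL * (E2 - E1)) =
      E1 * (A * max D 0) + A / aL * S * (E2 - E1) := fun _ _ _ => by ring
    rw [e _ 0 _]
    refine (add_le_add_left this _).trans_eq ?_
    ring)
  have m := h.mem_step hN hs
  have h2 := h.mul_expDecay_mul_le hx m.2.2.2.2 (u (t N))
  have hUN : -U N ≤ expDecay (fun _ => aL) (t N) s * (A / aL * |S|) := by
    simp only [U, m.1]
    have e1 := (expDecay_pos (fun _ => aL) (t N) s).le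
    have e2 := (expDecay_pos (fun _ => aL) (t (N - 1)) s).le
    have e3 : 0 ≤ A * max D 0 / (1 - Real.exp (-(aL * η))) *
      expDecay (fun _ => aL) (t (N - 1)) s := by positivity
    have e4 : -(A / aL * S * expDecay (fun _ => aL) (t N) s) ≤
        expDecay (fun _ => aL) (t N) s * (A / aL * |S|) := by
      rw [show -(A / aL * S * expDecay (fun _ => aL) (t N) s) =
        expDecay (fun _ => aL) (t N) s * (A / aL * (-S)) by ring]
      gcongr
      exact neg_le_abs S
    linarith
  have hUn : U (n + 1) ≤ A / aL * S + A * max D 0 / (1 - Real.exp (-(aL * η))) := by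
    simp only [U, min_eq_right hs.2, add_sub_cancel_right, expDecay_self, mul_one]
    gcongr
    exact mul_le_of_le_one_right (by positivity) (expDecay_const_le_one hL.le hs.1.le)
  linarith

end LinearImpulsive

/-- The lower bound of bounded solutions with forcing at least `S` and impulses at least `D`. -/
noncomputable def lowerConst (aL aM η η' A B S D : ℝ) : ℝ :=
  B / aM * S + if 0 ≤ D then B * D * Real.exp (-(aM * η')) / (1 - Real.exp (-(aM * η')))
    else A * D / (1 - Real.exp (-(aL * η)))

namespace LinearImpulsive

variable {a : ℝ → ℝ} {t γ : ℤ → ℝ} {aL aM η η' A B : ℝ}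

theorem aM_expDecay_le (h : LinearImpulsive a t γ aL aM η η' A B) {r s : ℝ} (hrs : r ≤ s) :
    expDecay (fun _ => aM) r s ≤ expDecay (fun _ => aL) r s :=
  (h.le_expDecay hrs).trans (h.expDecay_le hrs)

/-- A jump D at p pays for the increment of D q / (1 - q) times the exponential over [p, r], where q
= exp (-a_M η'), because q exp (a_M (r - p)) ≤ 1; equality holds for a gap of maximal length η'.
Jump and forcing thus combine into a single increment. Its nonnegativity permits passing to the
weight B even for S < 0. -/
theorem le_pulse (h : LinearImpulsive a t γ aL aM η η' A B) {f : ℝ → ℝ} (hf : BddMeas f)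
    {S D d p r s x : ℝ} (hpr : p ≤ r) (hrs : r ≤ s) (hpr' : r - p ≤ η')
    (hfS : ∀ z, p < z → S ≤ f z) (hd : D ≤ d) (hD : 0 ≤ D)
    (hμ : 0 ≤ S / aM + D * Real.exp (-(aM * η')) / (1 - Real.exp (-(aM * η'))))
    (hx : x ∈ Icc B A) :
    B * (S / aM + D * Real.exp (-(aM * η')) / (1 - Real.exp (-(aM * η')))) *
        (expDecay (fun _ => aM) r s - expDecay (fun _ => aM) p s) ≤
      x * (expDecay a p s * d + ∫ z in p..r, expDecay a z s * f z) := by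
  have hB := h.B_pos
  have hx0 : 0 ≤ x := hB.le.trans hx.1
  have hp := (expDecay_pos a p s).le
  have hpM := expDecay_pos (fun _ => aM) p s
  have hM := h.aM_pos
  have hq := h.exp_eta'_pos
  have hfi := hf.intervalIntegrable_mul (continuous_expDecay h.cont s) p r
  have hEM : ∀ x y, IntervalIntegrable (fun z => expDecay (fun _ => aM) z s * S)
      MeasureTheory.volume x y :=
    fun x y => ((continuous_expDecay continuous_const s).mul continuous_const).intervalIntegrable _ _
  have hsub : ∀ z ∈ Ioo p r, z ≤ s := fun z hz => hz.2.le.trans hrs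
  set q := Real.exp (-(aM * η')) with hqdef
  set μ := S / aM + D * q / (1 - q) with hμdef
  -- the constant coefficient pulse
  have key : μ * (expDecay (fun _ => aM) r s - expDecay (fun _ => aM) p s) ≤
      expDecay (fun _ => aM) p s * D + ∫ z in p..r, expDecay (fun _ => aM) z s * S := by
    rw [integral_expDecay_const_mul hM.ne', exp_gap aM p r s]
    have h1 : q * Real.exp (aM * (r - p)) ≤ 1 := by
      rw [hqdef, ← Real.exp_add, Real.exp_le_one_iff]
      have := mul_le_mul_of_nonneg_left hpr' hM.le
      linarith
    have h2 : D * q / (1 - q) * (Real.exp (aM * (r - p)) - 1) ≤ D := by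
      rw [div_mul_eq_mul_div, div_le_iff₀ hq]
      have := mul_le_mul_of_nonneg_left h1 hD
      linarith
    have := mul_le_mul_of_nonneg_left h2 hpM.le
    rw [hμdef]
    linarith
  have hE : expDecay (fun _ => aM) p s ≤ expDecay (fun _ => aM) r s :=
    expDecay_const_mono hM.le hpr
  have key0 : 0 ≤ expDecay (fun _ => aM) p s * D + ∫ z in p..r, expDecay (fun _ => aM) z s * S :=
    (mul_nonneg hμ (sub_nonneg.2 hE)).trans key
  rw [mul_assoc]
  refine (mul_le_mul_of_nonneg_left key hB.le).trans ?_
  rcases le_or_gt 0 S with hS | hS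
  · have i1 : ∫ z in p..r, expDecay (fun _ => aM) z s * S ≤ ∫ z in p..r, expDecay a z s * f z :=
      intervalIntegral.integral_mono_on_of_le_Ioo hpr (hEM _ _) hfi fun z hz =>
        (mul_le_mul_of_nonneg_right (h.le_expDecay (hsub z hz)) hS).trans
          (mul_le_mul_of_nonneg_left (hfS z hz.1) (expDecay_pos _ _ _).le)
    have i2 : expDecay (fun _ => aM) p s * D ≤ expDecay a p s * d :=
      (mul_le_mul_of_nonneg_right (h.le_expDecay (hpr.trans hrs)) hD).trans
        (mul_le_mul_of_nonneg_left hd hp)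
    exact (mul_le_mul_of_nonneg_right hx.1 key0).trans
      (mul_le_mul_of_nonneg_left (add_le_add i2 i1) hx0)
  · set κ := expDecay a p s / expDecay (fun _ => aM) p s with hκ
    have hκ1 : 1 ≤ κ := (one_le_div hpM).2 (h.le_expDecay (hpr.trans hrs))
    have i1 : κ * ∫ z in p..r, expDecay (fun _ => aM) z s * S ≤
        ∫ z in p..r, expDecay a z s * f z := by
      rw [← intervalIntegral.integral_const_mul]
      refine intervalIntegral.integral_mono_on_of_le_Ioo hpr ((hEM _ _).const_mul _) hfi
        fun z hz => ?_
      refine le_trans ?_ (mul_le_mul_of_nonneg_left (hfS z hz.1) (expDecay_pos _ _ _).le)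
      rw [← mul_assoc]
      refine mul_le_mul_of_nonpos_right ?_ hS.le
      rw [hκ, div_mul_eq_mul_div, le_div_iff₀ hpM]
      exact h.le_expDecay_cross hz.1.le
    have i2 : κ * (expDecay (fun _ => aM) p s * D) ≤ expDecay a p s * d := by
      rw [hκ, ← mul_assoc, div_mul_cancel₀ _ hpM.ne']
      exact mul_le_mul_of_nonneg_left hd hp
    calc _ ≤ x * κ * (expDecay (fun _ => aM) p s * D +
          ∫ z in p..r, expDecay (fun _ => aM) z s * S) :=
          mul_le_mul_of_nonneg_right (hx.1.trans (le_mul_of_one_le_right hx0 hκ1)) key0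
      _ = x * (κ * (expDecay (fun _ => aM) p s * D) +
          κ * ∫ z in p..r, expDecay (fun _ => aM) z s * S) := by ring
      _ ≤ _ := mul_le_mul_of_nonneg_left (add_le_add i2 i1) hx0

/-- Negative jumps are worst with the largest weight A and slowest decay a_L, nonnegative forcing
with the smallest weight B and fastest decay a_M, so the two parts are bounded separately. -/
theorem le_pulse_of_neg (h : LinearImpulsive a t γ aL aM η η' A B) {f : ℝ → ℝ} (hf : BddMeas f)
    {S D d p r s x : ℝ} (hpr : p ≤ r) (hrs : r ≤ s) (hfS : ∀ z, p < z → S ≤ f z) (hd : D ≤ d)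
    (hD : D ≤ 0) (hS : 0 ≤ S) (hx : x ∈ Icc B A) :
    A * D * expDecay (fun _ => aL) p s + B / aM * S *
        (expDecay (fun _ => aM) r s - expDecay (fun _ => aM) p s) ≤
      x * (expDecay a p s * d + ∫ z in p..r, expDecay a z s * f z) := by
  have hfi := hf.intervalIntegrable_mul (continuous_expDecay h.cont s) p r
  have hEM : ∀ x y, IntervalIntegrable (fun z => expDecay (fun _ => aM) z s * S)
      MeasureTheory.volume x y :=
    fun x y => ((continuous_expDecay continuous_const s).mul continuous_const).intervalIntegrable _ _
  rw [mul_add]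
  refine add_le_add ?_ ?_
  · calc _ = A * expDecay (fun _ => aL) p s * D := by ring
      _ ≤ x * expDecay a p s * D :=
        mul_le_mul_of_nonpos_right (h.mul_expDecay_le hx (hpr.trans hrs)) hD
      _ ≤ x * expDecay a p s * d := mul_le_mul_of_nonneg_left hd (h.mul_expDecay_nonneg hx)
      _ = _ := by ring
  · rw [div_mul_eq_mul_div, mul_div_assoc, mul_assoc,
      ← integral_expDecay_const_mul h.aM_pos.ne', ← intervalIntegral.integral_const_mul,
      ← intervalIntegral.integral_const_mul]
    refine intervalIntegral.integral_mono_on_of_le_Ioo hpr ((hEM _ _).const_mul _)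
        (hfi.const_mul _) fun z hz => ?_
    rw [← mul_assoc, ← mul_assoc]
    exact (mul_le_mul_of_nonneg_right (h.le_mul_expDecay hx (hz.2.le.trans hrs)) hS).trans
      (mul_le_mul_of_nonneg_left (hfS z hz.1) (h.mul_expDecay_nonneg hx))

/-- The lower bound for solutions with forcing at least `S` and impulses at least `D`. -/
theorem le_of_le_forcing (h : LinearImpulsive a t γ aL aM η η' A B) {S D : ℝ}
    (hpos : 0 ≤ lowerConst aL aM η η' A B S D) {f : ℝ → ℝ} {d : ℤ → ℝ}
    {u : ℝ → ℝ} (hf : BddMeas f) {N n : ℤ} (hN : N ≤ n) {s : ℝ} (hs : s ∈ Ioc (t n) (t (n + 1)))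
    (hu : ∀ k, N ≤ k → k ≤ n → MildOn a t γ f d u k) (hfS : ∀ r, t N < r → S ≤ f r)
    (hd : ∀ k, D ≤ d k) :
    lowerConst aL aM η η' A B S D -
      expDecay (fun _ => aL) (t N) s *
        (A * |u (t N)| + (lowerConst aL aM η η' A B S D + B / aM * |S|)) ≤ u s := by
  have hA := h.A_pos
  have hB := h.B_pos
  have hL := h.aL_pos
  have hM := h.aM_pos
  have hq := h.exp_eta_pos
  have m := h.mem_step hN hs
  have hcmp := h.aM_expDecay_le m.2.2.2.2
  have hEL := (expDecay_pos (fun _ => aL) (t N) s).le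
  have hS0 : 0 ≤ B / aM * |S| := by positivity
  rcases le_or_gt 0 D with hD | hD
  · have e : lowerConst aL aM η η' A B S D =
        B * (S / aM + D * Real.exp (-(aM * η')) / (1 - Real.exp (-(aM * η')))) := by
      rw [lowerConst, if_pos hD]; ring
    have hμ : 0 ≤ S / aM + D * Real.exp (-(aM * η')) / (1 - Real.exp (-(aM * η'))) := by
      rw [e] at hpos
      exact nonneg_of_mul_nonneg_right hpos hB
    let U : ℤ → ℝ := fun k => lowerConst aL aM η η' A B S D *
      expDecay (fun _ => aM) (min (t k) s) s
    obtain ⟨x, hx, h1⟩ := h.le_of_le_pulse hN hs hu U (by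
      intro k h1 h2 x hx
      obtain ⟨m1, m2, m3, m4, m5⟩ := h.mem_step h2 hs
      have := h.le_pulse hf m2 m3 (by linarith [h.le_eta' k]) (fun z hz => hfS z
        ((h.strictMono.monotone h1).trans_lt hz)) (hd k) hD hμ hx
      rw [← e] at this
      simp only [U, m1]
      linarith)
    have h2 := h.mul_expDecay_mul_le hx m.2.2.2.2 (-u (t N))
    rw [abs_neg] at h2
    simp only [U, min_eq_right hs.2, m.1, expDecay_self, mul_one] at h1
    have h3 := mul_le_mul_of_nonneg_left hcmp hpos
    have h4 := mul_nonneg hEL hS0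
    linarith
  -- For D < 0 the jump part of the constant is nonpositive, so its total can be nonnegative only if
  -- S is.
  · have hS : 0 ≤ S := by
      rw [lowerConst, if_neg hD.not_ge] at hpos
      have h1 : A * D / (1 - Real.exp (-(aL * η))) ≤ 0 :=
        div_nonpos_of_nonpos_of_nonneg (mul_nonpos_of_nonneg_of_nonpos hA.le hD.le) hq.le
      exact nonneg_of_mul_nonneg_right (show 0 ≤ B / aM * S by linarith) (div_pos hB hM)
    let U : ℤ → ℝ := fun k => B / aM * S * expDecay (fun _ => aM) (min (t k) s) s +
      A * D / (1 - Real.exp (-(aL * η))) * expDecay (fun _ => aL) (t (k - 1)) s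
    obtain ⟨x, hx, h1⟩ := h.le_of_le_pulse hN hs hu U (by
      intro k h1 h2 x hx
      obtain ⟨m1, m2, m3, m4, m5⟩ := h.mem_step h2 hs
      have := h.le_pulse_of_neg hf m2 m3 (fun z hz => hfS z
        ((h.strictMono.monotone h1).trans_lt hz)) (hd k) hD.le hS hx
      refine le_trans ?_ this
      simp only [U, m1, add_sub_cancel_right]
      have := mul_le_mul_of_nonpos_right (h.expDecay_le_telescope k s)
        (mul_nonpos_of_nonneg_of_nonpos hA.le hD.le)
      have e : ∀ X : ℝ, 1 / (1 - Real.exp (-(aL * η))) * X * (A * D) =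
        A * D / (1 - Real.exp (-(aL * η))) * X := fun X => by ring
      rw [e] at this
      linarith)
    have h2 := h.mul_expDecay_mul_le hx m.2.2.2.2 (-u (t N))
    rw [abs_neg] at h2
    simp only [U, min_eq_right hs.2, m.1, expDecay_self, mul_one, add_sub_cancel_right] at h1
    have hneg : A * D / (1 - Real.exp (-(aL * η))) ≤ 0 :=
      div_nonpos_of_nonpos_of_nonneg (mul_nonpos_of_nonneg_of_nonpos hA.le hD.le) hq.le
    have h3 := mul_le_mul_of_nonpos_left (expDecay_const_le_one hL.le hs.1.le) hneg
    have h4 := mul_le_mul_of_nonneg_left hcmp hS0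
    have h5 := mul_nonpos_of_nonpos_of_nonneg hneg (expDecay_pos (fun _ => aL) (t (N - 1)) s).le
    have h6 := mul_nonneg hEL hpos
    rw [abs_of_nonneg hS] at h4 ⊢
    have e : lowerConst aL aM η η' A B S D =
        B / aM * S + A * D / (1 - Real.exp (-(aL * η))) := by
      rw [lowerConst, if_neg hD.not_ge]
    rw [e] at h6 ⊢
    linarith

end LinearImpulsive

/-! ### Piecewise continuity and the variation of constants formula -/

/-- The index of the interval `(t k, t (k + 1)]` that contains `s`. -/
noncomputable def intervalIndex (t : ℤ → ℝ) (s : ℝ) : ℤ :=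
  open Classical in if h : ∃ k, s ∈ Ioc (t k) (t (k + 1)) then h.choose else 0

theorem exists_mem_Ioc {t : ℤ → ℝ} (hm : StrictMono t) (htop : Tendsto t atTop atTop)
    (hbot : Tendsto t atBot atBot) (s : ℝ) : ∃ k, s ∈ Ioc (t k) (t (k + 1)) := by
  obtain ⟨n, hn, hmin⟩ := Int.exists_least_of_bdd (P := fun n => s ≤ t n)
    (by
      obtain ⟨b, hb⟩ := (hbot.eventually (eventually_lt_atBot s)).exists
      exact ⟨b, fun z hz => by
        by_contra! h
        exact absurd (hm h) (by linarith)⟩)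
    (htop.eventually (eventually_ge_atTop s)).exists
  refine ⟨n - 1, ?_, by simpa using hn⟩
  by_contra! h
  have := hmin _ h
  lia

theorem eq_of_mem_Ioc {t : ℤ → ℝ} (hm : StrictMono t) {s : ℝ} {j k : ℤ}
    (hj : s ∈ Ioc (t j) (t (j + 1))) (hk : s ∈ Ioc (t k) (t (k + 1))) : j = k := by
  have h1 := hm.lt_iff_lt.1 (hj.1.trans_le hk.2)
  have h2 := hm.lt_iff_lt.1 (hk.1.trans_le hj.2)
  lia

/-- A piecewise left continuous function is continuous on each interval between impulses. -/
theorem PLC.continuousOn {t : ℤ → ℝ} (hm : StrictMono t) {X : Set ℝ} {φ : ℝ → ℝ} (h : PLC t X φ)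
    (k : ℤ) : ContinuousOn φ (X ∩ Ioc (t k) (t (k + 1))) := by
  rintro s ⟨hs, hk⟩
  rcases hk.2.eq_or_lt with e | hlt
  · refine (h s hs).1.mono fun x hx => ⟨hx.1, ?_⟩
    rw [e]; exact hx.2.2
  · refine ((h s hs).2.2 fun j hj => ?_).mono inter_subset_left
    have h1 := hm.lt_iff_lt.1 (hj ▸ hk.1)
    have h2 := hm.lt_iff_lt.1 (hj ▸ hlt)
    lia

namespace LinearImpulsive

variable {a : ℝ → ℝ} {t γ : ℤ → ℝ} {aL aM η η' A B : ℝ}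

theorem mem_intervalIndex (h : LinearImpulsive a t γ aL aM η η' A B) (s : ℝ) :
    s ∈ Ioc (t (intervalIndex t s)) (t (intervalIndex t s + 1)) := by
  have := exists_mem_Ioc h.strictMono h.tendsto_atTop h.tendsto_atBot s
  rw [intervalIndex, dif_pos this]
  exact this.choose_spec

theorem intervalIndex_eq (h : LinearImpulsive a t γ aL aM η η' A B) {s : ℝ} {k : ℤ}
    (hs : s ∈ Ioc (t k) (t (k + 1))) : intervalIndex t s = k :=
  eq_of_mem_Ioc h.strictMono (h.mem_intervalIndex s) hs

theorem measurable_intervalIndex (h : LinearImpulsive a t γ aL aM η η' A B) :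
    Measurable (intervalIndex t) := by
  refine measurable_to_countable' fun k => ?_
  have : intervalIndex t ⁻¹' {k} = Ioc (t k) (t (k + 1)) := by
    ext s
    exact ⟨fun hs => by
      have := h.mem_intervalIndex s
      rwa [show intervalIndex t s = k from hs] at this, fun hs => h.intervalIndex_eq hs⟩
  rw [this]
  exact measurableSet_Ioc

/-- On each of countably many intervals the function is continuous; the measurable index of the
interval glues the pieces. -/
theorem measurable_of_PLC (h : LinearImpulsive a t γ aL aM η η' A B) {X : Set ℝ} {φ : ℝ → ℝ}
    (hX : MeasurableSet X) (hφ : PLC t X φ) : Measurable (X.indicator φ) := by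
  classical
  have h1 : ∀ k, Measurable ((X ∩ Ioc (t k) (t (k + 1))).indicator φ) := fun k => by
    rw [← piecewise_eq_indicator]
    exact (hφ.continuousOn h.strictMono k).measurable_piecewise continuousOn_const
      (hX.inter measurableSet_Ioc)
  have h2 : Measurable fun p : ℤ × ℝ => (X ∩ Ioc (t p.1) (t (p.1 + 1))).indicator φ p.2 :=
    measurable_from_prod_countable_right h1
  convert h2.comp (h.measurable_intervalIndex.prodMk measurable_id) using 1
  ext s
  have := h.mem_intervalIndex s
  simp only [Function.comp, id, indicator, mem_inter_iff, this, and_true]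

theorem tendsto_expDecay_atBot (h : LinearImpulsive a t γ aL aM η η' A B) (s : ℝ) :
    Tendsto (fun N => expDecay (fun _ => aL) (t N) s) atBot (𝓝 0) := by
  simp only [expDecay_const]
  refine Real.tendsto_exp_neg_atTop_nhds_zero.comp (Tendsto.const_mul_atTop h.aL_pos ?_)
  simp only [sub_eq_add_neg]
  exact tendsto_atTop_add_const_left _ _ (tendsto_neg_atBot_atTop.comp h.tendsto_atBot)

/-- The continuous extension of a mild solution from `(t k, t (k + 1)]`. -/
theorem exists_continuous_extension (h : LinearImpulsive a t γ aL aM η η' A B) {f : ℝ → ℝ}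
    (hf : BddMeas f) {d : ℤ → ℝ} {u : ℝ → ℝ} {k : ℤ} (hu : MildOn a t γ f d u k) :
    ∃ v : ℝ → ℝ, Continuous v ∧ EqOn u v (Ioc (t k) (t (k + 1))) ∧
      v (t k) = (1 + γ k) * u (t k) + d k ∧
      (∀ s, ContinuousAt f s → HasDerivAt v (-(a s * v s) + f s) s) ∧
      ∀ r s, v s = expDecay a r s * v r + ∫ z in r..s, expDecay a z s * f z := by
  let c := (1 + γ k) * u (t k) + d k
  have hi : ∀ p x y, IntervalIntegrable (fun r => expDecay a r p * f r) MeasureTheory.volume x y :=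
    fun p x y => hf.intervalIntegrable_mul (continuous_expDecay h.cont p) x y
  -- With the factor `expDecay a (t k) s` pulled out, the integrand no longer depends on s and the
  -- fundamental theorem of calculus applies.
  have e : ∀ s, expDecay a (t k) s * c + ∫ r in t k..s, expDecay a r s * f r =
      expDecay a (t k) s * (c + ∫ r in t k..s, expDecay a r (t k) * f r) := by
    intro s
    rw [mul_add (expDecay a (t k) s) c, ← intervalIntegral.integral_const_mul]
    simp_rw [← mul_assoc, mul_comm (expDecay a (t k) s), expDecay_mul h.cont]
  have hcd : ∀ s, HasDerivAt (fun s => expDecay a (t k) s) (-(a s * expDecay a (t k) s)) s :=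
    fun s => hasDerivAt_expDecay h.cont (t k) s
  have hcE : Continuous fun s => expDecay a (t k) s :=
    continuous_iff_continuousAt.2 fun s => (hcd s).continuousAt
  have hv : Continuous fun s =>
      expDecay a (t k) s * (c + ∫ r in t k..s, expDecay a r (t k) * f r) :=
    hcE.mul (continuous_const.add (intervalIntegral.continuous_primitive (hi (t k)) _))
  refine ⟨_, hv, fun s hs => ?_, ?_, fun s hs => ?_, fun r s => ?_⟩
  · exact (hu s hs).trans (e s)
  · simp [expDecay_self, c]
  · have hm : Measurable fun r => expDecay a r (t k) * f r :=
      (continuous_expDecay h.cont (t k)).measurable.mul hf.1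
    have h2 := intervalIntegral.integral_hasDerivAt_right (hi (t k) (t k) s)
      hm.stronglyMeasurable.stronglyMeasurableAtFilter
      ((continuous_expDecay h.cont (t k)).continuousAt.mul hs)
    refine ((hcd s).mul (h2.const_add c)).congr_deriv ?_
    rw [← mul_assoc, expDecay_mul h.cont, expDecay_self]
    ring
  · have e2 : ∫ z in r..s, expDecay a z s * f z =
        expDecay a (t k) s * ∫ z in r..s, expDecay a z (t k) * f z := by
      rw [← intervalIntegral.integral_const_mul]
      simp_rw [← mul_assoc, mul_comm (expDecay a (t k) s), expDecay_mul h.cont]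
    rw [e2, ← mul_assoc, mul_comm (expDecay a r s), expDecay_mul h.cont,
      ← intervalIntegral.integral_add_adjacent_intervals (hi (t k) (t k) r) (hi (t k) r s)]
    ring

/-- Mild solutions are piecewise left continuous. -/
theorem plc_of_mildOn (h : LinearImpulsive a t γ aL aM η η' A B) {f : ℝ → ℝ} (hf : BddMeas f)
    {d : ℤ → ℝ} {u : ℝ → ℝ} (hu : ∀ k, MildOn a t γ f d u k) : PLC t univ u := by
  intro s _
  have hs := h.mem_intervalIndex s
  obtain ⟨v, hv, hvu, -⟩ := h.exists_continuous_extension hf (hu (intervalIndex t s))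
  have hleft : ContinuousWithinAt u (univ ∩ Iic s) s := by
    rw [univ_inter]
    refine hv.continuousWithinAt.congr_of_eventuallyEq ?_ (hvu hs)
    filter_upwards [Ioc_mem_nhdsLE hs.1] with x hx using hvu ⟨hx.1, hx.2.trans hs.2⟩
  refine ⟨hleft, ?_, fun hk => ?_⟩
  · rw [univ_inter]
    rcases hs.2.eq_or_lt with e | hlt
    · obtain ⟨v, hv, hvu, -⟩ := h.exists_continuous_extension hf (hu (intervalIndex t s + 1))
      refine ⟨v s, (hv.tendsto s).mono_left nhdsWithin_le_nhds |>.congr' ?_⟩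
      have : s < t (intervalIndex t s + 1 + 1) := by
        rw [e]; exact h.strictMono (by lia)
      filter_upwards [Ioc_mem_nhdsGT this] with x hx
      exact (hvu ⟨by rw [← e]; exact hx.1, hx.2⟩).symm
    · refine ⟨v s, (hv.tendsto s).mono_left nhdsWithin_le_nhds |>.congr' ?_⟩
      filter_upwards [Ioc_mem_nhdsGT hlt] with x hx using (hvu ⟨hs.1.trans hx.1, hx.2⟩).symm
  · rw [continuousWithinAt_univ]
    refine hv.continuousAt.congr ?_
    filter_upwards [Ioc_mem_nhds hs.1 (lt_of_le_of_ne hs.2 (hk _))] with x hx using (hvu hx).symm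

theorem hasDerivAt_of_mildOn (h : LinearImpulsive a t γ aL aM η η' A B) {f : ℝ → ℝ}
    (hf : BddMeas f) {d : ℤ → ℝ} {u : ℝ → ℝ} (hu : ∀ k, MildOn a t γ f d u k) {s : ℝ}
    (hs : ∀ k, s ≠ t k) (hfs : ContinuousAt f s) : HasDerivAt u (-(a s * u s) + f s) s := by
  have hk := h.mem_intervalIndex s
  obtain ⟨v, hv, hvu, -, hd, -⟩ := h.exists_continuous_extension hf (hu (intervalIndex t s))
  rw [hvu hk]
  refine (hd s hfs).congr_of_eventuallyEq ?_
  filter_upwards [Ioc_mem_nhds hk.1 (lt_of_le_of_ne hk.2 (hs _))] with x hx using hvu hx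

theorem tendsto_of_mildOn (h : LinearImpulsive a t γ aL aM η η' A B) {f : ℝ → ℝ}
    (hf : BddMeas f) {d : ℤ → ℝ} {u : ℝ → ℝ} {k : ℤ} (hu : MildOn a t γ f d u k) :
    Tendsto u (𝓝[>] (t k)) (𝓝 ((1 + γ k) * u (t k) + d k)) := by
  obtain ⟨v, hv, hvu, hvk, -⟩ := h.exists_continuous_extension hf hu
  rw [← hvk]
  refine (hv.tendsto _).mono_left nhdsWithin_le_nhds |>.congr' ?_
  filter_upwards [Ioc_mem_nhdsGT (h.strictMono (lt_add_one k))] with x hx using (hvu hx).symm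

/-- Bounded mild solutions are uniformly Lipschitz between impulses. -/
theorem lipschitz_of_mildOn (h : LinearImpulsive a t γ aL aM η η' A B) {f : ℝ → ℝ}
    (hf : BddMeas f) {C D : ℝ} (hfC : ∀ s, |f s| ≤ C) {d : ℤ → ℝ} {u : ℝ → ℝ}
    (huD : ∀ s, |u s| ≤ D) {k : ℤ} (hu : MildOn a t γ f d u k) {r s : ℝ}
    (hr : r ∈ Ioc (t k) (t (k + 1))) (hs : s ∈ Ioc (t k) (t (k + 1))) :
    |u s - u r| ≤ (aM * D + C) * |s - r| := by
  wlog hrs : r ≤ s generalizing r s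
  · rw [abs_sub_comm, abs_sub_comm s r]; exact this hs hr (not_le.1 hrs).le
  obtain ⟨v, hv, hvu, -, -, hvv⟩ := h.exists_continuous_extension hf hu
  have hC : 0 ≤ C := (abs_nonneg _).trans (hfC 0)
  have hD : 0 ≤ D := (abs_nonneg _).trans (huD 0)
  have e := hvv r s
  rw [← hvu hr, ← hvu hs] at e
  have h1 : |∫ z in r..s, expDecay a z s * f z| ≤ C * |s - r| := by
    refine intervalIntegral.norm_integral_le_of_norm_le_const (f := fun z => expDecay a z s * f z)
      fun z hz => ?_
    rw [uIoc_of_le hrs] at hz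
    rw [norm_mul, Real.norm_of_nonneg (expDecay_pos _ _ _).le]
    have : expDecay a z s ≤ 1 :=
      (h.expDecay_le hz.2).trans (expDecay_const_le_one h.aL_pos.le hz.2)
    exact (mul_le_of_le_one_left (norm_nonneg _) this).trans (hfC z)
  have h2 : |1 - expDecay a r s| ≤ aM * |s - r| := by
    have e1 : expDecay a r s ≤ 1 :=
      (h.expDecay_le hrs).trans (expDecay_const_le_one h.aL_pos.le hrs)
    have e2 := h.le_expDecay hrs
    have e3 := Real.add_one_le_exp (-(aM * (s - r)))
    rw [expDecay_const] at e2
    rw [abs_of_nonneg (sub_nonneg.2 e1), abs_of_nonneg (sub_nonneg.2 hrs)]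
    linarith
  calc |u s - u r| = |(∫ z in r..s, expDecay a z s * f z) - (1 - expDecay a r s) * u r| := by
        rw [e]; congr 1; ring
    _ ≤ C * |s - r| + aM * |s - r| * D := by
        refine (abs_sub _ _).trans (add_le_add h1 ?_)
        rw [abs_mul]
        exact mul_le_mul h2 (huD r) (abs_nonneg _) (mul_nonneg h.aM_pos.le (abs_nonneg _))
    _ = _ := by ring

/-- Classical solutions satisfy the variation of constants formula. -/
theorem mildOn_of_hasDerivAt (h : LinearImpulsive a t γ aL aM η η' A B) {f : ℝ → ℝ}
    (hf : BddMeas f) {d : ℤ → ℝ} {u : ℝ → ℝ} {k : ℤ} (hc : ContinuousOn u (Ioc (t k) (t (k + 1))))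
    (hr : Tendsto u (𝓝[>] (t k)) (𝓝 ((1 + γ k) * u (t k) + d k))) {Z : Set ℝ} (hZ : Z.Countable)
    (hd : ∀ s ∈ Ioo (t k) (t (k + 1)), s ∉ Z → HasDerivAt u (-(a s * u s) + f s) s) :
    MildOn a t γ f d u k := by
  intro s hs
  let c := (1 + γ k) * u (t k) + d k
  -- The value at the left endpoint is replaced by the right limit, giving continuity on the closed
  -- interval. The integrating factor then works with derivatives that exist only off a countable
  -- set.
  let v : ℝ → ℝ := Function.update u (t k) c
  have hvu : ∀ r, t k < r → v r = u r := fun r hr => Function.update_of_ne hr.ne' _ _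
  have hvc : ContinuousOn v (Icc (t k) s) := by
    intro r hr'
    rcases hr'.1.eq_or_lt with rfl | hlt
    · have h1 : ContinuousWithinAt v (Ioi (t k)) (t k) := by
        rw [ContinuousWithinAt, show v (t k) = c from Function.update_self _ _ _]
        exact hr.congr' (by filter_upwards [self_mem_nhdsWithin] with x hx using (hvu x hx).symm)
      exact (continuousWithinAt_Ioi_iff_Ici.1 h1).mono Icc_subset_Ici_self
    · have h1 := (hc r ⟨hlt, hr'.2.trans hs.2⟩)
      have h2 : ContinuousWithinAt v (Ioc (t k) (t (k + 1))) r :=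
        h1.congr (fun x hx => hvu x hx.1) (hvu r hlt)
      refine h2.mono_of_mem_nhdsWithin ?_
      filter_upwards [self_mem_nhdsWithin, mem_nhdsWithin_of_mem_nhds (Ioi_mem_nhds hlt)] with x hx
        hx' using ⟨hx', hx.2.trans hs.2⟩
  have hw : ∀ r ∈ Ioo (t k) s \ Z,
      HasDerivAt (fun r => expDecay a r s * v r) (expDecay a r s * f r) r := by
    rintro r ⟨hr', hrZ⟩
    have h1 : HasDerivAt v (-(a r * u r) + f r) r := by
      refine (hd r ⟨hr'.1, hr'.2.trans_le hs.2⟩ hrZ).congr_of_eventuallyEq ?_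
      filter_upwards [Ioi_mem_nhds hr'.1] with x hx using hvu x hx
    refine ((hasDerivAt_expDecay_left h.cont r s).mul h1).congr_deriv ?_
    rw [hvu r hr'.1]; ring
  have : ∫ r in t k..s, expDecay a r s * f r =
      expDecay a s s * v s - expDecay a (t k) s * v (t k) :=
    MeasureTheory.integral_eq_of_hasDerivAt_off_countable_of_le _ _ hs.1.le hZ
    ((continuous_expDecay h.cont s).continuousOn.mul hvc) hw
    (hf.intervalIntegrable_mul (continuous_expDecay h.cont s) _ _)
  rw [this, expDecay_self, hvu s hs.1, show v (t k) = c from Function.update_self _ _ _]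
  ring

end LinearImpulsive

/-! ### Bounded solutions on the whole line -/

namespace LinearImpulsive

variable {a : ℝ → ℝ} {t γ : ℤ → ℝ} {aL aM η η' A B : ℝ}

theorem le_gap_mul (h : LinearImpulsive a t γ aL aM η η' A B) (k : ℤ) (i : ℕ) :
    η * i ≤ t k - t (k - i) := by
  induction i with
  | zero => simp
  | succ i ih =>
    have := h.eta_le (k - (i + 1))
    rw [show k - (i + 1 : ℤ) + 1 = k - i by ring] at this
    push_cast
    linarith

/-- Estimates of the variation of constants integral on one interval. -/
theorem abs_integral_expDecay_mul_le (h : LinearImpulsive a t γ aL aM η η' A B) {f : ℝ → ℝ} {C : ℝ}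
    (hfC : ∀ s, |f s| ≤ C) {k : ℤ} {s : ℝ} (hs : s ∈ Ioc (t k) (t (k + 1))) :
    |∫ r in t k..s, expDecay a r s * f r| ≤ C * η' := by
  have hC : 0 ≤ C := (abs_nonneg _).trans (hfC 0)
  have h1 : |∫ r in t k..s, expDecay a r s * f r| ≤ C * |s - t k| := by
    refine intervalIntegral.norm_integral_le_of_norm_le_const
      (f := fun z => expDecay a z s * f z) fun z hz => ?_
    rw [uIoc_of_le hs.1.le] at hz
    rw [norm_mul, Real.norm_of_nonneg (expDecay_pos _ _ _).le]
    exact (mul_le_of_le_one_left (norm_nonneg _) ((h.expDecay_le hz.2).trans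
      (expDecay_const_le_one h.aL_pos.le hz.2))).trans (hfC z)
  refine h1.trans (mul_le_mul_of_nonneg_left ?_ hC)
  rw [abs_of_pos (sub_pos.2 hs.1)]
  linarith [h.le_eta' k, hs.2]

/-- Existence of a bounded solution on the whole line. -/
theorem exists_bounded_mildOn (h : LinearImpulsive a t γ aL aM η η' A B) {f : ℝ → ℝ}
    (hf : BddMeas f) {d : ℤ → ℝ} {D : ℝ} (hd : ∀ k, |d k| ≤ D) :
    ∃ u : ℝ → ℝ, (∃ C, ∀ s, |u s| ≤ C) ∧ ∀ k, MildOn a t γ f d u k := by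
  obtain ⟨C, hC⟩ := hf.2
  obtain ⟨g, hg, hg1, hgr⟩ := exists_multiplier h.factor_pos h.one_le_A h.B_le_one h.le_prod
    h.prod_le
  have hmono := h.strictMono
  have hA := h.A_pos
  have hD : 0 ≤ D := (abs_nonneg _).trans (hd 0)
  have hC0 : 0 ≤ C := (abs_nonneg _).trans (hC 0)
  have hη' := h.eta'_pos
  let c : ℤ → ℝ := fun k => expDecay a (t k) (t (k + 1)) * d k +
    ∫ r in t k..t (k + 1), expDecay a r (t (k + 1)) * f r
  have hE1 : ∀ k, ∀ s ∈ Ioc (t k) (t (k + 1)), expDecay a (t k) s ≤ 1 := fun k s hs =>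
    (h.expDecay_le hs.1.le).trans (expDecay_const_le_one h.aL_pos.le hs.1.le)
  have hEd : ∀ k, ∀ s ∈ Ioc (t k) (t (k + 1)), |expDecay a (t k) s * d k| ≤ D := fun k s hs => by
    rw [abs_mul, abs_of_pos (expDecay_pos _ _ _)]
    exact (mul_le_of_le_one_left (abs_nonneg _) (hE1 k s hs)).trans (hd k)
  have hk1 : ∀ k, t (k + 1) ∈ Ioc (t k) (t (k + 1)) := fun k => ⟨hmono (by lia), le_rfl⟩
  have hc : ∀ k, |c k| ≤ D + C * η' := fun k =>
    (abs_add_le _ _).trans (add_le_add (hEd k _ (hk1 k))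
      (h.abs_integral_expDecay_mul_le hC (hk1 k)))
  -- G is the fundamental solution at the impulse times. Its ratios decay like A q^i, so the pulses
  -- c of the whole past can be summed; the sums X solve the recursion between consecutive impulse
  -- times.
  let G : ℤ → ℝ := fun k => g k * expDecay a 0 (t k)
  have hG : ∀ k, 0 < G k := fun k => mul_pos (hg k) (expDecay_pos _ _ _)
  have hG1 : ∀ k, G (k + 1) = (1 + γ k) * expDecay a (t k) (t (k + 1)) * G k := fun k => by
    simp only [G]
    rw [hg1, ← expDecay_mul h.cont 0 (t k) (t (k + 1))]; ring
  set q := Real.exp (-(aL * η)) with hq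
  have hq1 : q < 1 := by linarith [h.exp_eta_pos]
  have hq0 : 0 ≤ q := (Real.exp_pos _).le
  have hGr : ∀ k (i : ℕ), G k / G (k - i) ≤ A * q ^ i := fun k i => by
    have hle : t (k - i) ≤ t k := hmono.monotone (by lia)
    have e : G k / G (k - i) = g k / g (k - i) * expDecay a (t (k - i)) (t k) := by
      simp only [G]
      rw [← expDecay_mul h.cont 0 (t (k - i)) (t k)]
      have := (hg (k - i)).ne'
      have := (expDecay_pos a 0 (t (k - i))).ne'
      field_simp
    rw [e]
    refine (h.mul_expDecay_le (hgr _ _ (by lia)) hle).trans (mul_le_mul_of_nonneg_left ?_ hA.le)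
    rw [expDecay_const, hq, ← Real.exp_nat_mul, Real.exp_le_exp]
    have := mul_le_mul_of_nonneg_left (h.le_gap_mul k i) h.aL_pos.le
    linarith
  let T : ℤ → ℕ → ℝ := fun k i => G k / G (k - i) * c (k - 1 - i)
  have hT : ∀ k i, ‖T k i‖ ≤ A * (D + C * η') * q ^ i := fun k i => by
    simp only [T, norm_mul, Real.norm_eq_abs]
    rw [abs_of_pos (div_pos (hG _) (hG _))]
    calc _ ≤ (A * q ^ i) * (D + C * η') :=
          mul_le_mul (hGr k i) (hc _) (abs_nonneg _) (by positivity)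
      _ = _ := by ring
  have hgeo : HasSum (fun i : ℕ => A * (D + C * η') * q ^ i) (A * (D + C * η') * (1 - q)⁻¹) :=
    (hasSum_geometric_of_lt_one hq0 hq1).mul_left _
  have hsum : ∀ k, Summable (T k) := fun k => .of_norm_bounded hgeo.summable (hT k)
  let X : ℤ → ℝ := fun k => ∑' i, T k i
  have hX : ∀ k, |X k| ≤ A * (D + C * η') * (1 - q)⁻¹ := fun k =>
    tsum_of_norm_bounded hgeo (hT k)
  have hXrec : ∀ k, X (k + 1) = expDecay a (t k) (t (k + 1)) * ((1 + γ k) * X k + d k) +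
      ∫ r in t k..t (k + 1), expDecay a r (t (k + 1)) * f r := fun k => by
    have e0 : T (k + 1) 0 = c k := by
      simp only [T, Nat.cast_zero, sub_zero, div_self (hG _).ne', one_mul, add_sub_cancel_right]
    have e1 : ∀ i, T (k + 1) (i + 1) = (1 + γ k) * expDecay a (t k) (t (k + 1)) * T k i :=
      fun i => by
        simp only [T]
        rw [show k + 1 - ((i + 1 : ℕ) : ℤ) = k - i by push_cast; ring,
          show k + 1 - 1 - ((i + 1 : ℕ) : ℤ) = k - 1 - i by push_cast; ring, hG1]
        ring
    have : X (k + 1) = c k + (1 + γ k) * expDecay a (t k) (t (k + 1)) * X k := by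
      simp only [X]
      rw [(hsum (k + 1)).tsum_eq_zero_add, e0]
      simp only [e1, tsum_mul_left]
    rw [this]
    simp only [c]; ring
  let u : ℝ → ℝ := fun s => expDecay a (t (intervalIndex t s)) s *
    ((1 + γ (intervalIndex t s)) * X (intervalIndex t s) + d (intervalIndex t s)) +
      ∫ r in t (intervalIndex t s)..s, expDecay a r s * f r
  have huX : ∀ k, u (t (k + 1)) = X (k + 1) := fun k => by
    simp only [u]
    rw [h.intervalIndex_eq (hk1 k), hXrec]
  have hγ : ∀ k, |1 + γ k| ≤ A := fun k => by
    have := h.prod_le k k le_rfl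
    rw [Finset.Icc_self, Finset.prod_singleton] at this
    rwa [abs_of_pos (h.factor_pos k)]
  refine ⟨u, ⟨A * (A * (D + C * η') * (1 - q)⁻¹) + D + C * η', fun s => ?_⟩, fun k s hs => ?_⟩
  · have hk := h.mem_intervalIndex s
    set k := intervalIndex t s with hkdef
    simp only [u, ← hkdef]
    rw [mul_add]
    refine (abs_add_le _ _).trans (add_le_add ((abs_add_le _ _).trans (add_le_add ?_
      (hEd k s hk))) (h.abs_integral_expDecay_mul_le hC hk))
    rw [abs_mul, abs_mul, abs_of_pos (expDecay_pos _ _ _)]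
    exact (mul_le_of_le_one_left (by positivity) (hE1 k s hk)).trans
      (mul_le_mul (hγ k) (hX k) (abs_nonneg _) hA.le)
  · have : u (t k) = X k := by simpa using huX (k - 1)
    rw [this]
    simp only [u, h.intervalIndex_eq hs]

variable {f u : ℝ → ℝ} {d : ℤ → ℝ}

/-- Estimates on the whole line, from estimates with a decaying error term. -/
theorem le_of_forall_le_add (h : LinearImpulsive a t γ aL aM η η' A B) {C x y K : ℝ} {s : ℝ}
    (hC : ∀ k, |u (t k)| ≤ C)
    (hx : ∀ N, N ≤ intervalIndex t s →
      x ≤ y + expDecay (fun _ => aL) (t N) s * (A * |u (t N)| + K)) : x ≤ y := by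
  have h1 : Tendsto (fun N => y + expDecay (fun _ => aL) (t N) s * (A * C + K)) atBot
      (𝓝 (y + 0 * (A * C + K))) :=
    tendsto_const_nhds.add ((h.tendsto_expDecay_atBot s).mul_const _)
  rw [zero_mul, add_zero] at h1
  refine ge_of_tendsto h1 ?_
  filter_upwards [eventually_le_atBot (intervalIndex t s)] with N hN
  refine (hx N hN).trans ?_
  have := (expDecay_pos (fun _ => aL) (t N) s).le
  have := h.A_pos
  gcongr
  exact hC N

theorem le_of_forcing_le_entire (h : LinearImpulsive a t γ aL aM η η' A B) {S D : ℝ}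
    (hSD : 0 ≤ S ∨ 0 ≤ D ∧ 0 ≤ D + S / aL * (Real.exp (aL * η') - 1)) (hf : BddMeas f)
    (hu : ∀ k, MildOn a t γ f d u k) {C : ℝ} (hC : ∀ k, |u (t k)| ≤ C) (hfS : ∀ r, f r ≤ S)
    (hd : ∀ k, d k ≤ D) (s : ℝ) :
    u s ≤ A / aL * S + A * max D 0 / (1 - Real.exp (-(aL * η))) :=
  h.le_of_forall_le_add hC fun _ hN => h.le_of_forcing_le hSD hf hN (h.mem_intervalIndex s)
    (fun k _ _ => hu k) (fun r _ => hfS r) hd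

theorem le_of_le_forcing_entire (h : LinearImpulsive a t γ aL aM η η' A B) {S D : ℝ}
    (hpos : 0 ≤ lowerConst aL aM η η' A B S D) (hf : BddMeas f)
    (hu : ∀ k, MildOn a t γ f d u k) {C : ℝ} (hC : ∀ k, |u (t k)| ≤ C) (hfS : ∀ r, S ≤ f r)
    (hd : ∀ k, D ≤ d k) (s : ℝ) : lowerConst aL aM η η' A B S D ≤ u s :=
  h.le_of_forall_le_add (K := lowerConst aL aM η η' A B S D + B / aM * |S|) hC fun N hN => by
    have := h.le_of_le_forcing hpos hf hN (h.mem_intervalIndex s)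
      (fun k _ _ => hu k) (fun r _ => hfS r) hd
    linarith

theorem abs_le_of_mildOn_entire (h : LinearImpulsive a t γ aL aM η η' A B) {D I : ℝ}
    (hf : BddMeas f) (hu : ∀ k, MildOn a t γ f d u k) {C : ℝ} (hC : ∀ k, |u (t k)| ≤ C)
    (hd : ∀ k, |d k| ≤ D) {s : ℝ}
    (hI : ∀ N, N ≤ intervalIndex t s →
      ∫ r in t N..s, expDecay (fun _ => aL) r s * |f r| ≤ I) :
    |u s| ≤ A * D / (1 - Real.exp (-(aL * η))) + A * I :=
  h.le_of_forall_le_add (K := 0) hC fun N hN => by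
    have := h.abs_le_of_mildOn hf hN (h.mem_intervalIndex s) (fun k _ _ => hu k) hd
    have := mul_le_mul_of_nonneg_left (hI N hN) h.A_pos.le
    linarith

/-- The estimate for forcing bounded by a constant and no impulses. -/
theorem abs_le_of_abs_forcing_le (h : LinearImpulsive a t γ aL aM η η' A B) {F : ℝ}
    (hf : BddMeas f) (hu : ∀ k, MildOn a t γ f (fun _ => 0) u k) {C : ℝ}
    (hC : ∀ k, |u (t k)| ≤ C) (hF : ∀ r, |f r| ≤ F) (s : ℝ) : |u s| ≤ A / aL * F := by
  have hF0 : 0 ≤ F := (abs_nonneg _).trans (hF 0)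
  have := h.abs_le_of_mildOn_entire (I := F / aL) hf hu hC (fun k => (abs_zero).le) (s := s)
    fun N hN => by
      have hle := (h.mem_step hN (h.mem_intervalIndex s)).2.2.2.2
      calc _ ≤ ∫ r in t N..s, expDecay (fun _ => aL) r s * F := by
            refine intervalIntegral.integral_mono_on hle
              (hf.abs.intervalIntegrable_mul (continuous_expDecay continuous_const s) _ _)
              (((continuous_expDecay continuous_const s).mul
                continuous_const).intervalIntegrable _ _)
              fun r _ => mul_le_mul_of_nonneg_left (hF r) (expDecay_pos _ _ _).le
        _ = F / aL * (expDecay (fun _ => aL) s s - expDecay (fun _ => aL) (t N) s) :=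
            integral_expDecay_const_mul h.aL_pos.ne' _ _ _ _
        _ ≤ F / aL := by
            rw [expDecay_self]
            refine mul_le_of_le_one_right (div_nonneg hF0 h.aL_pos.le) ?_
            linarith [expDecay_pos (fun _ => aL) (t N) s]
  refine this.trans_eq ?_
  ring

end LinearImpulsive

/-! ### The Hill function -/

/-- The Hill function `1 / (1 + x ^ α)`. -/
noncomputable def hill (α x : ℝ) : ℝ := 1 / (1 + x ^ α)

theorem hill_nonneg {α x : ℝ} (hx : 0 ≤ x) : 0 ≤ hill α x := by
  have := Real.rpow_nonneg hx α
  rw [hill]; positivity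

theorem hill_le_one {α x : ℝ} (hx : 0 ≤ x) : hill α x ≤ 1 := by
  have := Real.rpow_nonneg hx α
  rw [hill, div_le_one (by positivity)]; linarith

theorem hill_antitone {α x y : ℝ} (hα : 0 < α) (hx : 0 ≤ x) (hxy : x ≤ y) :
    hill α y ≤ hill α x := by
  have := Real.rpow_nonneg hx α
  have := Real.rpow_le_rpow hx hxy hα.le
  rw [hill, hill]
  gcongr

theorem measurable_hill (α : ℝ) : Measurable (hill α) :=
  measurable_const.div (measurable_const.add (measurable_id.pow_const α))

theorem continuousAt_hill {α x : ℝ} (hα : 0 < α) (hx : 0 ≤ x) :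
    ContinuousAt (hill α) x := by
  have := Real.rpow_nonneg hx α
  exact continuousAt_const.div (continuousAt_const.add
    (Real.continuousAt_rpow_const x α (Or.inr hα.le))) (by positivity)

/-- The maximum of the derivative of `x ^ α` on `[c, d]`. -/
noncomputable def hillLip (α c d : ℝ) : ℝ := max (α * c ^ (α - 1)) (α * d ^ (α - 1))

theorem hillLip_nonneg {α c d : ℝ} (hα : 0 < α) (hc : 0 < c) : 0 ≤ hillLip α c d :=
  le_max_of_le_left (mul_nonneg hα.le (Real.rpow_nonneg hc.le _))

theorem mul_rpow_le_hillLip {α c d x : ℝ} (hα : 0 < α) (hc : 0 < c) (hx : x ∈ Icc c d) :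
    α * x ^ (α - 1) ≤ hillLip α c d := by
  have hx0 : 0 < x := hc.trans_le hx.1
  rcases le_total 1 α with h | h
  · exact le_max_of_le_right (mul_le_mul_of_nonneg_left
      (Real.rpow_le_rpow hx0.le hx.2 (by linarith)) hα.le)
  · exact le_max_of_le_left (mul_le_mul_of_nonneg_left
      (Real.rpow_le_rpow_of_nonpos hc hx.1 (by linarith)) hα.le)

/-- The mean value inequality, with the denominator (1 + z^α)^2 ≥ 1 dropped. The bound c > 0 is
essential for α < 1, where the derivative blows up at 0. -/
theorem abs_hill_sub_le {α c d x y : ℝ} (hα : 0 < α) (hc : 0 < c) (hx : x ∈ Icc c d)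
    (hy : y ∈ Icc c d) : |hill α x - hill α y| ≤ hillLip α c d * |x - y| := by
  have hd : ∀ z ∈ Icc c d,
      HasDerivWithinAt (hill α) (-(α * z ^ (α - 1)) / (1 + z ^ α) ^ 2) (Icc c d) z := by
    intro z hz
    have hz0 : 0 < z := hc.trans_le hz.1
    have hp := Real.rpow_nonneg hz0.le α
    have h1 := (Real.hasDerivAt_rpow_const (p := α) (Or.inl hz0.ne')).const_add 1
    have h2 := h1.fun_inv (by positivity)
    have : hill α = fun x => (1 + x ^ α)⁻¹ := by ext; simp [hill]
    rw [this]
    exact h2.hasDerivWithinAt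
  refine (convex_Icc c d).norm_image_sub_le_of_norm_hasDerivWithin_le hd (fun z hz => ?_) hy hx
  have hz0 : 0 < z := hc.trans_le hz.1
  have hp := Real.rpow_nonneg hz0.le α
  have hp' := Real.rpow_nonneg hz0.le (α - 1)
  rw [norm_div, norm_neg, Real.norm_of_nonneg (by positivity), Real.norm_of_nonneg (by positivity)]
  refine le_trans (div_le_self (by positivity) ?_) (mul_rpow_le_hillLip hα hc hz)
  exact one_le_pow₀ (by linarith)

/-- The power x^(α - 1) is monotone, so endpoints suffice. The endpoint form is visibly continuous
in c and d, as needed when the interval is enlarged for stability. -/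
theorem hillLip_le_sSup {α c d : ℝ} (hα : 0 < α) (hc : 0 < c) (hcd : c ≤ d) :
    hillLip α c d ≤ sSup ((fun x : ℝ => α * x ^ (α - 1)) '' Icc c d) := by
  have hb : BddAbove ((fun x : ℝ => α * x ^ (α - 1)) '' Icc c d) :=
    ⟨hillLip α c d, by rintro _ ⟨x, hx, rfl⟩; exact mul_rpow_le_hillLip hα hc hx⟩
  exact max_le (le_csSup hb ⟨c, ⟨le_rfl, hcd⟩, rfl⟩) (le_csSup hb ⟨d, ⟨hcd, le_rfl⟩, rfl⟩)

/-- Secant slopes of the convex exponential from 0 increase. -/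
theorem exp_sub_one_div_le {x y η : ℝ} (hx : 0 < x) (hxy : x ≤ y) :
    (Real.exp (x * η) - 1) / x ≤ (Real.exp (y * η) - 1) / y := by
  have hy := hx.trans_le hxy
  have h := convexOn_exp.2 (mem_univ (0 : ℝ)) (mem_univ (y * η))
    (sub_nonneg.2 ((div_le_one hy).2 hxy)) (show 0 ≤ x / y by positivity) (by ring)
  simp only [smul_eq_mul, mul_zero, zero_add, Real.exp_zero, mul_one] at h
  rw [← mul_assoc, div_mul_cancel₀ _ hy.ne'] at h
  rw [div_le_iff₀ hx]
  calc _ ≤ x / y * (Real.exp (y * η) - 1) := by linarith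
    _ = _ := by ring

/-! ### Constants and standing assumptions of the model -/

namespace HematopoiesisModel

variable {m : ℕ} {P : HematopoiesisModel m} {L : Fin m → ℝ}

/-- The delayed part of the right-hand side. -/
noncomputable def forcing (P : HematopoiesisModel m) (x : ℝ → ℝ) (s : ℝ) : ℝ :=
  ∑ i, (P.b i s / (1 + x (s - P.tau i s) ^ P.alpha i)
    + P.c i s * (∫ r in (0 : ℝ)..P.T, P.v i r / (1 + x (s - r) ^ P.beta i))
    - P.H i s (x (s - P.sig i s)))

theorem rhs_eq (x : ℝ → ℝ) (s : ℝ) : P.rhs x s = -(P.a s * x s) + P.forcing x s := rfl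

/-- The sum of the maximal production rates minus the minimal harvesting rates. -/
noncomputable def upperForcing (P : HematopoiesisModel m) : ℝ := ∑ i, (P.bM i + P.cM i - P.HL i)

/-- The minimal forcing for states that are at most `y`. -/
noncomputable def lowerForcing (P : HematopoiesisModel m) (y : ℝ) : ℝ :=
  ∑ i, (P.bL i / (1 + y ^ P.alpha i) + P.cL i / (1 + y ^ P.beta i) - P.HM i)

/-- A Lipschitz constant of the forcing for states in `[c, d]`. -/
noncomputable def forcingLip (P : HematopoiesisModel m) (L : Fin m → ℝ) (c d : ℝ) : ℝ :=
  ∑ i, (P.bM i * hillLip (P.alpha i) c d + P.cM i * hillLip (P.beta i) c d + L i)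

/-- The standing assumptions on the coefficients, the impulses and the size of the bounds. -/
structure Standing (P : HematopoiesisModel m) (L : Fin m → ℝ) : Prop where
  admissible : P.Admissible
  decay : P.DecayAssumption
  production : P.ProductionAssumption
  harvest : P.HarvestAssumption L
  delay : P.DelayAssumption
  shift : P.ImpulseShiftAssumption
  factor : P.ImpulseFactorAssumption
  time : P.ImpulseTimeAssumption
  M₁_nonneg : 0 ≤ P.M₁
  M₂_pos : 0 < P.M₂
  delay_le : P.maxDelay ≤ P.eta
  contraction : 1 / P.aL * max P.A (P.gammaL + 1)⁻¹ *
      ∑ i, (P.bM i * P.KStar i + P.cM i * P.GStar i + L i) < 1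

theorem bddAbove_of_abs_le {ι : Sort*} {f : ι → ℝ} {C : ℝ} (h : ∀ s, |f s| ≤ C) :
    BddAbove (range f) := ⟨C, by rintro _ ⟨s, rfl⟩; exact (le_abs_self _).trans (h s)⟩

theorem bddBelow_of_abs_le {ι : Sort*} {f : ι → ℝ} {C : ℝ} (h : ∀ s, |f s| ≤ C) :
    BddBelow (range f) := ⟨-C, by rintro _ ⟨s, rfl⟩; exact (abs_le.1 (h s)).1⟩

theorem _root_.BohrAlmostPeriodic.bddAbove {f : ℝ → ℝ} (h : BohrAlmostPeriodic f) :
    BddAbove (range f) := h.bounded.elim fun _ => bddAbove_of_abs_le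

theorem _root_.BohrAlmostPeriodic.bddBelow {f : ℝ → ℝ} (h : BohrAlmostPeriodic f) :
    BddBelow (range f) := h.bounded.elim fun _ => bddBelow_of_abs_le

theorem _root_.BohrAlmostPeriodic.bddMeas {f : ℝ → ℝ} (h : BohrAlmostPeriodic f) : BddMeas f :=
  ⟨h.1.measurable, h.bounded⟩

namespace Standing

theorem aL_le (h : P.Standing L) (s : ℝ) : P.aL ≤ P.a s := ciInf_le h.decay.1.bddBelow s

theorem le_aM (h : P.Standing L) (s : ℝ) : P.a s ≤ P.aM := le_ciSup h.decay.1.bddAbove s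

theorem bL_le (h : P.Standing L) (i) (s : ℝ) : P.bL i ≤ P.b i s :=
  ciInf_le (h.production i).2.2.1.bddBelow s

theorem le_bM (h : P.Standing L) (i) (s : ℝ) : P.b i s ≤ P.bM i :=
  le_ciSup (h.production i).2.2.1.bddAbove s

theorem cL_le (h : P.Standing L) (i) (s : ℝ) : P.cL i ≤ P.c i s :=
  ciInf_le (h.production i).2.2.2.bddBelow s

theorem le_cM (h : P.Standing L) (i) (s : ℝ) : P.c i s ≤ P.cM i :=
  le_ciSup (h.production i).2.2.2.bddAbove s

theorem bM_nonneg (h : P.Standing L) (i) : 0 ≤ P.bM i := ((h.production i).1 0).trans (h.le_bM i 0)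

theorem cM_nonneg (h : P.Standing L) (i) : 0 ≤ P.cM i :=
  ((h.production i).2.1 0).trans (h.le_cM i 0)

theorem bL_nonneg (h : P.Standing L) (i) : 0 ≤ P.bL i := le_ciInf (h.production i).1

theorem cL_nonneg (h : P.Standing L) (i) : 0 ≤ P.cL i := le_ciInf (h.production i).2.1

theorem HL_le (h : P.Standing L) (i) (s : ℝ) {x : ℝ} (hx : 0 ≤ x) : P.HL i ≤ P.H i s x := by
  have hb : BddBelow (range fun p : ℝ × ℝ≥0 => P.H i p.1 p.2) :=
    ⟨0, by rintro _ ⟨p, rfl⟩; exact (h.harvest i).1 _ _ p.2.2⟩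
  exact ciInf_le hb (s, ⟨x, hx⟩)

theorem le_HM (h : P.Standing L) (i) (s : ℝ) {x : ℝ} (hx : 0 ≤ x) : P.H i s x ≤ P.HM i := by
  obtain ⟨C, hC⟩ := (h.harvest i).2.1
  have hb : BddAbove (range fun p : ℝ × ℝ≥0 => P.H i p.1 p.2) :=
    ⟨C, by rintro _ ⟨p, rfl⟩; exact hC _ _ p.2.2⟩
  exact le_ciSup hb (s, ⟨x, hx⟩)

theorem T_le (_ : P.Standing L) : P.T ≤ P.maxDelay := le_max_left _ _

theorem delays_le (h : P.Standing L) (i) (s : ℝ) :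
    P.tau i s ≤ P.maxDelay ∧ P.sig i s ≤ P.maxDelay := by
  have h1 : max (⨆ s, P.tau i s) (⨆ s, P.sig i s) ≤ P.maxDelay :=
    (le_ciSup (f := fun i => max (⨆ s, P.tau i s) (⨆ s, P.sig i s))
      (finite_range _).bddAbove i).trans (le_max_right _ _)
  exact ⟨(le_ciSup (h.delay i).1.1.bddAbove s).trans ((le_max_left _ _).trans h1),
    (le_ciSup (h.delay i).2.1.bddAbove s).trans ((le_max_right _ _).trans h1)⟩

theorem maxDelay_pos (h : P.Standing L) : 0 < P.maxDelay := h.admissible.T_pos.trans_le h.T_le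

theorem deltaL_le (h : P.Standing L) (k : ℤ) : P.deltaL ≤ P.delta k :=
  ciInf_le (h.shift.bounded.elim fun _ => bddBelow_of_abs_le) k

theorem le_deltaM (h : P.Standing L) (k : ℤ) : P.delta k ≤ P.deltaM :=
  le_ciSup (h.shift.bounded.elim fun _ => bddAbove_of_abs_le) k

/-- Almost periodicity supplies the boundedness that makes the infima and suprema of the data true
bounds and not default values; the products of impulse factors are bounded below by 0. -/
theorem linear (h : P.Standing L) :
    LinearImpulsive P.a P.t P.gamma P.aL P.aM P.eta P.etaBar P.A P.B := by
  have hgap := h.time.1.almostPeriodicSeq.bounded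
  have hpos : ∀ k, 0 < 1 + P.gamma k := fun k => by
    have h1 : P.gammaL ≤ P.gamma k :=
      ciInf_le (h.factor.1.bounded.elim fun _ => bddBelow_of_abs_le) k
    linarith [h.factor.2.1]
  have hbelow : BddBelow P.gammaProducts := ⟨0, by
    rintro _ ⟨q, p, -, rfl⟩
    exact (Finset.prod_pos fun i _ => hpos i).le⟩
  exact {
    cont := h.decay.1.1
    aL_pos := h.decay.2
    aL_le := h.aL_le
    le_aM := h.le_aM
    eta_pos := h.time.2
    eta_le := fun k => ciInf_le (hgap.elim fun _ => bddBelow_of_abs_le) k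
    le_eta' := fun k => le_ciSup (hgap.elim fun _ hC => bddAbove_of_abs_le hC) k
    tendsto_atTop := h.admissible.t_atTop
    tendsto_atBot := h.admissible.t_atBot
    factor_pos := hpos
    B_pos := lt_min h.factor.2.2.2 one_pos
    B_le_one := min_le_right _ _
    one_le_A := le_max_right _ _
    le_prod := fun q p hqp => (min_le_left _ _).trans (csInf_le hbelow ⟨q, p, hqp, rfl⟩)
    prod_le := fun q p hqp => (le_csSup h.factor.2.2.1 ⟨q, p, hqp, rfl⟩).trans (le_max_left _ _) }

theorem M₁_eq (_ : P.Standing L) : P.M₁ = P.A / P.aL * P.upperForcing +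
    P.A * max P.deltaM 0 / (1 - Real.exp (-(P.aL * P.eta))) := rfl

theorem M₂_eq (_ : P.Standing L) : P.M₂ = lowerConst P.aL P.aM P.eta P.etaBar P.A P.B
    (P.lowerForcing P.M₁) P.deltaL := rfl

theorem lowerForcing_le_upperForcing (h : P.Standing L) {y : ℝ} (hy : 0 ≤ y) :
    P.lowerForcing y ≤ P.upperForcing := by
  refine Finset.sum_le_sum fun i _ => ?_
  have h1 : P.bL i / (1 + y ^ P.alpha i) ≤ P.bM i := by
    have := Real.rpow_nonneg hy (P.alpha i)
    exact (div_le_self (h.bL_nonneg i) (by linarith)).trans ((h.bL_le i 0).trans (h.le_bM i 0))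
  have h2 : P.cL i / (1 + y ^ P.beta i) ≤ P.cM i := by
    have := Real.rpow_nonneg hy (P.beta i)
    exact (div_le_self (h.cL_nonneg i) (by linarith)).trans ((h.cL_le i 0).trans (h.le_cM i 0))
  have h3 : P.HL i ≤ P.HM i := (h.HL_le i 0 le_rfl).trans (h.le_HM i 0 le_rfl)
  linarith

/-- A negative upper forcing makes the lower forcing negative too, so M₂ > 0 must come from the
jumps: δ_L ≥ 0, and a jump δ_L followed by forcing `lowerForcing` at rate a_M over the longest gap
has positive total. Passing to δ_M, to `upperForcing` and to the rate a_L only increases this total.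
-/
theorem upper_condition (h : P.Standing L) : 0 ≤ P.upperForcing ∨ 0 ≤ P.deltaM ∧
    0 ≤ P.deltaM + P.upperForcing / P.aL * (Real.exp (P.aL * P.etaBar) - 1) := by
  rcases le_or_gt 0 P.upperForcing with hS | hS
  · exact Or.inl hS
  refine Or.inr ?_
  have hl := h.linear
  have hSS := h.lowerForcing_le_upperForcing h.M₁_nonneg
  have hpos := h.M₂_pos
  set S := P.upperForcing
  set S' := P.lowerForcing P.M₁ with hS'
  have hS'0 : S' < 0 := hSS.trans_lt hS
  rw [h.M₂_eq, ← hS', lowerConst] at hpos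
  have hB := hl.B_pos
  have hM := hl.aM_pos
  have hq := hl.exp_eta_pos
  have hq' := hl.exp_eta'_pos
  have hneg : P.B / P.aM * S' < 0 := mul_neg_of_pos_of_neg (by positivity) hS'0
  have hδ := (h.deltaL_le 0).trans (h.le_deltaM 0)
  split_ifs at hpos with hD
  · refine ⟨hD.trans hδ, ?_⟩
    have hE : Real.exp (-(P.aM * P.etaBar)) * Real.exp (P.aM * P.etaBar) = 1 := by
      rw [← Real.exp_add]; simp
    set q := Real.exp (-(P.aM * P.etaBar))
    set Q := Real.exp (P.aM * P.etaBar)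
    have hQ : 0 < Q := Real.exp_pos _
    have e : P.B * P.deltaL * q / (1 - q) = P.B * (P.deltaL / (Q - 1)) := by
      have : q = 1 / Q := by rw [eq_div_iff hQ.ne']; exact hE
      have h1 : Q - 1 ≠ 0 := by
        intro h0
        have : Q = 1 := by linarith
        rw [this, mul_one] at hE
        linarith
      rw [this]
      have h2 : 1 - 1 / Q = (Q - 1) / Q := by field_simp
      rw [h2]
      field_simp
    have h0 : 0 < S' / P.aM + P.deltaL / (Q - 1) := by
      have : 0 < P.B * (S' / P.aM + P.deltaL / (Q - 1)) := by
        rw [e] at hpos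
        calc _ < _ := hpos
          _ = _ := by ring
      exact pos_of_mul_pos_right this hB.le
    have hQ1 : 0 < Q - 1 := by
      have : 1 < Q := Real.one_lt_exp_iff.2 (mul_pos hM hl.eta'_pos)
      linarith
    have h1 : 0 < S' * ((Q - 1) / P.aM) + P.deltaL := by
      have := mul_pos h0 hQ1
      rw [add_mul, div_mul_cancel₀ _ hQ1.ne'] at this
      calc _ < _ := this
        _ = _ := by ring
    have h2 := exp_sub_one_div_le (η := P.etaBar) hl.aL_pos ((h.aL_le 0).trans (h.le_aM 0))
    have h3 : S' * ((Q - 1) / P.aM) ≤ S * ((Real.exp (P.aL * P.etaBar) - 1) / P.aL) :=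
      (mul_le_mul_of_nonpos_left h2 hS'0.le).trans (mul_le_mul_of_nonneg_right hSS
        (div_nonneg (sub_nonneg.2 (Real.one_le_exp (mul_pos hl.aL_pos hl.eta'_pos).le))
          hl.aL_pos.le))
    calc 0 ≤ P.deltaM + S * ((Real.exp (P.aL * P.etaBar) - 1) / P.aL) := by linarith
      _ = _ := by ring
  · have : P.A * P.deltaL / (1 - Real.exp (-(P.aL * P.eta))) ≤ 0 :=
      div_nonpos_of_nonpos_of_nonneg (mul_nonpos_of_nonneg_of_nonpos hl.A_pos.le
        (not_le.1 hD).le) hq.le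
    linarith

end Standing

end HematopoiesisModel

/-! ### The delayed forcing: bounds, Lipschitz estimate, regularity -/

theorem bddMeas_hill_comp {α : ℝ} {φ : ℝ → ℝ} (hφ : Measurable φ) (h0 : ∀ s, 0 ≤ φ s) :
    BddMeas fun s => hill α (φ s) :=
  ⟨(measurable_hill α).comp hφ, 1, fun s => by
    rw [abs_of_nonneg (hill_nonneg (h0 s))]; exact hill_le_one (h0 s)⟩

namespace HematopoiesisModel.Standing

variable {m : ℕ} {P : HematopoiesisModel m} {L : Fin m → ℝ}

theorem intervalIntegrable_v_mul (h : P.Standing L) (i) {w : ℝ → ℝ} (hw : BddMeas w) :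
    IntervalIntegrable (fun r => P.v i r * w r) MeasureTheory.volume 0 P.T := by
  obtain ⟨hm, C, hC⟩ := hw
  have hv := h.admissible.v_integrable i
  exact ⟨MeasureTheory.Integrable.mul_bdd (c := C) hv.1 hm.aestronglyMeasurable (.of_forall hC),
    MeasureTheory.Integrable.mul_bdd (c := C) hv.2 hm.aestronglyMeasurable (.of_forall hC)⟩

theorem integral_v_mul_le (h : P.Standing L) (i) {w : ℝ → ℝ} (hw : BddMeas w) {K : ℝ}
    (hK : ∀ r ∈ Icc 0 P.T, w r ≤ K) : ∫ r in (0 : ℝ)..P.T, P.v i r * w r ≤ K := by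
  calc _ ≤ ∫ r in (0 : ℝ)..P.T, P.v i r * K :=
        intervalIntegral.integral_mono_on h.admissible.T_pos.le (h.intervalIntegrable_v_mul i hw)
          (h.intervalIntegrable_v_mul i (bddMeas_const K))
          fun r hr => mul_le_mul_of_nonneg_left (hK r hr) (h.admissible.v_nonneg i r hr)
    _ = K := by rw [intervalIntegral.integral_mul_const, h.admissible.v_integral i, one_mul]

theorem le_integral_v_mul (h : P.Standing L) (i) {w : ℝ → ℝ} (hw : BddMeas w) {K : ℝ}
    (hK : ∀ r ∈ Icc 0 P.T, K ≤ w r) : K ≤ ∫ r in (0 : ℝ)..P.T, P.v i r * w r := by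
  have := h.integral_v_mul_le i hw.neg (K := -K) fun r hr => neg_le_neg (hK r hr)
  simp only [mul_neg, intervalIntegral.integral_neg] at this
  linarith

theorem abs_integral_v_mul_le (h : P.Standing L) (i) {w : ℝ → ℝ} (hw : BddMeas w) {K : ℝ}
    (hK : ∀ r ∈ Icc 0 P.T, |w r| ≤ K) : |∫ r in (0 : ℝ)..P.T, P.v i r * w r| ≤ K :=
  abs_le.2 ⟨h.le_integral_v_mul i hw fun r hr => (abs_le.1 (hK r hr)).1,
    h.integral_v_mul_le i hw fun r hr => (abs_le.1 (hK r hr)).2⟩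

theorem forcing_eq (_ : P.Standing L) (φ : ℝ → ℝ) (s : ℝ) : P.forcing φ s =
    ∑ i, (P.b i s * hill (P.alpha i) (φ (s - P.tau i s)) +
      P.c i s * (∫ r in (0 : ℝ)..P.T, P.v i r * hill (P.beta i) (φ (s - r))) -
      P.H i s (φ (s - P.sig i s))) := by
  simp only [forcing, hill, mul_one_div]

variable {φ ψ : ℝ → ℝ}

theorem bddMeas_hill_shift (_ : P.Standing L) (β s : ℝ) (hφ : Measurable φ) (h0 : ∀ s, 0 ≤ φ s) :
    BddMeas fun r => hill β (φ (s - r)) :=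
  bddMeas_hill_comp (hφ.comp (measurable_const.sub measurable_id)) fun _ => h0 _

theorem forcing_le (h : P.Standing L) (hφ : Measurable φ) (h0 : ∀ s, 0 ≤ φ s) (s : ℝ) :
    P.forcing φ s ≤ P.upperForcing := by
  rw [h.forcing_eq]
  refine Finset.sum_le_sum fun i _ => ?_
  have h1 : P.b i s * hill (P.alpha i) (φ (s - P.tau i s)) ≤ P.bM i :=
    (mul_le_of_le_one_right ((h.production i).1 s) (hill_le_one (h0 _))).trans (h.le_bM i s)
  have h2 : P.c i s * (∫ r in (0 : ℝ)..P.T, P.v i r * hill (P.beta i) (φ (s - r))) ≤ P.cM i :=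
    (mul_le_of_le_one_right ((h.production i).2.1 s) (h.integral_v_mul_le i
      (h.bddMeas_hill_shift _ s hφ h0) fun r _ => hill_le_one (h0 _))).trans (h.le_cM i s)
  have h3 := h.HL_le i s (h0 (s - P.sig i s))
  linarith

theorem mem_delay (h : P.Standing L) (i) (s : ℝ) :
    s - P.tau i s ∈ Icc (s - P.maxDelay) s ∧ s - P.sig i s ∈ Icc (s - P.maxDelay) s ∧
      ∀ r ∈ Icc 0 P.T, s - r ∈ Icc (s - P.maxDelay) s := by
  have h1 := h.delays_le i s
  have h2 := h.admissible.tau_nonneg i s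
  have h3 := h.admissible.sig_nonneg i s
  have h4 := h.T_le
  exact ⟨⟨by linarith, by linarith⟩, ⟨by linarith, by linarith⟩,
    fun r hr => ⟨by linarith [hr.2], by linarith [hr.1]⟩⟩

theorem lowerForcing_le (h : P.Standing L) (hφ : Measurable φ) (h0 : ∀ s, 0 ≤ φ s) {s y : ℝ}
    (hy : ∀ r ∈ Icc (s - P.maxDelay) s, φ r ≤ y) : P.lowerForcing y ≤ P.forcing φ s := by
  rw [h.forcing_eq]
  refine Finset.sum_le_sum fun i _ => ?_
  obtain ⟨d1, d2, d3⟩ := h.mem_delay i s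
  have hy0 : 0 ≤ y := (h0 _).trans (hy _ d1)
  have h1 : P.bL i / (1 + y ^ P.alpha i) ≤ P.b i s * hill (P.alpha i) (φ (s - P.tau i s)) := by
    rw [← mul_one_div]
    exact mul_le_mul (h.bL_le i s) (hill_antitone (h.admissible.alpha_pos i) (h0 _) (hy _ d1))
      (hill_nonneg hy0) ((h.production i).1 s)
  have h2 : P.cL i / (1 + y ^ P.beta i) ≤
      P.c i s * (∫ r in (0 : ℝ)..P.T, P.v i r * hill (P.beta i) (φ (s - r))) := by
    rw [← mul_one_div]
    exact mul_le_mul (h.cL_le i s) (h.le_integral_v_mul i (h.bddMeas_hill_shift _ s hφ h0)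
      fun r hr => hill_antitone (h.admissible.beta_pos i) (h0 _) (hy _ (d3 r hr)))
      (hill_nonneg hy0) ((h.production i).2.1 s)
  have h3 := h.le_HM i s (h0 (s - P.sig i s))
  linarith

/-- The delays reach back at most `maxDelay`, so the hypotheses concern only the history on that
window; this locality lets D vary with s in the stability estimate. -/
theorem abs_forcing_sub_le (h : P.Standing L) (hφ : Measurable φ) (h0 : ∀ s, 0 ≤ φ s)
    (hψ : Measurable ψ) (h0' : ∀ s, 0 ≤ ψ s) {s c d D : ℝ} (hc : 0 < c)
    (h1 : ∀ r ∈ Icc (s - P.maxDelay) s, φ r ∈ Icc c d)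
    (h2 : ∀ r ∈ Icc (s - P.maxDelay) s, ψ r ∈ Icc c d)
    (h3 : ∀ r ∈ Icc (s - P.maxDelay) s, |φ r - ψ r| ≤ D) :
    |P.forcing φ s - P.forcing ψ s| ≤ P.forcingLip L c d * D := by
  rw [h.forcing_eq, h.forcing_eq, ← Finset.sum_sub_distrib, forcingLip, Finset.sum_mul]
  refine (Finset.abs_sum_le_sum_abs _ _).trans (Finset.sum_le_sum fun i _ => ?_)
  obtain ⟨d1, d2, d3⟩ := h.mem_delay i s
  have hα := h.admissible.alpha_pos i
  have hβ := h.admissible.beta_pos i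
  have hφi := h.bddMeas_hill_shift (P.beta i) s hφ h0
  have hψi := h.bddMeas_hill_shift (P.beta i) s hψ h0'
  have e1 : |P.b i s * (hill (P.alpha i) (φ (s - P.tau i s)) -
      hill (P.alpha i) (ψ (s - P.tau i s)))| ≤ P.bM i * (hillLip (P.alpha i) c d * D) := by
    rw [abs_mul, abs_of_nonneg ((h.production i).1 s)]
    refine mul_le_mul (h.le_bM i s) ((abs_hill_sub_le hα hc (h1 _ d1) (h2 _ d1)).trans ?_)
      (abs_nonneg _) (h.bM_nonneg i)
    exact mul_le_mul_of_nonneg_left (h3 _ d1) (hillLip_nonneg hα hc)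
  have e2 : |P.c i s * ((∫ r in (0 : ℝ)..P.T, P.v i r * hill (P.beta i) (φ (s - r))) -
      ∫ r in (0 : ℝ)..P.T, P.v i r * hill (P.beta i) (ψ (s - r)))| ≤
      P.cM i * (hillLip (P.beta i) c d * D) := by
    rw [abs_mul, abs_of_nonneg ((h.production i).2.1 s), ← intervalIntegral.integral_sub
      (h.intervalIntegrable_v_mul i hφi) (h.intervalIntegrable_v_mul i hψi)]
    simp only [← mul_sub]
    refine mul_le_mul (h.le_cM i s) (h.abs_integral_v_mul_le i (hφi.sub hψi) fun r hr => ?_)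
      (abs_nonneg _) (h.cM_nonneg i)
    exact (abs_hill_sub_le hβ hc (h1 _ (d3 r hr)) (h2 _ (d3 r hr))).trans
      (mul_le_mul_of_nonneg_left (h3 _ (d3 r hr)) (hillLip_nonneg hβ hc))
  have e3 : |P.H i s (φ (s - P.sig i s)) - P.H i s (ψ (s - P.sig i s))| ≤ L i * D :=
    ((h.harvest i).2.2.2.2 s _ _ (h0 _) (h0' _)).trans
      (mul_le_mul_of_nonneg_left (h3 _ d2) (h.harvest i).2.2.2.1.le)
  rw [abs_le] at *
  constructor <;> linarith

/-- The kernel is only almost everywhere equal to a measurable function on (0, T]; a measurable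
version gives joint measurability of the integrand. -/
theorem measurable_integral_v_mul (h : P.Standing L) (i) {w : ℝ → ℝ} (hw : Measurable w) :
    Measurable fun s => ∫ r in (0 : ℝ)..P.T, P.v i r * w (s - r) := by
  have hi := (h.admissible.v_integrable i).1
  obtain ⟨v', hv', hvv⟩ := hi.aestronglyMeasurable
  have e : (fun s => ∫ r in (0 : ℝ)..P.T, P.v i r * w (s - r)) =
      fun s => ∫ r in Ioc 0 P.T, v' r * w (s - r) := by
    ext s
    rw [intervalIntegral.integral_of_le h.admissible.T_pos.le]
    refine MeasureTheory.integral_congr_ae ?_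
    filter_upwards [hvv] with r hr
    rw [hr]
  rw [e]
  have hm : Measurable fun p : ℝ × ℝ => v' p.2 * w (p.1 - p.2) :=
    (hv'.measurable.comp measurable_snd).mul (hw.comp (measurable_fst.sub measurable_snd))
  exact (MeasureTheory.StronglyMeasurable.integral_prod_right hm.stronglyMeasurable).measurable

/-- Continuity of H_i is assumed only on nonnegative states; truncation at 0 extends it to the plane
without changing it along nonnegative functions. -/
theorem continuous_H_max (h : P.Standing L) (i) :
    Continuous fun p : ℝ × ℝ => P.H i p.1 (max p.2 0) := by
  have : Continuous fun p : ℝ × ℝ => (p.1, max p.2 0) := by fun_prop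
  exact (h.harvest i).2.2.1.1.comp_continuous this fun p => ⟨mem_univ _, le_max_right p.2 0⟩

theorem bddMeas_forcing (h : P.Standing L) (hφ : Measurable φ) (h0 : ∀ s, 0 ≤ φ s) :
    BddMeas (P.forcing φ) := by
  have e : P.forcing φ = fun s => ∑ i, (P.b i s * hill (P.alpha i) (φ (s - P.tau i s)) +
      P.c i s * (∫ r in (0 : ℝ)..P.T, P.v i r * hill (P.beta i) (φ (s - r))) -
      P.H i s (φ (s - P.sig i s))) := by
    ext s; exact h.forcing_eq φ s
  rw [e]
  refine BddMeas.sum fun i => ?_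
  have hτ : Measurable fun s => s - P.tau i s :=
    measurable_id.sub (h.delay i).1.1.1.measurable
  have hσ : Measurable fun s => s - P.sig i s :=
    measurable_id.sub (h.delay i).2.1.1.measurable
  refine BddMeas.sub (BddMeas.add ?_ ?_) ?_
  · exact (h.production i).2.2.1.bddMeas.mul (bddMeas_hill_comp (hφ.comp hτ) fun s => h0 _)
  · refine (h.production i).2.2.2.bddMeas.mul ⟨h.measurable_integral_v_mul i
      ((measurable_hill (P.beta i)).comp hφ), 1, fun s => ?_⟩
    exact h.abs_integral_v_mul_le i (h.bddMeas_hill_shift _ s hφ h0) fun r _ => by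
      rw [abs_of_nonneg (hill_nonneg (h0 _))]; exact hill_le_one (h0 _)
  · have e2 : (fun s => P.H i s (φ (s - P.sig i s))) =
        fun s => P.H i s (max (φ (s - P.sig i s)) 0) := by
      ext s; rw [max_eq_left (h0 _)]
    refine ⟨?_, P.HM i, fun s => ?_⟩
    · rw [e2]
      exact (h.continuous_H_max i).measurable.comp (measurable_id.prodMk (hφ.comp hσ))
    · rw [abs_of_nonneg ((h.harvest i).1 _ _ (h0 _))]
      exact h.le_HM i s (h0 _)

/-- The forcing is continuous wherever the delayed states are. -/
theorem continuousAt_forcing (h : P.Standing L) (hφ : Measurable φ) (h0 : ∀ s, 0 ≤ φ s)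
    (hplc : PLC P.t univ φ) {s : ℝ} (hs : P.RegularTime s) : ContinuousAt (P.forcing φ) s := by
  have hcont : ∀ r, (∀ k, r ≠ P.t k) → ContinuousAt φ r := fun r hr =>
    (continuousWithinAt_univ _ _).1 ((hplc r (mem_univ r)).2.2 hr)
  have e : P.forcing φ = fun s => ∑ i, (P.b i s * hill (P.alpha i) (φ (s - P.tau i s)) +
      P.c i s * (∫ r in (0 : ℝ)..P.T, P.v i r * hill (P.beta i) (φ (s - r))) -
      P.H i s (max (φ (s - P.sig i s)) 0)) := by
    ext s
    rw [h.forcing_eq]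
    simp only [max_eq_left (h0 _)]
  rw [e]
  refine tendsto_finsetSum _ fun i _ => ?_
  have hτ : ContinuousAt (fun s => φ (s - P.tau i s)) s :=
    ContinuousAt.comp (g := φ) (f := fun s => s - P.tau i s) (hcont _ fun k => ((hs k).2 i).1)
      (continuousAt_id.sub (h.delay i).1.1.1.continuousAt)
  have hσ : ContinuousAt (fun s => φ (s - P.sig i s)) s :=
    ContinuousAt.comp (g := φ) (f := fun s => s - P.sig i s) (hcont _ fun k => ((hs k).2 i).2)
      (continuousAt_id.sub (h.delay i).2.1.1.continuousAt)
  refine ContinuousAt.sub (ContinuousAt.add ?_ ?_) ?_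
  · exact (h.production i).2.2.1.1.continuousAt.mul
      (ContinuousAt.comp (g := hill (P.alpha i)) (f := fun s => φ (s - P.tau i s))
        (continuousAt_hill (h.admissible.alpha_pos i) (h0 _)) hτ)
  · refine (h.production i).2.2.2.1.continuousAt.mul ?_
    -- Dominated convergence: s - r is an impulse time for only countably many r, so jumps of φ do
    -- not affect the distributed delay.
    refine intervalIntegral.continuousAt_of_dominated_interval (bound := fun r => ‖P.v i r‖)
      (.of_forall fun x => ?_) (.of_forall fun x => ?_) (h.admissible.v_integrable i).norm ?_
    · have := (h.intervalIntegrable_v_mul i (h.bddMeas_hill_shift (P.beta i) x hφ h0)).1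
      rw [uIoc_of_le h.admissible.T_pos.le]
      exact this.aestronglyMeasurable
    · refine .of_forall fun r _ => ?_
      rw [norm_mul]
      refine mul_le_of_le_one_right (norm_nonneg _) ?_
      rw [Real.norm_of_nonneg (hill_nonneg (h0 _))]; exact hill_le_one (h0 _)
    · have hcount : (range fun k => s - P.t k).Countable := countable_range _
      filter_upwards [hcount.ae_notMem MeasureTheory.volume] with r hr _
      refine continuousAt_const.mul ?_
      have h1 : ContinuousAt φ (s - r) := hcont _ fun k hk => hr ⟨k, by simp only; linarith⟩
      have h2 : ContinuousAt (fun x => φ (x - r)) s :=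
        ContinuousAt.comp (g := φ) (f := fun x => x - r) h1 (continuousAt_id.sub continuousAt_const)
      exact ContinuousAt.comp (g := hill (P.beta i)) (f := fun x => φ (x - r))
        (continuousAt_hill (h.admissible.beta_pos i) (h0 _)) h2
  · exact ContinuousAt.comp (g := fun p : ℝ × ℝ => P.H i p.1 (max p.2 0))
      (f := fun s => (s, φ (s - P.sig i s))) (h.continuous_H_max i).continuousAt
      (continuousAt_id.prodMk hσ)

/-- The mean value theorem with inf (1 - d') > 0. This expansion makes irregular times countable and
the time spent by delayed arguments near impulses short. -/
theorem _root_.HematopoiesisModel.IsRegularDelay.slope {d : ℝ → ℝ} (hd : IsRegularDelay d) :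
    ∃ c : ℝ, 0 < c ∧ ∀ r s, r ≤ s → c * (s - r) ≤ (s - d s) - (r - d r) := by
  obtain ⟨-, hdiff, ⟨C, hC⟩, hpos⟩ := hd
  refine ⟨_, hpos, fun r s hrs => ?_⟩
  have hb : BddBelow (range fun s => 1 - deriv d s) := ⟨1 - C, by
    rintro _ ⟨s, rfl⟩
    have := (abs_le.1 (hC s)).2
    simp only; linarith⟩
  have hder : ∀ s, HasDerivAt (fun s => s - d s) (1 - deriv d s) s := fun s =>
    (hasDerivAt_id s).sub (hdiff s).hasDerivAt
  exact mul_sub_le_image_sub_of_le_deriv (f := fun s => s - d s)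
    (fun s => (hder s).differentiableAt) (fun s => by
      rw [(hder s).deriv]; exact ciInf_le hb s) hrs

theorem countable_not_regularTime (h : P.Standing L) : {s | ¬ P.RegularTime s}.Countable := by
  have hinj : ∀ d, IsRegularDelay d → Function.Injective fun s => s - d s := by
    intro d hd
    obtain ⟨c, hc, H⟩ := hd.slope
    have : StrictMono fun s => s - d s := fun r s hrs => by
      have := H r s hrs.le
      have := mul_pos hc (sub_pos.2 hrs)
      simp only; linarith
    exact this.injective
  have h1 : (range P.t).Countable := countable_range _
  have hsub : {s | ¬ P.RegularTime s} ⊆ range P.t ∪ ⋃ i, ((fun s => s - P.tau i s) ⁻¹' range P.t ∪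
      (fun s => s - P.sig i s) ⁻¹' range P.t) := by
    intro s hs
    simp only [mem_ofPred_eq, RegularTime, not_forall, not_and_or, not_not] at hs
    obtain ⟨k, hk | ⟨i, hk | hk⟩⟩ := hs
    · exact Or.inl ⟨k, hk.symm⟩
    · exact Or.inr (mem_iUnion.2 ⟨i, Or.inl ⟨k, hk.symm⟩⟩)
    · exact Or.inr (mem_iUnion.2 ⟨i, Or.inr ⟨k, hk.symm⟩⟩)
  refine Countable.mono hsub (h1.union (countable_iUnion fun i => ?_))
  exact (h1.preimage_of_injOn (hinj _ (h.delay i).1).injOn).union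
    (h1.preimage_of_injOn (hinj _ (h.delay i).2).injOn)

end HematopoiesisModel.Standing

/-! ### Existence and uniqueness by contraction -/

namespace HematopoiesisModel.Standing

variable {m : ℕ} {P : HematopoiesisModel m} {L : Fin m → ℝ}

theorem abs_delta_le (h : P.Standing L) : ∃ D, ∀ k, |P.delta k| ≤ D := h.shift.bounded

/-- The bounds `M₂` and `M₁` for bounded solutions of the linear equation. -/
theorem le_M₁ (h : P.Standing L) {φ u : ℝ → ℝ} (hφ : Measurable φ) (h0 : ∀ s, 0 ≤ φ s)
    (hu : ∀ k, MildOn P.a P.t P.gamma (P.forcing φ) P.delta u k) {C : ℝ}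
    (hC : ∀ k, |u (P.t k)| ≤ C) (s : ℝ) : u s ≤ P.M₁ :=
  h.linear.le_of_forcing_le_entire h.upper_condition (h.bddMeas_forcing hφ h0) hu hC
    (h.forcing_le hφ h0) h.le_deltaM s

theorem M₂_le (h : P.Standing L) {φ u : ℝ → ℝ} (hφ : Measurable φ) (h0 : ∀ s, 0 ≤ φ s)
    (h1 : ∀ s, φ s ≤ P.M₁) (hu : ∀ k, MildOn P.a P.t P.gamma (P.forcing φ) P.delta u k) {C : ℝ}
    (hC : ∀ k, |u (P.t k)| ≤ C) (s : ℝ) : P.M₂ ≤ u s :=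
  h.linear.le_of_le_forcing_entire h.M₂_pos.le (h.bddMeas_forcing hφ h0) hu hC
    (fun _ => h.lowerForcing_le hφ h0 fun r _ => h1 r) h.deltaL_le s

/-- Invariance of [M₂, M₁]: the estimates starting at t_N lose their error term as N → -∞ because
the solution is bounded. -/
theorem exists_mildOn (h : P.Standing L) {φ : ℝ → ℝ} (hφ : Measurable φ) (h0 : ∀ s, 0 ≤ φ s)
    (h1 : ∀ s, φ s ≤ P.M₁) : ∃ u : ℝ → ℝ, Measurable u ∧ (∀ s, u s ∈ Icc P.M₂ P.M₁) ∧
      ∀ k, MildOn P.a P.t P.gamma (P.forcing φ) P.delta u k := by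
  obtain ⟨D, hD⟩ := h.abs_delta_le
  have hf := h.bddMeas_forcing hφ h0
  obtain ⟨u, ⟨C, hC⟩, hu⟩ := h.linear.exists_bounded_mildOn hf hD
  refine ⟨u, ?_, fun s => ⟨h.M₂_le hφ h0 h1 hu (fun k => hC _) s,
    h.le_M₁ hφ h0 hu (fun k => hC _) s⟩, hu⟩
  simpa using h.linear.measurable_of_PLC MeasurableSet.univ (h.linear.plc_of_mildOn hf hu)

/-- The solution with constant input M₁ takes its values in the interval, which is therefore
nonempty. -/
theorem M₂_le_M₁ (h : P.Standing L) : P.M₂ ≤ P.M₁ := by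
  obtain ⟨u, -, hu, -⟩ := h.exists_mildOn (φ := fun _ => P.M₁) measurable_const
    (fun _ => h.M₁_nonneg) fun _ => le_rfl
  exact (hu 0).1.trans (hu 0).2

theorem forcingLip_nonneg (h : P.Standing L) {c d : ℝ} (hc : 0 < c) :
    0 ≤ P.forcingLip L c d :=
  Finset.sum_nonneg fun i _ => add_nonneg (add_nonneg
    (mul_nonneg (h.bM_nonneg i) (hillLip_nonneg (h.admissible.alpha_pos i) hc))
    (mul_nonneg (h.cM_nonneg i) (hillLip_nonneg (h.admissible.beta_pos i) hc)))
    (h.harvest i).2.2.2.1.le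

theorem contraction_lt (h : P.Standing L) : P.A / P.aL * P.forcingLip L P.M₂ P.M₁ < 1 := by
  refine lt_of_le_of_lt ?_ h.contraction
  have h1 : P.forcingLip L P.M₂ P.M₁ ≤
      ∑ i, (P.bM i * P.KStar i + P.cM i * P.GStar i + L i) := by
    refine Finset.sum_le_sum fun i _ => ?_
    have := h.bM_nonneg i
    have := h.cM_nonneg i
    gcongr
    · exact hillLip_le_sSup (h.admissible.alpha_pos i) h.M₂_pos h.M₂_le_M₁
    · exact hillLip_le_sSup (h.admissible.beta_pos i) h.M₂_pos h.M₂_le_M₁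
  have h0 := h.forcingLip_nonneg h.M₂_pos (d := P.M₁)
  have hL := h.linear.aL_pos
  rw [show P.A / P.aL = 1 / P.aL * P.A by ring]
  have := h.linear.A_pos
  gcongr
  exact le_max_left _ _

/-- The additive jumps cancel in the difference, leaving only the difference of the forcings, which
is Lipschitz on [M₂, M₁]. -/
theorem abs_mildOn_sub_le (h : P.Standing L) {φ ψ u v : ℝ → ℝ} (hφ : Measurable φ)
    (hφM : ∀ s, φ s ∈ Icc P.M₂ P.M₁) (hψ : Measurable ψ) (hψM : ∀ s, ψ s ∈ Icc P.M₂ P.M₁)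
    (hu : ∀ k, MildOn P.a P.t P.gamma (P.forcing φ) P.delta u k)
    (hv : ∀ k, MildOn P.a P.t P.gamma (P.forcing ψ) P.delta v k) {C D : ℝ}
    (hC : ∀ k, |u (P.t k) - v (P.t k)| ≤ C) (hD : ∀ s, |φ s - ψ s| ≤ D) (s : ℝ) :
    |u s - v s| ≤ P.A / P.aL * P.forcingLip L P.M₂ P.M₁ * D := by
  have hφ0 : ∀ s, 0 ≤ φ s := fun s => h.M₂_pos.le.trans (hφM s).1
  have hψ0 : ∀ s, 0 ≤ ψ s := fun s => h.M₂_pos.le.trans (hψM s).1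
  have hf := h.bddMeas_forcing hφ hφ0
  have hg := h.bddMeas_forcing hψ hψ0
  rw [mul_assoc]
  refine h.linear.abs_le_of_abs_forcing_le (u := fun s => u s - v s) (hf.sub hg) (fun k => ?_) hC
    (fun r => h.abs_forcing_sub_le hφ hφ0 hψ hψ0 h.M₂_pos (fun r _ => hφM r) (fun r _ => hψM r)
      fun r _ => hD r) s
  have := (hu k).sub h.linear.cont hf hg (hv k)
  simpa only [sub_self] using this

/-- Existence of a solution of the integral equation with values in `[M₂, M₁]`. -/
theorem exists_mildOn_self (h : P.Standing L) : ∃ x : ℝ → ℝ, Measurable x ∧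
    (∀ s, x s ∈ Icc P.M₂ P.M₁) ∧
      ∀ k, MildOn P.a P.t P.gamma (P.forcing x) P.delta x k := by
  let 𝒟 := {φ : ℝ → ℝ // Measurable φ ∧ ∀ s, φ s ∈ Icc P.M₂ P.M₁}
  have hΦ : ∀ φ : 𝒟, ∃ u : 𝒟, ∀ k, MildOn P.a P.t P.gamma (P.forcing φ.1) P.delta u.1 k := by
    rintro ⟨φ, hφ, hφM⟩
    obtain ⟨u, h1, h2, h3⟩ := h.exists_mildOn hφ (fun s => h.M₂_pos.le.trans (hφM s).1)
      fun s => (hφM s).2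
    exact ⟨⟨u, h1, h2⟩, h3⟩
  choose Φ hΦ using hΦ
  set κ := P.A / P.aL * P.forcingLip L P.M₂ P.M₁ with hκ
  have hκ0 : 0 ≤ κ := mul_nonneg (div_nonneg h.linear.A_pos.le h.linear.aL_pos.le)
    (h.forcingLip_nonneg h.M₂_pos)
  have hκ1 : κ < 1 := h.contraction_lt
  have hdist : ∀ (φ ψ : 𝒟) (s : ℝ), |φ.1 s - ψ.1 s| ≤ P.M₁ - P.M₂ := fun φ ψ s => by
    have h1 := φ.2.2 s
    have h2 := ψ.2.2 s
    rw [abs_le]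
    constructor <;> linarith [h1.1, h1.2, h2.1, h2.2]
  have hcontr : ∀ (φ ψ : 𝒟) (D : ℝ), (∀ s, |φ.1 s - ψ.1 s| ≤ D) →
      ∀ s, |(Φ φ).1 s - (Φ ψ).1 s| ≤ κ * D := fun φ ψ D hD s =>
    h.abs_mildOn_sub_le φ.2.1 φ.2.2 ψ.2.1 ψ.2.2 (hΦ φ) (hΦ ψ) (fun k => hdist _ _ _) hD s
  -- Picard iteration: the iterates converge uniformly at a geometric rate, and the limit keeps
  -- measurability and values in [M₂, M₁].
  let x : ℕ → 𝒟 := fun n => Φ^[n] ⟨fun _ => P.M₁, measurable_const, fun _ => ⟨h.M₂_le_M₁, le_rfl⟩⟩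
  have hx1 : ∀ n, x (n + 1) = Φ (x n) := fun n => Function.iterate_succ_apply' Φ n _
  have hstep : ∀ n s, |(x n).1 s - (x (n + 1)).1 s| ≤ (P.M₁ - P.M₂) * κ ^ n := by
    intro n
    induction n with
    | zero => intro s; simpa using hdist _ _ s
    | succ n ih =>
      intro s
      have := hcontr (x n) (x (n + 1)) _ ih s
      rw [← hx1 n, ← hx1 (n + 1)] at this
      exact this.trans_eq (by ring)
  have hcau : ∀ s, CauchySeq fun n => (x n).1 s := fun s =>
    cauchySeq_of_le_geometric κ _ hκ1 fun n => hstep n s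
  choose y hy using fun s => cauchySeq_tendsto_of_complete (hcau s)
  have hyx : ∀ n s, |(x n).1 s - y s| ≤ (P.M₁ - P.M₂) * κ ^ n / (1 - κ) := fun n s =>
    dist_le_of_le_geometric_of_tendsto κ _ hκ1 (fun n => hstep n s) (hy s) n
  have hymeas : Measurable y :=
    measurable_of_tendsto_metrizable (fun n => (x n).2.1) (tendsto_pi_nhds.2 hy)
  have hyM : ∀ s, y s ∈ Icc P.M₂ P.M₁ := fun s =>
    isClosed_Icc.mem_of_tendsto (hy s) (.of_forall fun n => (x n).2.2 s)
  let Y : 𝒟 := ⟨y, hymeas, hyM⟩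
  have hfix : (Φ Y).1 = y := by
    ext s
    have h1 : Tendsto (fun n => κ * ((P.M₁ - P.M₂) * κ ^ n / (1 - κ))) atTop
        (𝓝 (κ * ((P.M₁ - P.M₂) * 0 / (1 - κ)))) :=
      (((tendsto_pow_atTop_nhds_zero_of_lt_one hκ0 hκ1).const_mul _).div_const _).const_mul _
    simp only [mul_zero, zero_div] at h1
    have h2 : Tendsto (fun n => (x (n + 1)).1 s) atTop (𝓝 ((Φ Y).1 s)) := by
      refine tendsto_iff_dist_tendsto_zero.2 (squeeze_zero (fun _ => dist_nonneg) (fun n => ?_) h1)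
      rw [hx1 n, Real.dist_eq]
      exact hcontr (x n) Y _ (hyx n) s
    exact tendsto_nhds_unique h2 ((hy s).comp (tendsto_add_atTop_nat 1))
  refine ⟨y, hymeas, hyM, fun k => ?_⟩
  have := hΦ Y k
  rwa [hfix] at this

theorem isSolution_of_mildOn (h : P.Standing L) {x : ℝ → ℝ} (hx : Measurable x)
    (h0 : ∀ s, 0 ≤ x s) (hmild : ∀ k, MildOn P.a P.t P.gamma (P.forcing x) P.delta x k) :
    P.IsSolution x := by
  have hf := h.bddMeas_forcing hx h0
  have hplc := h.linear.plc_of_mildOn hf hmild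
  refine ⟨hplc, h0, fun s hs => ?_, fun k => ⟨_, h.linear.tendsto_of_mildOn hf (hmild k), by ring⟩⟩
  exact h.linear.hasDerivAt_of_mildOn hf hmild (fun k => (hs k).1)
    (h.continuousAt_forcing hx h0 hplc hs)

theorem measurable_of_isSolution (h : P.Standing L) {x : ℝ → ℝ} (hx : P.IsSolution x) :
    Measurable x := by
  simpa using h.linear.measurable_of_PLC MeasurableSet.univ hx.plc

theorem mildOn_of_isSolution (h : P.Standing L) {x : ℝ → ℝ} (hx : P.IsSolution x) (k : ℤ) :
    MildOn P.a P.t P.gamma (P.forcing x) P.delta x k := by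
  have hm := h.measurable_of_isSolution hx
  refine h.linear.mildOn_of_hasDerivAt (h.bddMeas_forcing hm hx.nonneg) ?_ ?_
    h.countable_not_regularTime fun s _ hs => ?_
  · simpa using hx.plc.continuousOn h.linear.strictMono k
  · obtain ⟨r, hr, he⟩ := hx.impulse k
    rwa [show (1 + P.gamma k) * x (P.t k) + P.delta k = r by linarith]
  · exact hx.hasDerivAt s (not_not.1 hs)

/-- Uniqueness among the solutions that are bounded at the impulse times. -/
theorem eq_of_mildOn_self (h : P.Standing L) {x y : ℝ → ℝ} (hx : Measurable x)
    (hxM : ∀ s, x s ∈ Icc P.M₂ P.M₁)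
    (hxm : ∀ k, MildOn P.a P.t P.gamma (P.forcing x) P.delta x k) (hy : P.IsSolution y) {C : ℝ}
    (hC : ∀ k, |y (P.t k)| ≤ C) : y = x := by
  have hm := h.measurable_of_isSolution hy
  have hmild := h.mildOn_of_isSolution hy
  -- The upper bound needs only nonnegativity of y; the lower bound uses it, since the forcing is
  -- smallest for large delayed states.
  have h1 := h.le_M₁ hm hy.nonneg hmild hC
  have h2 := h.M₂_le hm hy.nonneg h1 hmild hC
  have hyM : ∀ s, y s ∈ Icc P.M₂ P.M₁ := fun s => ⟨h2 s, h1 s⟩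
  have hb : ∀ s, |y s - x s| ≤ P.M₁ - P.M₂ := fun s => by
    rw [abs_le]
    constructor <;> linarith [(hxM s).1, (hxM s).2, h1 s, h2 s]
  set D := ⨆ s, |y s - x s| with hD
  have hbdd : BddAbove (range fun s => |y s - x s|) := ⟨_, by rintro _ ⟨s, rfl⟩; exact hb s⟩
  have hle : ∀ s, |y s - x s| ≤ D := fun s => le_ciSup hbdd s
  have h3 : D ≤ P.A / P.aL * P.forcingLip L P.M₂ P.M₁ * D :=
    ciSup_le fun s => h.abs_mildOn_sub_le hm hyM hx hxM hmild hxm (fun k => hb _) hle s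
  have hD0 : 0 ≤ D := (abs_nonneg _).trans (hle 0)
  have hκ := h.contraction_lt
  have : D = 0 := by nlinarith
  ext s
  have := (hle s).trans_eq this
  exact sub_eq_zero.1 (abs_nonpos_iff.1 this)

end HematopoiesisModel.Standing

/-! ### Boundedness of piecewise continuous functions -/

/-- Almost periodic functions are bounded at the impulse times. -/
theorem PLCAlmostPeriodic.bounded_at_impulses {t : ℤ → ℝ} {φ : ℝ → ℝ}
    (h : PLCAlmostPeriodic t φ) {η : ℝ} (hη : 0 < η) (hgap : ∀ k, η ≤ t (k + 1) - t k)
    (hloc : ∀ l : ℝ, ∃ C, ∀ s ∈ Icc 0 l, |φ s| ≤ C) : ∃ C, ∀ k, |φ (t k)| ≤ C := by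
  obtain ⟨-, -, huni, hper⟩ := h
  obtain ⟨d, hd, hd'⟩ := huni 1 one_pos
  have hm : StrictMono t := strictMono_int_of_lt_succ fun k => by linarith [hgap k]
  -- Almost periods give no control within ε of an impulse. The point t k - 3ε/2 lies further than ε
  -- from all impulse times, yet in the interval ending at t k and closer than d to it, so uniform
  -- continuity carries its bound to t k.
  set ε := min (d / 2) (η / 4) with hε
  have hε0 : 0 < ε := by positivity
  have hε1 : ε ≤ d / 2 := min_le_left _ _
  have hε2 : ε ≤ η / 4 := min_le_right _ _
  obtain ⟨l, hl, H⟩ := hper ε hε0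
  obtain ⟨C, hC⟩ := hloc l
  refine ⟨C + ε + 1, fun k => ?_⟩
  have hg := hgap (k - 1)
  rw [sub_add_cancel] at hg
  have h1 := hd' (k - 1) (t k) (by rw [sub_add_cancel]; exact ⟨hm (by lia), le_rfl⟩)
    (t k - 3 / 2 * ε) (by rw [sub_add_cancel]; constructor <;> linarith)
    (by rw [sub_sub_cancel, abs_of_pos (by positivity)]; linarith)
  obtain ⟨w, hw, hw1, hw2⟩ := H (-(t k - 3 / 2 * ε))
  have h2 := hw (t k - 3 / 2 * ε) fun j => by
    rcases le_or_gt k j with hj | hj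
    · have := hm.monotone hj
      rw [abs_of_neg (by linarith)]; linarith
    · have := hm.monotone (show j ≤ k - 1 by lia)
      rw [abs_of_pos (by linarith)]; linarith
  have h3 := hC (t k - 3 / 2 * ε + w) ⟨by linarith, by linarith⟩
  rw [abs_lt] at h1 h2
  rw [abs_le] at h3 ⊢
  constructor <;> linarith

/-- Piecewise left continuous functions are bounded on compact sets. -/
theorem PLC.exists_bound {t : ℤ → ℝ} {X : Set ℝ} {φ : ℝ → ℝ} (h : PLC t X φ) {K : Set ℝ}
    (hK : IsCompact K) (hKX : K ⊆ X) : ∃ C, ∀ s ∈ K, |φ s| ≤ C := by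
  refine hK.induction_on (p := fun K => ∃ C, ∀ s ∈ K, |φ s| ≤ C) ⟨0, by simp⟩
    (fun s t hst ⟨C, hC⟩ => ⟨C, fun x hx => hC x (hst hx)⟩)
    (fun s t ⟨C, hC⟩ ⟨D, hD⟩ => ⟨max C D, fun x hx => hx.elim
      (fun hx => (hC x hx).trans (le_max_left _ _)) fun hx => (hD x hx).trans (le_max_right _ _)⟩)
    fun s hs => ?_
  obtain ⟨h1, ⟨r, hr⟩, -⟩ := h s (hKX hs)
  have e1 : ∀ᶠ x in 𝓝[X ∩ Iic s] s, |φ x| < |φ s| + 1 :=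
    h1.tendsto.abs.eventually (gt_mem_nhds (by linarith))
  have e2 : ∀ᶠ x in 𝓝[X ∩ Ioi s] s, |φ x| < |r| + 1 :=
    hr.abs.eventually (gt_mem_nhds (by linarith))
  have e3 : ∀ᶠ x in 𝓝[X] s, |φ x| ≤ max (|φ s| + 1) (|r| + 1) := by
    have : X = X ∩ Iic s ∪ X ∩ Ioi s := by rw [← inter_union_distrib_left]; simp
    rw [this, nhdsWithin_union, eventually_sup]
    exact ⟨e1.mono fun x hx => hx.le.trans (le_max_left _ _),
      e2.mono fun x hx => hx.le.trans (le_max_right _ _)⟩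
  exact ⟨_, nhdsWithin_mono s hKX e3, _, fun x hx => hx⟩

/-! ### Time spent near the impulse times -/

/-- The closed `r`-neighbourhood of the impulse times. -/
def nearImpulses (t : ℤ → ℝ) (r : ℝ) : Set ℝ := {p | ∃ k, |p - t k| ≤ r}

theorem measurableSet_nearImpulses (t : ℤ → ℝ) (r : ℝ) : MeasurableSet (nearImpulses t r) := by
  have : nearImpulses t r = ⋃ k, {p | |p - t k| ≤ r} := by ext; simp [nearImpulses]
  rw [this]
  exact .iUnion fun k => (isClosed_le (by fun_prop) continuous_const).measurableSet

/-- The indicator function of the neighbourhood of the impulse times. -/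
noncomputable def nearInd (t : ℤ → ℝ) (r p : ℝ) : ℝ := (nearImpulses t r).indicator (fun _ => 1) p

theorem nearInd_nonneg (t : ℤ → ℝ) (r p : ℝ) : 0 ≤ nearInd t r p :=
  indicator_nonneg (fun _ _ => zero_le_one) p

theorem nearInd_le_one (t : ℤ → ℝ) (r p : ℝ) : nearInd t r p ≤ 1 :=
  indicator_le_self' (fun _ _ => zero_le_one) p

theorem bddMeas_nearInd (t : ℤ → ℝ) (r : ℝ) : BddMeas (nearInd t r) :=
  ⟨measurable_const.indicator (measurableSet_nearImpulses t r), 1, fun p => by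
    rw [abs_of_nonneg (nearInd_nonneg t r p)]; exact nearInd_le_one t r p⟩

namespace LinearImpulsive

variable {a : ℝ → ℝ} {t γ : ℤ → ℝ} {aL aM η η' A B : ℝ}

/-- The time that an expanding map spends near the impulse times. -/
theorem volume_near_le (h : LinearImpulsive a t γ aL aM η η' A B) {g : ℝ → ℝ} {c : ℝ} (hc : 0 < c)
    (hg : ∀ r s, r ≤ s → c * (s - r) ≤ |g s - g r|) {S : Set ℝ} {j : ℤ}
    (hS : ∀ s ∈ S, g s ∈ Icc (t j - η) (t (j + 1))) {r : ℝ} (hr0 : 0 ≤ r) (hr : r < η) :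
    MeasureTheory.volume {s ∈ S | g s ∈ nearImpulses t r} ≤ ENNReal.ofReal (6 * r / c) := by
  have h1 : ∀ k, MeasureTheory.volume {s | |g s - t k| ≤ r} ≤ ENNReal.ofReal (2 * r / c) := by
    intro k
    refine (Real.volume_le_diam _).trans (Metric.ediam_le fun x hx y hy => ?_)
    rw [edist_dist]
    refine ENNReal.ofReal_le_ofReal ?_
    rw [Real.dist_eq, le_div_iff₀ hc]
    have hx' := abs_le.1 (show |g x - t k| ≤ r from hx)
    have hy' := abs_le.1 (show |g y - t k| ≤ r from hy)
    have hxy : |g x - g y| ≤ 2 * r := by rw [abs_le]; constructor <;> linarith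
    rcases le_total y x with hle | hle
    · rw [abs_of_nonneg (sub_nonneg.2 hle)]
      linarith [hg y x hle]
    · rw [abs_of_nonpos (sub_nonpos.2 hle)]
      have := hg x y hle
      rw [abs_sub_comm] at this
      linarith
  -- The image reaches at most η before t j and r < η, so only the impulses j - 1, j and j + 1 can
  -- be close; each contributes a set of diameter at most 2r/c. In the applications this range comes
  -- from the maximal delay being at most η.
  have hsub : {s ∈ S | g s ∈ nearImpulses t r} ⊆
      {s | |g s - t (j - 1)| ≤ r} ∪ ({s | |g s - t j| ≤ r} ∪ {s | |g s - t (j + 1)| ≤ r}) := by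
    rintro s ⟨hs, k, hk⟩
    have hk' := abs_le.1 hk
    obtain ⟨g1, g2⟩ := hS s hs
    have e1 := h.eta_le (j - 1)
    have e2 := h.eta_le (j - 2)
    have e3 := h.eta_le (j + 1)
    rw [sub_add_cancel] at e1
    rw [show j - 2 + 1 = j - 1 by ring] at e2
    have k1 := h.strictMono.lt_iff_lt.1 (show t (j - 2) < t k by linarith)
    have k2 := h.strictMono.lt_iff_lt.1 (show t k < t (j + 1 + 1) by linarith)
    have : k = j - 1 ∨ k = j ∨ k = j + 1 := by lia
    rcases this with rfl | rfl | rfl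
    · exact Or.inl hk
    · exact Or.inr (Or.inl hk)
    · exact Or.inr (Or.inr hk)
  calc _ ≤ _ := MeasureTheory.measure_mono hsub
    _ ≤ ENNReal.ofReal (2 * r / c) + (ENNReal.ofReal (2 * r / c) + ENNReal.ofReal (2 * r / c)) :=
        (MeasureTheory.measure_union_le _ _).trans (add_le_add (h1 _)
          ((MeasureTheory.measure_union_le _ _).trans (add_le_add (h1 _) (h1 _))))
    _ = ENNReal.ofReal (6 * r / c) := by
        rw [← ENNReal.ofReal_add (by positivity) (by positivity),
          ← ENNReal.ofReal_add (by positivity) (by positivity)]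
        congr 1; ring

theorem integral_nearInd_le (h : LinearImpulsive a t γ aL aM η η' A B) {g : ℝ → ℝ} {c : ℝ}
    (hc : 0 < c) (hg : ∀ r s, r ≤ s → c * (s - r) ≤ |g s - g r|) (hgm : Measurable g) {j : ℤ}
    (hS : ∀ s ∈ Ioc (t j) (t (j + 1)), g s ∈ Icc (t j - η) (t (j + 1))) {r : ℝ} (hr0 : 0 ≤ r)
    (hr : r < η) {s : ℝ} (hs : s ∈ Ioc (t j) (t (j + 1))) :
    ∫ z in t j..s, nearInd t r (g z) ≤ 6 * r / c := by
  have hvol := h.volume_near_le hc hg hS hr0 hr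
  rw [intervalIntegral.integral_of_le hs.1.le]
  have e : ∀ z, nearInd t r (g z) = (g ⁻¹' nearImpulses t r).indicator (fun _ => 1) z := fun z => rfl
  simp_rw [e]
  rw [MeasureTheory.integral_indicator (hgm (measurableSet_nearImpulses t r))]
  simp only [MeasureTheory.integral_const, smul_eq_mul, mul_one,
    MeasureTheory.measureReal_restrict_apply_univ]
  rw [MeasureTheory.measureReal_restrict_apply (hgm (measurableSet_nearImpulses t r))]
  refine ENNReal.toReal_le_of_le_ofReal (by positivity) (le_trans (MeasureTheory.measure_mono ?_) hvol)
  rintro z ⟨h1, h2⟩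
  exact ⟨⟨h2.1, h2.2.trans hs.2⟩, h1⟩

/-- Exponentially weighted integrals of functions with small integrals between impulses. -/
theorem integral_expDecay_mul_le_of_interval (h : LinearImpulsive a t γ aL aM η η' A B)
    {f : ℝ → ℝ} (hf : BddMeas f) (hf0 : ∀ s, 0 ≤ f s) {ρ : ℝ}
    (hρ : ∀ k, ∀ s ∈ Ioc (t k) (t (k + 1)), ∫ r in t k..s, f r ≤ ρ) {N n : ℤ} (hN : N ≤ n) {s : ℝ}
    (hs : s ∈ Ioc (t n) (t (n + 1))) :
    ∫ r in t N..s, expDecay (fun _ => aL) r s * f r ≤ 2 * ρ / (1 - Real.exp (-(aL * η))) := by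
  have hi : ∀ p x y, IntervalIntegrable (fun r => expDecay (fun _ => aL) r p * f r)
      MeasureTheory.volume x y := fun p x y =>
    hf.intervalIntegrable_mul (continuous_expDecay continuous_const p) x y
  set q := Real.exp (-(aL * η)) with hq
  have hq0 : 0 < q := Real.exp_pos _
  have hq1 : 0 < 1 - q := h.exp_eta_pos
  have hstep : ∀ k, ∀ s ∈ Ioc (t k) (t (k + 1)), N ≤ k →
      ∫ r in t N..s, expDecay (fun _ => aL) r s * f r ≤
        expDecay (fun _ => aL) (t k) s *
          (∫ r in t N..t k, expDecay (fun _ => aL) r (t k) * f r) + ρ := by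
    intro k s hs hk
    rw [← intervalIntegral.integral_add_adjacent_intervals (hi s _ (t k)) (hi s _ _)]
    refine add_le_add (le_of_eq ?_) (le_trans ?_ (hρ k s hs))
    · rw [← intervalIntegral.integral_const_mul]
      simp_rw [← mul_assoc, mul_comm (expDecay (fun _ => aL) (t k) s),
        expDecay_mul (a := fun _ => aL) continuous_const]
    · refine intervalIntegral.integral_mono_on hs.1.le (hi _ _ _) (hf.intervalIntegrable _ _)
        fun r hr => ?_
      exact mul_le_of_le_one_left (hf0 r) (expDecay_const_le_one h.aL_pos.le hr.2)
  have hρ0 : 0 ≤ ρ := (intervalIntegral.integral_nonneg (h.strictMono (lt_add_one (0 : ℤ))).le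
    fun r _ => hf0 r).trans (hρ 0 _ ⟨h.strictMono (lt_add_one (0 : ℤ)), le_rfl⟩)
  -- One interval turns a bound I into q I + ρ, whose fixed point is ρ / (1 - q).
  have hind : ∀ k, N ≤ k →
      ∫ r in t N..t k, expDecay (fun _ => aL) r (t k) * f r ≤ ρ / (1 - q) := by
    intro k hk
    induction k, hk using Int.leInduction with
    | base => rw [intervalIntegral.integral_same]; positivity
    | succ k hk ih =>
      have hk1 : t (k + 1) ∈ Ioc (t k) (t (k + 1)) := ⟨h.strictMono (by lia), le_rfl⟩
      refine (hstep k _ hk1 hk).trans ?_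
      have e1 : expDecay (fun _ => aL) (t k) (t (k + 1)) ≤ q := by
        rw [expDecay_const, hq, Real.exp_le_exp, neg_le_neg_iff]
        exact mul_le_mul_of_nonneg_left (h.eta_le k) h.aL_pos.le
      have e2 : 0 ≤ ρ / (1 - q) := by positivity
      calc _ ≤ q * (ρ / (1 - q)) + ρ := by
            exact add_le_add_left ((mul_le_mul_of_nonneg_left ih (expDecay_pos _ _ _).le).trans
              (mul_le_mul_of_nonneg_right e1 e2)) _
        _ = ρ / (1 - q) := by field_simp; ring
  refine (hstep n s hs hN).trans ?_
  have e1 := expDecay_const_le_one (s := s) h.aL_pos.le hs.1.le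
  have e2 : 0 ≤ ρ / (1 - q) := by positivity
  have e3 : ρ ≤ ρ / (1 - q) := le_div_self hρ0 hq1 (by linarith)
  have e4 : expDecay (fun _ => aL) (t n) s *
      (∫ r in t N..t n, expDecay (fun _ => aL) r (t n) * f r) ≤ ρ / (1 - q) :=
    (mul_le_mul_of_nonneg_left (hind n hN) (expDecay_pos _ _ _).le).trans
      (mul_le_of_le_one_left e2 e1)
  calc _ ≤ ρ / (1 - q) + ρ / (1 - q) := add_le_add e4 e3
    _ = _ := by ring

end LinearImpulsive

/-! ### Common almost periods of the model -/

namespace HematopoiesisModel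

variable {m : ℕ} {P : HematopoiesisModel m} {L : Fin m → ℝ}

/-- `w` is an almost period of all the coefficients of the model, and `q` a corresponding index
shift of the impulses. -/
structure ApproxPeriod (P : HematopoiesisModel m) (ε ρ w : ℝ) (q : ℤ) : Prop where
  gap : ∀ k, |P.t (k + q) - P.t k - w| ≤ ρ
  gamma : ∀ k, |P.gamma (k + q) - P.gamma k| ≤ ε
  delta : ∀ k, |P.delta (k + q) - P.delta k| ≤ ε
  a : ∀ s s', |s' - (s + w)| ≤ ρ → |P.a s' - P.a s| ≤ ε
  b : ∀ i s s', |s' - (s + w)| ≤ ρ → |P.b i s' - P.b i s| ≤ ε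
  c : ∀ i s s', |s' - (s + w)| ≤ ρ → |P.c i s' - P.c i s| ≤ ε
  tau : ∀ i s s', |s' - (s + w)| ≤ ρ → |P.tau i s' - P.tau i s| ≤ ε
  sig : ∀ i s s', |s' - (s + w)| ≤ ρ → |P.sig i s' - P.sig i s| ≤ ε
  H : ∀ i s s', |s' - (s + w)| ≤ ρ → ∀ y ∈ Icc 0 P.M₁, |P.H i s' y - P.H i s y| ≤ ε

/-- `s` and `s'` are almost equal shifts of `f`, also after a perturbation of size `ρ`. -/
def RobustShift {E : Type*} [PseudoMetricSpace E] (f : ℝ → E) (ε ρ s s' : ℝ) : Prop :=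
  ∀ r r', |r' - (r + (s - s'))| ≤ ρ → dist (f r') (f r) ≤ ε

theorem _root_.AlmostPeriodicMap.robustShift {E : Type*} [PseudoMetricSpace E] {f : ℝ → E}
    (h : AlmostPeriodicMap f) {ε : ℝ} (hε : 0 < ε) :
    ∃ ρ₀ : ℝ, 0 < ρ₀ ∧ ∀ ρ < ρ₀, FinitelyColored fun s s' => RobustShift f ε ρ s s' := by
  obtain ⟨d, hd, H⟩ := h.uniform (ε := ε / 2) (by positivity)
  refine ⟨d, hd, fun ρ hρ => ?_⟩
  obtain ⟨κ, hκ, c, hc⟩ := h.finitelyColored (ε := ε / 2) (by positivity)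
  refine ⟨κ, hκ, c, fun s s' hs r r' hr => ?_⟩
  have h1 := hc s s' hs (r - s')
  rw [sub_add_cancel, show r - s' + s = r + (s - s') by ring] at h1
  have h2 := H _ _ (hr.trans_lt hρ)
  linarith [dist_triangle (f r') (f (r + (s - s'))) (f r)]

/-- The order of choices matters: uniform continuity of the coefficients first fixes ρ, and only
then are common almost periods taken with tolerance ρ for the impulse times. The coefficients
therefore tolerate the error ρ of the time change. -/
theorem Standing.relativelyDense_approxPeriod (h : P.Standing L) {ε : ℝ} (hε : 0 < ε) :
    ∃ ρ : ℝ, 0 < ρ ∧ ρ ≤ ε ∧ RelativelyDense {w : ℝ | ∃ q, P.ApproxPeriod ε ρ w q} := by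
  choose fH hfH hfH' using fun i => (h.harvest i).2.2.1.almostPeriodicMap P.M₁
  obtain ⟨ρa, ha, Ha⟩ := h.decay.1.almostPeriodicMap.robustShift hε
  choose ρb hb Hb using fun i => (h.production i).2.2.1.almostPeriodicMap.robustShift hε
  choose ρc hc Hc using fun i => (h.production i).2.2.2.almostPeriodicMap.robustShift hε
  choose ρt ht Ht using fun i => (h.delay i).1.1.almostPeriodicMap.robustShift hε
  choose ρs hs Hs using fun i => (h.delay i).2.1.almostPeriodicMap.robustShift hε
  choose ρH hH HH using fun i => (hfH i).robustShift hε
  have hev : ∀ {r : ℝ}, 0 < r → ∀ᶠ ρ in 𝓝[>] (0 : ℝ), ρ < r := fun hr =>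
    mem_nhdsWithin_of_mem_nhds (gt_mem_nhds hr)
  have hall : ∀ᶠ ρ in 𝓝[>] (0 : ℝ), ρ < ρa ∧ (∀ i, ρ < ρb i) ∧ (∀ i, ρ < ρc i) ∧
      (∀ i, ρ < ρt i) ∧ (∀ i, ρ < ρs i) ∧ (∀ i, ρ < ρH i) ∧ ρ < ε ∧ 0 < ρ := by
    refine (hev ha).and ((eventually_all.2 fun i => hev (hb i)).and
      ((eventually_all.2 fun i => hev (hc i)).and ((eventually_all.2 fun i => hev (ht i)).and
      ((eventually_all.2 fun i => hev (hs i)).and ((eventually_all.2 fun i => hev (hH i)).and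
      ((hev hε).and self_mem_nhdsWithin))))))
  obtain ⟨ρ, pa, pb, pc, pt, ps, pH, pε, p0⟩ := hall.exists
  refine ⟨ρ, p0, pε.le, ?_⟩
  have hl := h.linear
  have hcol := (Ha ρ pa).and ((FinitelyColored.forall_fin fun i => Hb i ρ (pb i)).and
    ((FinitelyColored.forall_fin fun i => Hc i ρ (pc i)).and
    ((FinitelyColored.forall_fin fun i => Ht i ρ (pt i)).and
    ((FinitelyColored.forall_fin fun i => Hs i ρ (ps i)).and
    (FinitelyColored.forall_fin fun i => HH i ρ (pH i))))))
  obtain ⟨l, hl0, Hl⟩ := relativelyDense_common h.time.1 hl.le_eta' hl.tendsto_atTop hl.tendsto_atBot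
    hl.strictMono hcol ((h.factor.1.finitelyColored hε).and (h.shift.finitelyColored hε)) p0
  refine ⟨l, hl0, fun x => ?_⟩
  obtain ⟨w, ⟨q, n, n', s, s', rfl, rfl, ⟨ra, rb, rc, rt, rs, rH⟩, ⟨c1, c2⟩, hg⟩, hw⟩ := Hl x
  have hshift : ∀ {z : ℤ → ℝ}, (∀ k, |z (k + n) - z (k + n')| < ε) →
      ∀ k, |z (k + (n - n')) - z k| ≤ ε := fun hz k => by
    have := hz (k - n')
    rw [sub_add_cancel, show k - n' + n = k + (n - n') by ring] at this
    exact this.le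
  refine ⟨s - s', ⟨n - n', ⟨fun k => (hg k).le, hshift c1, hshift c2, ra, rb, rc, rt, rs,
    fun i r r' hr y hy => ?_⟩⟩, hw⟩
  have := (ContinuousMap.dist_le hε.le).1 (rH i r r' hr) ⟨y, hy⟩
  rwa [hfH', hfH', Real.dist_eq] at this

/-- Small mass of the kernels near the impulse times. -/
theorem Standing.exists_integral_v_nearInd_le (h : P.Standing L) {ν : ℝ} (hν : 0 < ν) :
    ∃ r₀ : ℝ, 0 < r₀ ∧ ∀ r, 0 ≤ r → r < r₀ → ∀ i s,
      ∫ z in (0 : ℝ)..P.T, P.v i z * nearInd P.t r (s - z) ≤ ν := by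
  have hT := h.admissible.T_pos
  have hfin : ∀ i, ∫⁻ z in Ioc 0 P.T, ‖P.v i z‖ₑ ≠ ⊤ := fun i =>
    (h.admissible.v_integrable i).1.2.ne
  -- Absolute continuity of the integral: sets of small measure carry little mass of the kernels.
  choose d hd Hd using fun i => MeasureTheory.exists_pos_setLIntegral_lt_of_measure_lt (hfin i)
    (ε := ENNReal.ofReal ν) (by simpa using hν)
  have hl := h.linear
  have hev : ∀ᶠ r : ℝ in 𝓝[>] 0, (∀ i, ENNReal.ofReal (6 * r / 1) < d i) ∧ r < P.eta ∧ 0 < r := by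
    have hη : ∀ᶠ r : ℝ in 𝓝[>] 0, r < P.eta := mem_nhdsWithin_of_mem_nhds (gt_mem_nhds hl.eta_pos)
    refine (eventually_all.2 fun i => ?_).and (hη.and self_mem_nhdsWithin)
    have : Tendsto (fun r : ℝ => ENNReal.ofReal (6 * r / 1)) (𝓝 0)
        (𝓝 (ENNReal.ofReal (6 * 0 / 1))) :=
      (ENNReal.continuous_ofReal.tendsto _).comp ((Continuous.tendsto (by fun_prop) 0))
    refine mem_nhdsWithin_of_mem_nhds (this.eventually (gt_mem_nhds ?_))
    simpa using hd i
  obtain ⟨r₀, hr₀, hη, hr₀0⟩ := hev.exists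
  refine ⟨r₀, hr₀0, fun r hr0 hr i s => ?_⟩
  set S : Set ℝ := {z ∈ Ioc 0 P.T | s - z ∈ nearImpulses P.t r} with hS
  have hSm : MeasurableSet {z : ℝ | s - z ∈ nearImpulses P.t r} :=
    (measurable_const.sub measurable_id) (measurableSet_nearImpulses P.t r)
  have hj := hl.mem_intervalIndex s
  have hvol : MeasureTheory.volume S ≤ ENNReal.ofReal (6 * r / 1) :=
    -- The map z ↦ s - z is decreasing, which the absolute value in the expansion hypothesis allows;
    -- T ≤ `maxDelay` ≤ η keeps its values in the required range.
    hl.volume_near_le (g := fun z => s - z) one_pos (fun x y hxy => by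
      rw [show s - y - (s - x) = -(y - x) by ring, abs_neg, one_mul]; exact le_abs_self _)
      (j := intervalIndex P.t s) (fun z hz => by
        have := h.T_le.trans h.delay_le
        exact ⟨by linarith [hz.2, hj.1], by linarith [hz.1, hj.2]⟩) hr0 (hr.trans hη)
  have hlt : (MeasureTheory.volume.restrict (Ioc 0 P.T)) {z : ℝ | s - z ∈ nearImpulses P.t r} <
      d i := by
    rw [MeasureTheory.Measure.restrict_apply hSm, inter_comm]
    refine (hvol.trans (ENNReal.ofReal_le_ofReal ?_)).trans_lt (hr₀ i)
    linarith
  have hint := Hd i _ hlt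
  rw [intervalIntegral.integral_of_le hT.le]
  have e : ∀ z, P.v i z * nearInd P.t r (s - z) =
      {z : ℝ | s - z ∈ nearImpulses P.t r}.indicator (P.v i) z := by
    intro z
    by_cases hz : s - z ∈ nearImpulses P.t r
    · rw [nearInd, indicator_of_mem hz, indicator_of_mem (by exact hz), mul_one]
    · rw [nearInd, indicator_of_notMem hz, indicator_of_notMem (by exact hz), mul_zero]
  simp_rw [e]
  rw [MeasureTheory.integral_indicator hSm]
  refine (Real.le_norm_self _).trans ((MeasureTheory.norm_integral_le_lintegral_norm _).trans ?_)
  refine ENNReal.toReal_le_of_le_ofReal hν.le ?_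
  simp only [ofReal_norm]
  exact hint.le

end HematopoiesisModel

/-! ### The time change between shifted impulse sequences -/

/-- The ratio of the lengths of the intervals with indices `k + q` and `k`. -/
noncomputable def gapRatio (t : ℤ → ℝ) (q k : ℤ) : ℝ :=
  (t (k + q + 1) - t (k + q)) / (t (k + 1) - t k)

/-- The piecewise affine time change that maps `t k` to `t (k + q)`. -/
noncomputable def timeChange (t : ℤ → ℝ) (q : ℤ) (s : ℝ) : ℝ :=
  t (intervalIndex t s + q) + (s - t (intervalIndex t s)) * gapRatio t q (intervalIndex t s)

namespace LinearImpulsive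

variable {a : ℝ → ℝ} {t γ : ℤ → ℝ} {aL aM η η' A B : ℝ}

theorem timeChange_eq (h : LinearImpulsive a t γ aL aM η η' A B) (q : ℤ) {s : ℝ} {k : ℤ}
    (hs : s ∈ Ioc (t k) (t (k + 1))) :
    timeChange t q s = t (k + q) + (s - t k) * gapRatio t q k := by
  rw [timeChange, h.intervalIndex_eq hs]

theorem gap_pos (h : LinearImpulsive a t γ aL aM η η' A B) (k : ℤ) : 0 < t (k + 1) - t k :=
  h.eta_pos.trans_le (h.eta_le k)

theorem gapRatio_pos (h : LinearImpulsive a t γ aL aM η η' A B) (q k : ℤ) :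
    0 < gapRatio t q k := div_pos (h.gap_pos _) (h.gap_pos _)

theorem gapRatio_mul (h : LinearImpulsive a t γ aL aM η η' A B) (q k : ℤ) :
    (t (k + 1) - t k) * gapRatio t q k = t (k + q + 1) - t (k + q) :=
  mul_div_cancel₀ _ (h.gap_pos k).ne'

theorem timeChange_mem (h : LinearImpulsive a t γ aL aM η η' A B) (q : ℤ) {s : ℝ} {k : ℤ}
    (hs : s ∈ Ioc (t k) (t (k + 1))) :
    timeChange t q s ∈ Ioc (t (k + q)) (t (k + q + 1)) := by
  rw [h.timeChange_eq q hs]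
  have h1 := mul_pos (sub_pos.2 hs.1) (h.gapRatio_pos q k)
  have h2 := mul_le_mul_of_nonneg_right (sub_le_sub_right hs.2 (t k)) (h.gapRatio_pos q k).le
  rw [h.gapRatio_mul] at h2
  constructor <;> linarith

theorem timeChange_impulse (h : LinearImpulsive a t γ aL aM η η' A B) (q k : ℤ) :
    timeChange t q (t k) = t (k + q) := by
  have hk : t k ∈ Ioc (t (k - 1)) (t (k - 1 + 1)) := by
    rw [sub_add_cancel]; exact ⟨h.strictMono (by lia), le_rfl⟩
  have := h.gapRatio_mul q (k - 1)
  rw [sub_add_cancel, show k - 1 + q + 1 = k + q by ring] at this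
  rw [h.timeChange_eq q hk, this]
  ring

theorem measurable_timeChange (h : LinearImpulsive a t γ aL aM η η' A B) (q : ℤ) :
    Measurable (timeChange t q) := by
  have hi := h.measurable_intervalIndex
  have h1 : ∀ f : ℤ → ℝ, Measurable fun s => f (intervalIndex t s) := fun f =>
    (measurable_of_countable f).comp hi
  exact (h1 fun k => t (k + q)).add ((measurable_id.sub (h1 t)).mul (h1 (gapRatio t q)))

theorem bddMeas_gapRatio (h : LinearImpulsive a t γ aL aM η η' A B) (q : ℤ) :
    BddMeas fun s => gapRatio t q (intervalIndex t s) := by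
  refine ⟨(measurable_of_countable (gapRatio t q)).comp h.measurable_intervalIndex, η' / η,
    fun s => ?_⟩
  rw [abs_of_pos (h.gapRatio_pos _ _)]
  exact div_le_div₀ h.eta'_pos.le (h.le_eta' _) h.eta_pos (h.eta_le _)

variable {q : ℤ} {w ρ : ℝ}

/-- On each interval the time change is affine, so its deviation from s + w is a convex combination
of the deviations at the two endpoints. -/
theorem abs_timeChange_sub_le (h : LinearImpulsive a t γ aL aM η η' A B)
    (hq : ∀ k, |t (k + q) - t k - w| ≤ ρ) (s : ℝ) : |timeChange t q s - (s + w)| ≤ ρ := by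
  have hs := h.mem_intervalIndex s
  set k := intervalIndex t s with hk
  rw [h.timeChange_eq q hs]
  have e1 := abs_le.1 (hq k)
  have e2 := abs_le.1 (hq (k + 1))
  have hg := h.gap_pos k
  have hr := h.gapRatio_mul q k
  have e3 : t (k + 1 + q) = t (k + q + 1) := by congr 1; ring
  rw [e3] at e2
  set x := (s - t k) / (t (k + 1) - t k) with hx
  have hx0 : 0 ≤ x := div_nonneg (sub_nonneg.2 hs.1.le) hg.le
  have hx1 : x ≤ 1 := (div_le_one hg).2 (sub_le_sub_right hs.2 _)
  have hsx : s - t k = x * (t (k + 1) - t k) := (div_mul_cancel₀ _ hg.ne').symm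
  have e : t (k + q) + (s - t k) * gapRatio t q k - (s + w) =
      (1 - x) * (t (k + q) - t k - w) + x * (t (k + q + 1) - t (k + 1) - w) := by
    linear_combination (gapRatio t q k - 1) * hsx + x * hr
  rw [e, abs_le]
  have hx1' : 0 ≤ 1 - x := sub_nonneg.2 hx1
  constructor
  · have := mul_le_mul_of_nonneg_left e1.1 hx1'
    have := mul_le_mul_of_nonneg_left e2.1 hx0
    linarith
  · have := mul_le_mul_of_nonneg_left e1.2 hx1'
    have := mul_le_mul_of_nonneg_left e2.2 hx0
    linarith

theorem abs_gapRatio_sub_one_le (h : LinearImpulsive a t γ aL aM η η' A B)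
    (hq : ∀ k, |t (k + q) - t k - w| ≤ ρ) (k : ℤ) : |gapRatio t q k - 1| ≤ 2 * ρ / η := by
  have e1 := abs_le.1 (hq k)
  have e2 := abs_le.1 (hq (k + 1))
  have hg := h.gap_pos k
  have e3 : t (k + 1 + q) = t (k + q + 1) := by congr 1; ring
  rw [e3] at e2
  have hρ : 0 ≤ ρ := (abs_nonneg _).trans (hq k)
  rw [gapRatio, div_sub_one hg.ne', abs_div, abs_of_pos hg]
  refine div_le_div₀ (by positivity) ?_ h.eta_pos (h.eta_le k)
  rw [abs_le]; constructor <;> linarith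

/-- Points away from the impulse times stay in the corresponding interval under an almost
period. -/
theorem abs_shift_sub_le (h : LinearImpulsive a t γ aL aM η η' A B)
    (hq : ∀ k, |t (k + q) - t k - w| ≤ ρ) {x : ℝ → ℝ} {K D ε : ℝ} (hρ : ρ ≤ ε)
    (hx : ∀ k, ∀ r ∈ Ioc (t k) (t (k + 1)), ∀ s ∈ Ioc (t k) (t (k + 1)), |x s - x r| ≤ K * |s - r|)
    (hK : 0 ≤ K) (hD : ∀ s, |x (timeChange t q s) - x s| ≤ D) {p p' : ℝ}
    (hp : p ∉ nearImpulses t (4 * ε)) (hp' : |p' - (p + w)| ≤ 3 * ε) :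
    |x p' - x p| ≤ D + 4 * K * ε := by
  have hk := h.mem_intervalIndex p
  set k := intervalIndex t p
  have hnear : ∀ j, 4 * ε < |p - t j| := fun j => by
    by_contra! hj; exact hp ⟨j, hj⟩
  have n1 := hnear k
  have n2 := hnear (k + 1)
  rw [abs_of_pos (sub_pos.2 hk.1)] at n1
  rw [abs_sub_comm, abs_of_nonneg (sub_nonneg.2 hk.2)] at n2
  have hθ := h.timeChange_mem q hk
  have hθ' := abs_le.1 (h.abs_timeChange_sub_le hq p)
  have e1 := abs_le.1 (hq k)
  have e2 := abs_le.1 (hq (k + 1))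
  have e3 : t (k + 1 + q) = t (k + q + 1) := by congr 1; ring
  rw [e3] at e2
  have e4 := abs_le.1 hp'
  -- The margin 4ε pays for the error 3ε of p' and the error ρ ≤ ε of the shifted impulse times.
  have hmem : p' ∈ Ioc (t (k + q)) (t (k + q + 1)) := ⟨by linarith, by linarith⟩
  have h1 := hx _ _ hθ _ hmem
  have h2 : |p' - timeChange t q p| ≤ 4 * ε := by rw [abs_le]; constructor <;> linarith
  calc |x p' - x p| ≤ |x p' - x (timeChange t q p)| + |x (timeChange t q p) - x p| :=
        abs_sub_le _ _ _
    _ ≤ K * (4 * ε) + D := add_le_add (h1.trans (mul_le_mul_of_nonneg_left h2 hK)) (hD p)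
    _ = _ := by ring

end LinearImpulsive

/-! ### The forcing under an almost period -/

namespace HematopoiesisModel.Standing

variable {m : ℕ} {P : HematopoiesisModel m} {L : Fin m → ℝ}

/-- The variation of the forcing under an almost period. -/
theorem abs_forcing_shift_le (h : P.Standing L) {x : ℝ → ℝ} (hx : Measurable x)
    (hxM : ∀ s, x s ∈ Icc P.M₂ P.M₁) {ε ρ w : ℝ} {q : ℤ} (hw : P.ApproxPeriod ε ρ w q)
    (hρ0 : 0 ≤ ρ) (hρ : ρ ≤ ε) {E ν : ℝ} (hE : 0 ≤ E)
    (hcmp : ∀ p p', p ∉ nearImpulses P.t (4 * ε) → |p' - (p + w)| ≤ 3 * ε → |x p' - x p| ≤ E)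
    (hν : ∀ i s, ∫ z in (0 : ℝ)..P.T, P.v i z * nearInd P.t (4 * ε) (s - z) ≤ ν)
    {s s' : ℝ} (hs : |s' - (s + w)| ≤ ρ) :
    |P.forcing x s' - P.forcing x s| ≤ P.forcingLip L P.M₂ P.M₁ * E +
      ∑ i, (3 * ε + P.cM i * ν) + ∑ i, (P.bM i * nearInd P.t (4 * ε) (s - P.tau i s) +
        L i * P.M₁ * nearInd P.t (4 * ε) (s - P.sig i s)) := by
  have h0 : ∀ s, 0 ≤ x s := fun s => h.M₂_pos.le.trans (hxM s).1
  have hM := h.M₂_pos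
  have hε : 0 ≤ ε := hρ0.trans hρ
  have hnear : ∀ p, p ∈ nearImpulses P.t (4 * ε) → nearInd P.t (4 * ε) p = 1 := fun p hp =>
    indicator_of_mem hp _
  have hnear' : ∀ p, p ∉ nearImpulses P.t (4 * ε) → nearInd P.t (4 * ε) p = 0 := fun p hp =>
    indicator_of_notMem hp _
  -- Near an impulse the shifted argument may fall on the other side of the jump, so only the
  -- trivial bound 1 is available; the indicator records this exceptional set for later integration.
  have hhill : ∀ {α}, 0 < α → ∀ p p', |p' - (p + w)| ≤ 3 * ε →
      |hill α (x p') - hill α (x p)| ≤ hillLip α P.M₂ P.M₁ * E + nearInd P.t (4 * ε) p := by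
    intro α hα p p' hp
    by_cases hn : p ∈ nearImpulses P.t (4 * ε)
    · rw [hnear p hn]
      have h1 := hill_nonneg (α := α) (h0 p)
      have h2 := hill_nonneg (α := α) (h0 p')
      have h3 := hill_le_one (α := α) (h0 p)
      have h4 := hill_le_one (α := α) (h0 p')
      have h5 := mul_nonneg (hillLip_nonneg hα hM (d := P.M₁)) hE
      rw [abs_le]; constructor <;> linarith
    · rw [hnear' p hn, add_zero]
      exact (abs_hill_sub_le hα hM (hxM _) (hxM _)).trans
        (mul_le_mul_of_nonneg_left (hcmp p p' hn hp) (hillLip_nonneg hα hM))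
  rw [h.forcing_eq, h.forcing_eq, ← Finset.sum_sub_distrib, forcingLip, Finset.sum_mul,
    ← Finset.sum_add_distrib, ← Finset.sum_add_distrib]
  refine (Finset.abs_sum_le_sum_abs _ _).trans (Finset.sum_le_sum fun i _ => ?_)
  have hα := h.admissible.alpha_pos i
  have hβ := h.admissible.beta_pos i
  have hsa := abs_le.1 hs
  have e1 : |P.b i s' * hill (P.alpha i) (x (s' - P.tau i s')) -
      P.b i s * hill (P.alpha i) (x (s - P.tau i s))| ≤
      ε + P.bM i * (hillLip (P.alpha i) P.M₂ P.M₁ * E +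
        nearInd P.t (4 * ε) (s - P.tau i s)) := by
    have ht := abs_le.1 (hw.tau i s s' hs)
    have h1 := hhill hα (s - P.tau i s) (s' - P.tau i s') (by
      rw [abs_le]; constructor <;> linarith)
    rw [show P.b i s' * hill (P.alpha i) (x (s' - P.tau i s')) -
      P.b i s * hill (P.alpha i) (x (s - P.tau i s)) =
      (P.b i s' - P.b i s) * hill (P.alpha i) (x (s' - P.tau i s')) + P.b i s *
      (hill (P.alpha i) (x (s' - P.tau i s')) - hill (P.alpha i) (x (s - P.tau i s))) by ring]
    refine (abs_add_le _ _).trans (add_le_add ?_ ?_)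
    · rw [abs_mul, abs_of_nonneg (hill_nonneg (h0 _))]
      exact (mul_le_of_le_one_right (abs_nonneg _) (hill_le_one (h0 _))).trans (hw.b i s s' hs)
    · rw [abs_mul, abs_of_nonneg ((h.production i).1 s)]
      exact mul_le_mul (h.le_bM i s) h1 (abs_nonneg _) (h.bM_nonneg i)
  have e2 : |P.c i s' * (∫ r in (0 : ℝ)..P.T, P.v i r * hill (P.beta i) (x (s' - r))) -
      P.c i s * (∫ r in (0 : ℝ)..P.T, P.v i r * hill (P.beta i) (x (s - r)))| ≤
      ε + P.cM i * (hillLip (P.beta i) P.M₂ P.M₁ * E + ν) := by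
    have i1 := h.bddMeas_hill_shift (P.beta i) s' hx h0
    have i2 := h.bddMeas_hill_shift (P.beta i) s hx h0
    have i3 : BddMeas fun r => nearInd P.t (4 * ε) (s - r) :=
      (bddMeas_nearInd _ _).comp (measurable_const.sub measurable_id)
    have h1 : |(∫ r in (0 : ℝ)..P.T, P.v i r * hill (P.beta i) (x (s' - r))) -
        ∫ r in (0 : ℝ)..P.T, P.v i r * hill (P.beta i) (x (s - r))| ≤
        hillLip (P.beta i) P.M₂ P.M₁ * E + ν := by
      rw [← intervalIntegral.integral_sub (h.intervalIntegrable_v_mul i i1)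
        (h.intervalIntegrable_v_mul i i2)]
      simp only [← mul_sub]
      calc _ ≤ ∫ r in (0 : ℝ)..P.T, |P.v i r * (hill (P.beta i) (x (s' - r)) -
            hill (P.beta i) (x (s - r)))| :=
            intervalIntegral.abs_integral_le_integral_abs h.admissible.T_pos.le
        _ ≤ ∫ r in (0 : ℝ)..P.T, P.v i r * (hillLip (P.beta i) P.M₂ P.M₁ * E +
            nearInd P.t (4 * ε) (s - r)) := by
            refine intervalIntegral.integral_mono_on h.admissible.T_pos.le
              (h.intervalIntegrable_v_mul i (i1.sub i2)).abs
              (h.intervalIntegrable_v_mul i ((bddMeas_const _).add i3)) fun r hr => ?_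
            have hv := h.admissible.v_nonneg i r hr
            rw [abs_mul, abs_of_nonneg hv]
            exact mul_le_mul_of_nonneg_left (hhill hβ _ _ (by
              rw [abs_le]; constructor <;> linarith)) hv
        _ = (∫ r in (0 : ℝ)..P.T, P.v i r * (hillLip (P.beta i) P.M₂ P.M₁ * E)) +
            ∫ r in (0 : ℝ)..P.T, P.v i r * nearInd P.t (4 * ε) (s - r) := by
            rw [← intervalIntegral.integral_add (h.intervalIntegrable_v_mul i (bddMeas_const _))
              (h.intervalIntegrable_v_mul i i3)]
            simp only [mul_add]
        _ ≤ _ := by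
            refine add_le_add (le_of_eq ?_) (hν i s)
            rw [intervalIntegral.integral_mul_const, h.admissible.v_integral i, one_mul]
    have h2 : |∫ r in (0 : ℝ)..P.T, P.v i r * hill (P.beta i) (x (s' - r))| ≤ 1 :=
      h.abs_integral_v_mul_le i i1 fun r _ => by
        rw [abs_of_nonneg (hill_nonneg (h0 _))]; exact hill_le_one (h0 _)
    have e : ∀ c' c I' I : ℝ, c' * I' - c * I = (c' - c) * I' + c * (I' - I) :=
      fun _ _ _ _ => by ring
    rw [e]
    refine (abs_add_le _ _).trans (add_le_add ?_ ?_)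
    · rw [abs_mul]
      exact (mul_le_of_le_one_right (abs_nonneg _) h2).trans (hw.c i s s' hs)
    · rw [abs_mul, abs_of_nonneg ((h.production i).2.1 s)]
      exact mul_le_mul (h.le_cM i s) h1 (abs_nonneg _) (h.cM_nonneg i)
  have e3 : |P.H i s' (x (s' - P.sig i s')) - P.H i s (x (s - P.sig i s))| ≤
      ε + L i * (E + P.M₁ * nearInd P.t (4 * ε) (s - P.sig i s)) := by
    have ht := abs_le.1 (hw.sig i s s' hs)
    have h1 : |x (s' - P.sig i s') - x (s - P.sig i s)| ≤
        E + P.M₁ * nearInd P.t (4 * ε) (s - P.sig i s) := by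
      by_cases hn : s - P.sig i s ∈ nearImpulses P.t (4 * ε)
      · rw [hnear _ hn, mul_one, abs_le]
        have h1 := hxM (s - P.sig i s)
        have h2 := hxM (s' - P.sig i s')
        constructor <;> linarith [h1.1, h1.2, h2.1, h2.2]
      · rw [hnear' _ hn, mul_zero, add_zero]
        exact hcmp _ _ hn (by rw [abs_le]; constructor <;> linarith)
    refine (abs_sub_le _ (P.H i s (x (s' - P.sig i s'))) _).trans (add_le_add
      (hw.H i s s' hs _ ⟨h0 _, (hxM _).2⟩) (((h.harvest i).2.2.2.2 s _ _ (h0 _) (h0 _)).trans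
        (mul_le_mul_of_nonneg_left h1 (h.harvest i).2.2.2.1.le)))
  rw [abs_le] at e1 e2 e3 ⊢
  constructor <;> linarith

end HematopoiesisModel.Standing

/-! ### Almost periodicity of the solution -/

namespace HematopoiesisModel.Standing

variable {m : ℕ} {P : HematopoiesisModel m} {L : Fin m → ℝ}

/-- The forcing of the equation satisfied by a solution after the time change. -/
noncomputable def _root_.HematopoiesisModel.shiftedForcing (P : HematopoiesisModel m) (x : ℝ → ℝ)
    (q : ℤ) (s : ℝ) : ℝ :=
  P.a s * x (timeChange P.t q s) + gapRatio P.t q (intervalIndex P.t s) *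
    (-(P.a (timeChange P.t q s) * x (timeChange P.t q s)) + P.forcing x (timeChange P.t q s))

variable {x : ℝ → ℝ}

theorem bddMeas_shiftedForcing (h : P.Standing L) (hx : Measurable x)
    (hxM : ∀ s, x s ∈ Icc P.M₂ P.M₁) (q : ℤ) : BddMeas (P.shiftedForcing x q) := by
  have h0 : ∀ s, 0 ≤ x s := fun s => h.M₂_pos.le.trans (hxM s).1
  have hθ := h.linear.measurable_timeChange q
  have hv : BddMeas x := ⟨hx, P.M₁, fun s => by rw [abs_of_nonneg (h0 _)]; exact (hxM _).2⟩
  have ha := h.decay.1.bddMeas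
  have hf := h.bddMeas_forcing hx h0
  exact (ha.mul (hv.comp hθ)).add ((h.linear.bddMeas_gapRatio q).mul
    (((ha.comp hθ).mul (hv.comp hθ)).neg.add (hf.comp hθ)))

/-- The chain rule multiplies the right-hand side by the slope of the affine time change. Adding and
subtracting a(s) x(θ(s)) restores the original coefficient a, with all discrepancies moved into the
forcing; in the same way the discrepancy of the impulse factors is moved into the jump. -/
theorem mildOn_timeChange (h : P.Standing L) (hx : Measurable x)
    (hxM : ∀ s, x s ∈ Icc P.M₂ P.M₁) (hsol : P.IsSolution x) (q k : ℤ) :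
    MildOn P.a P.t P.gamma (P.shiftedForcing x q)
      (fun k => P.delta (k + q) + (P.gamma (k + q) - P.gamma k) * x (timeChange P.t q (P.t k)))
      (fun s => x (timeChange P.t q s)) k := by
  have hl := h.linear
  have hr0 := hl.gapRatio_pos q k
  let θ : ℝ → ℝ := fun s => P.t (k + q) + (s - P.t k) * gapRatio P.t q k
  have hθ : ∀ s ∈ Ioc (P.t k) (P.t (k + 1)), timeChange P.t q s = θ s := fun s hs =>
    hl.timeChange_eq q hs
  have hθd : ∀ s, HasDerivAt θ (gapRatio P.t q k) s := fun s => by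
    refine HasDerivAt.const_add (P.t (k + q)) ?_
    simpa using ((hasDerivAt_id s).sub_const (P.t k)).mul_const (gapRatio P.t q k)
  have hθc : Continuous θ := continuous_iff_continuousAt.2 fun s => (hθd s).continuousAt
  have hθinj : Function.Injective θ := fun r s hrs => by
    have : (r - P.t k) * gapRatio P.t q k = (s - P.t k) * gapRatio P.t q k := by
      simpa [θ] using hrs
    have := mul_right_cancel₀ hr0.ne' this
    linarith
  refine hl.mildOn_of_hasDerivAt (h.bddMeas_shiftedForcing hx hxM q) ?_ ?_
    (h.countable_not_regularTime.preimage_of_injOn (f := θ) hθinj.injOn) fun s hs hZ => ?_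
  · have h1 := hsol.plc.continuousOn hl.strictMono (k + q)
    rw [univ_inter] at h1
    refine (h1.comp hθc.continuousOn fun s hs => ?_).congr fun s hs => by
      simp only [hθ s hs, Function.comp]
    rw [← hθ s hs]
    exact hl.timeChange_mem q hs
  · obtain ⟨r, hr, he⟩ := hsol.impulse (k + q)
    have e : (1 + P.gamma k) * x (timeChange P.t q (P.t k)) + (P.delta (k + q) +
        (P.gamma (k + q) - P.gamma k) * x (timeChange P.t q (P.t k))) = r := by
      rw [hl.timeChange_impulse]; linarith
    simp only [e]
    have h1 : Tendsto θ (𝓝[>] (P.t k)) (𝓝[>] (P.t (k + q))) := by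
      refine tendsto_nhdsWithin_iff.2 ⟨?_, ?_⟩
      · have := (hθc.tendsto (P.t k)).mono_left (nhdsWithin_le_nhds (s := Ioi (P.t k)))
        simpa [θ] using this
      · filter_upwards [self_mem_nhdsWithin] with s hs
        have := mul_pos (sub_pos.2 (show P.t k < s from hs)) hr0
        simp only [θ, mem_Ioi]; linarith
    refine (hr.comp h1).congr' ?_
    filter_upwards [Ioc_mem_nhdsGT (hl.strictMono (lt_add_one k))] with s hs
    rw [hθ s hs]; rfl
  · have hs' : s ∈ Ioc (P.t k) (P.t (k + 1)) := ⟨hs.1, hs.2.le⟩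
    have h1 := hsol.hasDerivAt (θ s) (not_not.1 hZ)
    have h2 := (h1.comp s (hθd s)).congr_of_eventuallyEq
      (f₁ := fun s => x (timeChange P.t q s)) (by
        filter_upwards [Ioo_mem_nhds hs.1 hs.2] with r hr
        rw [hθ r ⟨hr.1, hr.2.le⟩]; rfl)
    refine h2.congr_deriv ?_
    rw [shiftedForcing, hl.intervalIndex_eq hs', hθ s hs', rhs_eq]
    ring

/-- A solution and its image under an almost period are close. -/
theorem exists_abs_timeChange_sub_le (h : P.Standing L) (hx : Measurable x)
    (hxM : ∀ s, x s ∈ Icc P.M₂ P.M₁) (hsol : P.IsSolution x) {K : ℝ} (hK : 0 ≤ K)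
    (hLip : ∀ k, ∀ r ∈ Ioc (P.t k) (P.t (k + 1)), ∀ s ∈ Ioc (P.t k) (P.t (k + 1)),
      |x s - x r| ≤ K * |s - r|) :
    ∃ C : ℝ, 0 < C ∧ ∀ ε ρ w q ν, P.ApproxPeriod ε ρ w q → 0 ≤ ρ → ρ ≤ ε → 4 * ε < P.eta → 0 ≤ ν →
      (∀ i s, ∫ z in (0 : ℝ)..P.T, P.v i z * nearInd P.t (4 * ε) (s - z) ≤ ν) →
      ∀ s, |x (timeChange P.t q s) - x s| ≤ C * (ε + ν) := by
  have hl := h.linear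
  have h0 : ∀ s, 0 ≤ x s := fun s => h.M₂_pos.le.trans (hxM s).1
  have hf := h.bddMeas_forcing hx h0
  obtain ⟨R, hR⟩ := hf.2
  have hR0 : 0 ≤ R := (abs_nonneg _).trans (hR 0)
  choose cτ hcτ Hτ using fun i => (h.delay i).1.slope
  choose cσ hcσ Hσ using fun i => (h.delay i).2.slope
  have hA := hl.A_pos
  have haL := hl.aL_pos
  have haM := hl.aM_pos
  have hη := hl.eta_pos
  have hM1 := h.M₁_nonneg
  have hq := hl.exp_eta_pos
  set Q := 1 - Real.exp (-(P.aL * P.eta)) with hQ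
  set Λ := P.forcingLip L P.M₂ P.M₁ with hΛ
  have hΛ0 : 0 ≤ Λ := h.forcingLip_nonneg h.M₂_pos
  have hκ : P.A / P.aL * Λ < 1 := h.contraction_lt
  set Cs := ∑ i, (P.bM i / cτ i + L i * P.M₁ / cσ i) with hCs
  -- C₁ and C₂ collect the coefficients of ε and ν in the final estimate. The factor 48 is 2 · 6 ·
  -- 4: geometric summation over intervals, time near three impulses, and radius 4ε.
  set C₁ := P.A * (1 + P.M₁) / Q + P.A * ((P.M₁ + 2 / P.eta * (P.aM * P.M₁ + R) + Λ * (4 * K) +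
    ∑ _i : Fin m, 3) / P.aL + 48 * Cs / Q) with hC₁
  set C₂ := P.A / P.aL * ∑ i, P.cM i with hC₂
  have hL0 : ∀ i, 0 ≤ L i := fun i => (h.harvest i).2.2.2.1.le
  have hCs0 : 0 ≤ Cs := Finset.sum_nonneg fun i _ => by
    have := h.bM_nonneg i; have := hL0 i; have := hcτ i; have := hcσ i
    positivity
  have hC₁0 : 0 ≤ C₁ := by positivity
  have hC₂0 : 0 ≤ C₂ := by
    have := Finset.sum_nonneg fun i (_ : i ∈ Finset.univ) => h.cM_nonneg i
    positivity
  refine ⟨(C₁ + C₂ + 1) / (1 - P.A / P.aL * Λ), div_pos (by positivity) (sub_pos.2 hκ),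
    fun ε ρ w q ν hw hρ0 hρ hε hν0 hν s₀ => ?_⟩
  have hε0 : 0 ≤ ε := hρ0.trans hρ
  set D := ⨆ s, |x (timeChange P.t q s) - x s| with hD
  have hb : ∀ s, |x (timeChange P.t q s) - x s| ≤ P.M₁ := fun s => by
    rw [abs_le]
    constructor <;> linarith [(hxM s).2, h0 s, h0 (timeChange P.t q s),
      (hxM (timeChange P.t q s)).2]
  have hDle : ∀ s, |x (timeChange P.t q s) - x s| ≤ D :=
    fun s => le_ciSup (f := fun s => |x (timeChange P.t q s) - x s|)
      ⟨P.M₁, by rintro _ ⟨s, rfl⟩; exact hb s⟩ s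
  have hD0 : 0 ≤ D := (abs_nonneg _).trans (hDle 0)
  set E := D + 4 * K * ε with hE
  have hE0 : 0 ≤ E := by positivity
  set G := ε * P.M₁ + 2 * ε / P.eta * (P.aM * P.M₁ + R) + (Λ * E + ∑ i, (3 * ε + P.cM i * ν))
    with hG
  set N : ℝ → ℝ := fun s => ∑ i, (P.bM i * nearInd P.t (4 * ε) (s - P.tau i s) +
        L i * P.M₁ * nearInd P.t (4 * ε) (s - P.sig i s)) with hN
  have hτm : ∀ i, Measurable fun s => s - P.tau i s := fun i =>
    measurable_id.sub (h.delay i).1.1.1.measurable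
  have hσm : ∀ i, Measurable fun s => s - P.sig i s := fun i =>
    measurable_id.sub (h.delay i).2.1.1.measurable
  have hNτ : ∀ i, BddMeas fun s => nearInd P.t (4 * ε) (s - P.tau i s) := fun i =>
    (bddMeas_nearInd _ _).comp (hτm i)
  have hNσ : ∀ i, BddMeas fun s => nearInd P.t (4 * ε) (s - P.sig i s) := fun i =>
    (bddMeas_nearInd _ _).comp (hσm i)
  have hNi : ∀ i, BddMeas fun s => P.bM i * nearInd P.t (4 * ε) (s - P.tau i s) +
      L i * P.M₁ * nearInd P.t (4 * ε) (s - P.sig i s) := fun i =>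
    ((bddMeas_const _).mul (hNτ i)).add ((bddMeas_const _).mul (hNσ i))
  have hNm : BddMeas N := BddMeas.sum hNi
  have hN0 : ∀ s, 0 ≤ N s := fun s => Finset.sum_nonneg fun i _ =>
    add_nonneg (mul_nonneg (h.bM_nonneg i) (nearInd_nonneg _ _ _))
      (mul_nonneg (mul_nonneg (hL0 i) hM1) (nearInd_nonneg _ _ _))
  -- the forcing of the difference
  have hforce : ∀ s, |P.shiftedForcing x q s - P.forcing x s| ≤ G + N s := by
    intro s
    have hs := hl.abs_timeChange_sub_le hw.gap s
    have h1 := h.abs_forcing_shift_le hx hxM hw hρ0 hρ hE0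
      (fun p p' hp hp' => hl.abs_shift_sub_le hw.gap hρ hLip hK hDle hp hp') hν hs
    have h2 := hw.a s _ hs
    have h3 := hl.abs_gapRatio_sub_one_le hw.gap (intervalIndex P.t s)
    set s' := timeChange P.t q s
    set lam := gapRatio P.t q (intervalIndex P.t s)
    have e : P.shiftedForcing x q s - P.forcing x s = -(P.a s' - P.a s) * x s' +
        (lam - 1) * (-(P.a s' * x s') + P.forcing x s') + (P.forcing x s' - P.forcing x s) := by
      rw [shiftedForcing]; ring
    have e1 : |-(P.a s' - P.a s) * x s'| ≤ ε * P.M₁ := by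
      rw [abs_mul, abs_neg, abs_of_nonneg (h0 s')]
      exact mul_le_mul h2 (hxM s').2 (h0 _) hε0
    have e2 : |(lam - 1) * (-(P.a s' * x s') + P.forcing x s')| ≤
        2 * ε / P.eta * (P.aM * P.M₁ + R) := by
      rw [abs_mul]
      refine mul_le_mul (h3.trans (by gcongr)) ((abs_add_le _ _).trans (add_le_add ?_ (hR _)))
        (abs_nonneg _) (by positivity)
      rw [abs_neg, abs_mul, abs_of_nonneg (h0 s'),
        abs_of_nonneg (haL.le.trans (h.aL_le s'))]
      exact mul_le_mul (h.le_aM s') (hxM s').2 (h0 _) haM.le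
    rw [e]
    refine (abs_add_le _ _).trans ?_
    have := (abs_add_le (-(P.a s' - P.a s) * x s')
      ((lam - 1) * (-(P.a s' * x s') + P.forcing x s')))
    simp only [hG, hN]
    linarith
  -- the jumps of the difference
  have hjump : ∀ k, |(P.delta (k + q) + (P.gamma (k + q) - P.gamma k) *
      x (timeChange P.t q (P.t k))) - P.delta k| ≤ ε * (1 + P.M₁) := fun k => by
    rw [show (P.delta (k + q) + (P.gamma (k + q) - P.gamma k) * x (timeChange P.t q (P.t k))) -
      P.delta k = (P.delta (k + q) - P.delta k) + (P.gamma (k + q) - P.gamma k) *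
      x (timeChange P.t q (P.t k)) by ring]
    refine (abs_add_le _ _).trans ?_
    rw [abs_mul, abs_of_nonneg (h0 _)]
    have := mul_le_mul (hw.gamma k) (hxM (timeChange P.t q (P.t k))).2 (h0 _) hε0
    linarith [hw.delta k]
  -- the time near impulses
  have hnear : ∀ k, ∀ s ∈ Ioc (P.t k) (P.t (k + 1)), ∫ r in P.t k..s, N r ≤ 24 * ε * Cs := by
    intro k s hs
    have hreg : ∀ (d : ℝ → ℝ) (c : ℝ), (∀ r s, r ≤ s → c * (s - r) ≤ (s - d s) - (r - d r)) →
        ∀ r s, r ≤ s → c * (s - r) ≤ |(s - d s) - (r - d r)| := fun d c H r s hrs =>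
      (H r s hrs).trans (le_abs_self _)
    have h1 : ∀ i, ∫ r in P.t k..s, nearInd P.t (4 * ε) (r - P.tau i r) ≤ 6 * (4 * ε) / cτ i :=
      fun i => hl.integral_nearInd_le (hcτ i) (hreg _ _ (Hτ i)) (hτm i) (fun r hr => by
        have := (h.delays_le i r).1.trans h.delay_le
        have := h.admissible.tau_nonneg i r
        exact ⟨by linarith [hr.1], by linarith [hr.2]⟩) (by positivity) hε hs
    have h2 : ∀ i, ∫ r in P.t k..s, nearInd P.t (4 * ε) (r - P.sig i r) ≤ 6 * (4 * ε) / cσ i :=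
      fun i => hl.integral_nearInd_le (hcσ i) (hreg _ _ (Hσ i)) (hσm i) (fun r hr => by
        have := (h.delays_le i r).2.trans h.delay_le
        have := h.admissible.sig_nonneg i r
        exact ⟨by linarith [hr.1], by linarith [hr.2]⟩) (by positivity) hε hs
    simp only [hN]
    rw [intervalIntegral.integral_finsetSum fun i _ => (hNi i).intervalIntegrable _ _, hCs,
      Finset.mul_sum]
    refine Finset.sum_le_sum fun i _ => ?_
    rw [intervalIntegral.integral_add (((bddMeas_const _).mul (hNτ i)).intervalIntegrable _ _)
      (((bddMeas_const _).mul (hNσ i)).intervalIntegrable _ _),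
      intervalIntegral.integral_const_mul, intervalIntegral.integral_const_mul]
    calc _ ≤ P.bM i * (6 * (4 * ε) / cτ i) + L i * P.M₁ * (6 * (4 * ε) / cσ i) :=
          add_le_add (mul_le_mul_of_nonneg_left (h1 i) (h.bM_nonneg i))
            (mul_le_mul_of_nonneg_left (h2 i) (mul_nonneg (hL0 i) hM1))
      _ = _ := by ring
  have hG0 : 0 ≤ G := by
    have : 0 ≤ ∑ i, (3 * ε + P.cM i * ν) := Finset.sum_nonneg fun i _ =>
      add_nonneg (by positivity) (mul_nonneg (h.cM_nonneg i) hν0)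
    positivity
  have hsf := h.bddMeas_shiftedForcing hx hxM q
  have hmild := fun k => (h.mildOn_timeChange hx hxM hsol q k).sub hl.cont hsf hf
    (h.mildOn_of_isSolution hsol k)
  have hest : ∀ s, |x (timeChange P.t q s) - x s| ≤ P.A * (ε * (1 + P.M₁)) / Q +
      P.A * (G / P.aL + 2 * (24 * ε * Cs) / Q) := by
    intro s
    refine hl.abs_le_of_mildOn_entire (hsf.sub hf) hmild (fun k => hb _) hjump fun n hn => ?_
    have hmem := hl.mem_intervalIndex s
    have hle := (hl.mem_step hn hmem).2.2.2.2
    have hE := continuous_expDecay (a := fun _ => P.aL) continuous_const s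
    calc _ ≤ ∫ r in P.t n..s, (expDecay (fun _ => P.aL) r s * G +
          expDecay (fun _ => P.aL) r s * N r) := by
          refine intervalIntegral.integral_mono_on hle ((hsf.sub hf).abs.intervalIntegrable_mul hE
            _ _) (((hE.mul continuous_const).intervalIntegrable _ _).add
              (hNm.intervalIntegrable_mul hE _ _)) fun r _ => ?_
          rw [← mul_add]
          exact mul_le_mul_of_nonneg_left (hforce r) (expDecay_pos _ _ _).le
      _ = (∫ r in P.t n..s, expDecay (fun _ => P.aL) r s * G) +
          ∫ r in P.t n..s, expDecay (fun _ => P.aL) r s * N r :=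
          intervalIntegral.integral_add ((hE.mul continuous_const).intervalIntegrable _ _)
            (hNm.intervalIntegrable_mul hE _ _)
      _ ≤ _ := by
          refine add_le_add ?_ (hl.integral_expDecay_mul_le_of_interval hNm hN0 hnear hn hmem)
          rw [integral_expDecay_const_mul haL.ne', expDecay_self]
          refine mul_le_of_le_one_right (div_nonneg hG0 haL.le) ?_
          linarith [expDecay_pos (fun _ => P.aL) (P.t n) s]
  -- D enters the right-hand side only through E, with the contraction constant as coefficient, so
  -- it can be absorbed.
  have hDest : D ≤ P.A / P.aL * Λ * D + (C₁ * ε + C₂ * ν) := by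
    refine (ciSup_le hest).trans_eq ?_
    simp only [hG, hE, hC₁, hC₂, Finset.sum_add_distrib, ← Finset.sum_mul,
      Finset.sum_const, nsmul_eq_mul]
    field_simp
    ring
  refine (hDle s₀).trans ?_
  rw [div_mul_eq_mul_div, le_div_iff₀ (sub_pos.2 hκ)]
  have e1 := mul_nonneg hC₁0 hν0
  have e2 := mul_nonneg hC₂0 hε0
  linarith

/-- Solutions with values in `[M₂, M₁]` are almost periodic. -/
theorem plcAlmostPeriodic (h : P.Standing L) (hx : Measurable x)
    (hxM : ∀ s, x s ∈ Icc P.M₂ P.M₁) (hsol : P.IsSolution x) : PLCAlmostPeriodic P.t x := by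
  have hl := h.linear
  have h0 : ∀ s, 0 ≤ x s := fun s => h.M₂_pos.le.trans (hxM s).1
  have hf := h.bddMeas_forcing hx h0
  obtain ⟨R, hR⟩ := hf.2
  have hR0 : 0 ≤ R := (abs_nonneg _).trans (hR 0)
  set K := P.aM * P.M₁ + R with hKdef
  have hK : 0 ≤ K := add_nonneg (mul_nonneg hl.aM_pos.le h.M₁_nonneg) hR0
  have hLip : ∀ k, ∀ r ∈ Ioc (P.t k) (P.t (k + 1)), ∀ s ∈ Ioc (P.t k) (P.t (k + 1)),
      |x s - x r| ≤ K * |s - r| := fun k r hr s hs =>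
    hl.lipschitz_of_mildOn hf hR (fun s => by rw [abs_of_nonneg (h0 s)]; exact (hxM s).2)
      (h.mildOn_of_isSolution hsol k) hr hs
  refine ⟨hsol.plc, h.time.1, fun ε hε => ⟨ε / (K + 1), by positivity, fun k s hs s' hs' hss => ?_⟩,
    fun ε hε => ?_⟩
  · rw [lt_div_iff₀ (by positivity)] at hss
    have := hLip k s' hs' s hs
    have := abs_nonneg (s - s')
    linarith
  · obtain ⟨C, hC, H⟩ := h.exists_abs_timeChange_sub_le hx hxM hsol hK hLip
    -- Budget: δ ≤ ν makes C (δ + ν) at most ε/2, and δ ≤ ε / (16 (K + 1)) makes the Lipschitz error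
    -- 4Kδ at most ε/4 and gives 4δ ≤ ε. The other bounds keep 4δ below r₀ and below the minimal
    -- gap.
    set ν := ε / (4 * C) with hν
    have hν0 : 0 < ν := by positivity
    obtain ⟨r₀, hr₀, Hr⟩ := h.exists_integral_v_nearInd_le hν0
    set δ := min (min (r₀ / 8) (P.eta / 8)) (min ν (ε / (16 * (K + 1)))) with hδ
    have hη := hl.eta_pos
    have hδ0 : 0 < δ := by positivity
    have d1 : δ ≤ r₀ / 8 := (min_le_left _ _).trans (min_le_left _ _)
    have d2 : δ ≤ P.eta / 8 := (min_le_left _ _).trans (min_le_right _ _)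
    have d3 : δ ≤ ν := (min_le_right _ _).trans (min_le_left _ _)
    have d4 : δ ≤ ε / (16 * (K + 1)) := (min_le_right _ _).trans (min_le_right _ _)
    rw [le_div_iff₀ (by positivity)] at d4
    have d5 : C * (δ + ν) ≤ ε / 2 := by
      have : C * ν = ε / 4 := by rw [hν]; field_simp
      have := mul_le_mul_of_nonneg_left d3 hC.le
      linarith
    obtain ⟨ρ, hρ0, hρ, l, hl0, Hl⟩ := h.relativelyDense_approxPeriod hδ0
    refine ⟨l, hl0, fun z => ?_⟩
    obtain ⟨w, ⟨q, hw⟩, hwz⟩ := Hl z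
    refine ⟨w, fun s hs => ?_, hwz⟩
    have hD := H δ ρ w q ν hw hρ0.le hρ (by linarith) hν0.le
      (fun i s => Hr (4 * δ) (by positivity) (by linarith) i s)
    have hKδ : 0 ≤ K * δ := by positivity
    have hnear : s ∉ nearImpulses P.t (4 * δ) := by
      rintro ⟨k, hk⟩
      linarith [hs k]
    have := hl.abs_shift_sub_le hw.gap hρ hLip hK hD hnear (p' := s + w)
      (by rw [sub_self, abs_zero]; positivity)
    linarith

end HematopoiesisModel.Standing

/-! ### Exponential stability -/

theorem exists_expDecay_mul_le {c : ℝ} (hc : 0 < c) (p K : ℝ) {ε : ℝ} (hε : 0 < ε) :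
    ∃ T, p ≤ T ∧ ∀ s, T ≤ s → expDecay (fun _ => c) p s * K ≤ ε := by
  have h1 : Tendsto (fun s => expDecay (fun _ => c) p s * K) atTop (𝓝 (0 * K)) := by
    have e : (fun s => expDecay (fun _ => c) p s) = fun s => Real.exp (-(c * (s - p))) :=
      funext fun s => expDecay_const c p s
    refine Tendsto.mul_const K (f := fun s => expDecay (fun _ => c) p s) ?_
    rw [e]
    refine Real.tendsto_exp_neg_atTop_nhds_zero.comp (Tendsto.const_mul_atTop hc ?_)
    exact tendsto_atTop_add_const_right _ _ tendsto_id
  rw [zero_mul] at h1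
  obtain ⟨T, hT⟩ := eventually_atTop.1 (h1.eventually (gt_mem_nhds hε))
  exact ⟨max T p, le_max_right _ _, fun s hs => (hT s ((le_max_left _ _).trans hs)).le⟩

namespace HematopoiesisModel.Standing

variable {m : ℕ} {P : HematopoiesisModel m} {L : Fin m → ℝ}

/-- Exponential convergence of solutions that stay in `[c, d]`. -/
theorem exists_exp_decay (h : P.Standing L) {x y : ℝ → ℝ} (hx : Measurable x)
    (hx0 : ∀ s, 0 ≤ x s) (hy : Measurable y) (hy0 : ∀ s, 0 ≤ y s) {N : ℤ}
    (hxm : ∀ k, N ≤ k → MildOn P.a P.t P.gamma (P.forcing x) P.delta x k)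
    (hym : ∀ k, N ≤ k → MildOn P.a P.t P.gamma (P.forcing y) P.delta y k) {c d : ℝ} (hc : 0 < c)
    (hxM : ∀ s, P.t N - P.maxDelay ≤ s → x s ∈ Icc c d)
    (hyM : ∀ s, P.t N - P.maxDelay ≤ s → y s ∈ Icc c d) {rate : ℝ} (hr : 0 < rate)
    (hrL : rate < P.aL)
    (hκ : P.A * (P.forcingLip L c d * Real.exp (rate * P.maxDelay)) / (P.aL - rate) < 1) :
    ∃ C, ∀ s, P.t N ≤ s → |x s - y s| ≤ C * Real.exp (-(rate * (s - P.t N))) := by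
  have hl := h.linear
  have hσ := h.maxDelay_pos
  have hA := hl.A_pos
  set p := P.t N with hp
  set Λ := P.forcingLip L c d with hΛ
  have hΛ0 : 0 ≤ Λ := h.forcingLip_nonneg hc
  set κ := P.A * (Λ * Real.exp (rate * P.maxDelay)) / (P.aL - rate) with hκdef
  have hcd : c ≤ d := by
    have := hxM p (by linarith)
    exact this.1.trans this.2
  have hb : ∀ s, p - P.maxDelay ≤ s → |x s - y s| ≤ d := fun s hs => by
    have h1 := hxM s hs
    have h2 := hyM s hs
    rw [abs_le]; constructor <;> linarith [h1.1, h1.2, h2.1, h2.2]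
  refine ⟨P.A * d / (1 - κ), fun s₁ hs₁ => ?_⟩
  -- The supremum V of the weighted difference is taken up to a finite time s₁, so it exists. The
  -- resulting inequality V ≤ A d + κ V gives a bound independent of s₁; looking back over the delay
  -- costs the factor exp (rate · maxDelay) in κ.
  let F : ℝ → ℝ := fun s => Real.exp (rate * (s - p)) * |x s - y s|
  have hbdd : BddAbove (F '' Icc (p - P.maxDelay) s₁) := by
    refine ⟨Real.exp (rate * (s₁ - p)) * d, ?_⟩
    rintro _ ⟨s, hs, rfl⟩
    have := hs.2
    exact mul_le_mul (Real.exp_le_exp.2 (by gcongr)) (hb s hs.1) (abs_nonneg _) (Real.exp_pos _).le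
  set V := sSup (F '' Icc (p - P.maxDelay) s₁) with hV
  have hFV : ∀ s ∈ Icc (p - P.maxDelay) s₁, F s ≤ V := fun s hs => le_csSup hbdd ⟨s, hs, rfl⟩
  have huV : ∀ s ∈ Icc (p - P.maxDelay) s₁, |x s - y s| ≤ V * Real.exp (-(rate * (s - p))) :=
    fun s hs => by
      have := hFV s hs
      rw [Real.exp_neg, ← div_eq_mul_inv, le_div_iff₀ (Real.exp_pos _), mul_comm]
      exact this
  have hV0 : 0 ≤ V := le_trans (mul_nonneg (Real.exp_pos _).le (abs_nonneg _))
    (hFV s₁ ⟨by linarith, le_rfl⟩)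
  have hfx := h.bddMeas_forcing hx hx0
  have hfy := h.bddMeas_forcing hy hy0
  have hforce : ∀ r ∈ Icc p s₁, |P.forcing x r - P.forcing y r| ≤
      Λ * Real.exp (rate * P.maxDelay) * V * Real.exp (-(rate * (r - p))) := by
    intro r hr'
    have := h.abs_forcing_sub_le hx hx0 hy hy0 (s := r) (c := c) (d := d)
      (D := V * Real.exp (rate * P.maxDelay) * Real.exp (-(rate * (r - p)))) hc
      (fun z hz => hxM z (by linarith [hz.1, hr'.1])) (fun z hz => hyM z (by linarith [hz.1, hr'.1]))
      (fun z hz => by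
        refine (huV z ⟨by linarith [hz.1, hr'.1], hz.2.trans hr'.2⟩).trans ?_
        rw [mul_assoc, ← Real.exp_add]
        refine mul_le_mul_of_nonneg_left (Real.exp_le_exp.2 ?_) hV0
        have := mul_le_mul_of_nonneg_left hz.1 hr.le
        linarith)
    exact this.trans_eq (by ring)
  have key : ∀ s ∈ Icc (p - P.maxDelay) s₁, F s ≤ P.A * d + κ * V := by
    intro s hs
    have hκV : 0 ≤ κ * V := by
      have := sub_pos.2 hrL
      positivity
    have hd0 : 0 ≤ d := hc.le.trans hcd
    rcases le_or_gt s p with hsp | hsp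
    · have h1 : F s ≤ 1 * d := mul_le_mul (Real.exp_le_one_iff.2
        (mul_nonpos_of_nonneg_of_nonpos hr.le (by linarith))) (hb s hs.1) (abs_nonneg _) zero_le_one
      have h2 := mul_le_mul_of_nonneg_right hl.one_le_A hd0
      linarith
    · have hmem := hl.mem_intervalIndex s
      have hN : N ≤ intervalIndex P.t s := by
        have := hl.strictMono.lt_iff_lt.1 (hsp.trans_le hmem.2)
        lia
      have h1 := hl.abs_le_of_mildOn (u := fun s => x s - y s) (hfx.sub hfy) hN hmem
        (fun k hk _ => (hxm k hk).sub hl.cont hfx hfy (hym k hk)) (D := 0) (fun k => by simp)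
      have h2 : ∫ r in p..s, expDecay (fun _ => P.aL) r s * |P.forcing x r - P.forcing y r| ≤
          Λ * Real.exp (rate * P.maxDelay) * V * Real.exp (-(rate * (s - p))) / (P.aL - rate) := by
        -- Moving the weight from r to s lowers the decay rate of the kernel to a_L - rate.
        have e : ∀ r, expDecay (fun _ => P.aL) r s * (Λ * Real.exp (rate * P.maxDelay) * V *
            Real.exp (-(rate * (r - p)))) = expDecay (fun _ => P.aL - rate) r s *
            (Λ * Real.exp (rate * P.maxDelay) * V * Real.exp (-(rate * (s - p)))) := fun r => by
          have : Real.exp (-(P.aL * (s - r))) * Real.exp (-(rate * (r - p))) =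
              Real.exp (-((P.aL - rate) * (s - r))) * Real.exp (-(rate * (s - p))) := by
            rw [← Real.exp_add, ← Real.exp_add]; congr 1; ring
          rw [expDecay_const, expDecay_const]
          linear_combination (Λ * Real.exp (rate * P.maxDelay) * V) * this
        calc _ ≤ ∫ r in p..s, expDecay (fun _ => P.aL) r s * (Λ * Real.exp (rate * P.maxDelay) *
              V * Real.exp (-(rate * (r - p)))) := by
              refine intervalIntegral.integral_mono_on hsp.le
                ((hfx.sub hfy).abs.intervalIntegrable_mul
                  (continuous_expDecay continuous_const s) _ _) ?_ fun r hr' =>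
                mul_le_mul_of_nonneg_left (hforce r ⟨hr'.1, hr'.2.trans hs.2⟩) (expDecay_pos _ _ _).le
              exact Continuous.intervalIntegrable ((continuous_expDecay continuous_const s).mul
                (by fun_prop)) _ _
          _ ≤ _ := by
              simp only [e]
              rw [integral_expDecay_const_mul (sub_pos.2 hrL).ne', expDecay_self]
              have hpos : 0 ≤ Λ * Real.exp (rate * P.maxDelay) * V * Real.exp (-(rate * (s - p))) /
                (P.aL - rate) := by
                have := sub_pos.2 hrL
                positivity
              refine mul_le_of_le_one_right hpos ?_
              linarith [expDecay_pos (fun _ => P.aL - rate) p s]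
      have h3 : expDecay (fun _ => P.aL) p s ≤ Real.exp (-(rate * (s - p))) := by
        rw [expDecay_const, Real.exp_le_exp, neg_le_neg_iff]
        exact mul_le_mul_of_nonneg_right hrL.le (by linarith)
      have h4 : |x s - y s| ≤ Real.exp (-(rate * (s - p))) * (P.A * d + κ * V) := by
        rw [mul_zero, zero_div, add_zero] at h1
        have h5 : expDecay (fun _ => P.aL) p s * (P.A * |x p - y p|) ≤
            Real.exp (-(rate * (s - p))) * (P.A * d) :=
          mul_le_mul h3 (mul_le_mul_of_nonneg_left (hb p (by linarith)) hA.le)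
            (mul_nonneg hA.le (abs_nonneg _)) (Real.exp_pos _).le
        have h6 := mul_le_mul_of_nonneg_left h2 hA.le
        have e : P.A * (Λ * Real.exp (rate * P.maxDelay) * V * Real.exp (-(rate * (s - p))) /
            (P.aL - rate)) = Real.exp (-(rate * (s - p))) * (κ * V) := by
          rw [hκdef]; ring
        rw [e] at h6
        linarith
      calc F s ≤ Real.exp (rate * (s - p)) * (Real.exp (-(rate * (s - p))) *
            (P.A * d + κ * V)) := mul_le_mul_of_nonneg_left h4 (Real.exp_pos _).le
        _ = P.A * d + κ * V := by rw [← mul_assoc, ← Real.exp_add]; simp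
  have hVle : V ≤ P.A * d + κ * V := csSup_le ⟨_, ⟨s₁, ⟨by linarith, le_rfl⟩, rfl⟩⟩ (by
    rintro _ ⟨s, hs, rfl⟩; exact key s hs)
  refine (huV s₁ ⟨by linarith, le_rfl⟩).trans
    (mul_le_mul_of_nonneg_right ?_ (Real.exp_pos _).le)
  rw [le_div_iff₀ (sub_pos.2 hκ)]
  linarith

/-- The forcing sees only the history of length `maxDelay`, so values before the initial interval
are irrelevant. -/
theorem forcing_congr (h : P.Standing L) {φ ψ : ℝ → ℝ} {s : ℝ}
    (hs : ∀ r ∈ Icc (s - P.maxDelay) s, φ r = ψ r) : P.forcing φ s = P.forcing ψ s := by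
  rw [h.forcing_eq, h.forcing_eq]
  refine Finset.sum_congr rfl fun i _ => ?_
  obtain ⟨d1, d2, d3⟩ := h.mem_delay i s
  rw [hs _ d1, hs _ d2]
  congr 2
  congr 1
  refine intervalIntegral.integral_congr fun r hr => ?_
  rw [uIcc_of_le h.admissible.T_pos.le] at hr
  simp only [hs _ (d3 r hr)]

/-- Solutions of initial value problems satisfy the integral equation after the first impulse. -/
theorem mildOn_of_isSolutionFrom (h : P.Standing L) {t₀ : ℝ} {ξ x : ℝ → ℝ}
    (hξ : P.IsInitialFunction t₀ ξ) (hx : P.IsSolutionFrom t₀ ξ x) :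
    ∃ z : ℝ → ℝ, Measurable z ∧ (∀ s, 0 ≤ z s) ∧ (∀ s, t₀ - P.maxDelay ≤ s → z s = x s) ∧
      ∀ k, t₀ ≤ P.t k → MildOn P.a P.t P.gamma (P.forcing z) P.delta z k := by
  have hl := h.linear
  have hσ := h.maxDelay_pos
  -- Nothing is assumed about x before the initial interval; extension by zero makes it measurable
  -- and nonnegative on the whole line.
  let z := (Ici (t₀ - P.maxDelay)).indicator x
  have hzx : ∀ s, t₀ - P.maxDelay ≤ s → z s = x s := fun s hs => indicator_of_mem (by exact hs) _
  have hzm : Measurable z := hl.measurable_of_PLC measurableSet_Ici hx.plc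
  have hz0 : ∀ s, 0 ≤ z s := fun s => by
    refine indicator_nonneg (fun s hs => ?_) s
    rcases le_or_gt t₀ s with hs' | hs'
    · exact hx.nonneg s hs'
    · rw [hx.initial ⟨hs, hs'.le⟩]; exact hξ.nonneg s ⟨hs, hs'⟩
  refine ⟨z, hzm, hz0, hzx, fun k hk => ?_⟩
  refine hl.mildOn_of_hasDerivAt (h.bddMeas_forcing hzm hz0) ?_ ?_
    h.countable_not_regularTime fun s hs hreg => ?_
  · have := hx.plc.continuousOn hl.strictMono k
    have e : Ici (t₀ - P.maxDelay) ∩ Ioc (P.t k) (P.t (k + 1)) = Ioc (P.t k) (P.t (k + 1)) :=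
      inter_eq_right.2 fun s hs => mem_Ici.2 (by linarith [hs.1])
    rw [e] at this
    exact this.congr fun s hs => hzx s (by linarith [hs.1])
  · obtain ⟨r, hr, he⟩ := hx.impulse k hk
    rw [hzx _ (by linarith), show (1 + P.gamma k) * x (P.t k) + P.delta k = r by linarith]
    refine hr.congr' ?_
    filter_upwards [self_mem_nhdsWithin] with s hs
    exact (hzx s (by linarith [show P.t k < s from hs])).symm
  · have h1 := hx.hasDerivAt s (hk.trans_lt hs.1) (not_not.1 hreg)
    rw [rhs_eq, ← hzx s (by linarith [hs.1]),
      ← h.forcing_congr (φ := z) fun r hr => hzx r (by linarith [hr.1, hs.1])] at h1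
    refine h1.congr_of_eventuallyEq ?_
    filter_upwards [Ioi_mem_nhds (show t₀ - P.maxDelay < s by linarith [hs.1])] with r hr
    exact hzx r hr.le

/-- Margins for the Lipschitz constant and for the lower bound of the forcing. -/
theorem exists_margin (h : P.Standing L) : ∃ e : ℝ, 0 < e ∧ e < P.M₂ ∧
    P.A / P.aL * P.forcingLip L (P.M₂ - e) (P.M₁ + e) < 1 := by
  have hM1 : 0 < P.M₁ := h.M₂_pos.trans_le h.M₂_le_M₁
  have hc : ∀ α : ℝ, ContinuousAt (fun e : ℝ => hillLip α (P.M₂ - e) (P.M₁ + e)) 0 := by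
    intro α
    have c1 : ContinuousAt (fun e : ℝ => P.M₂ - e) 0 := by fun_prop
    have c2 : ContinuousAt (fun e : ℝ => P.M₁ + e) 0 := by fun_prop
    exact (continuousAt_const.mul (c1.rpow_const (Or.inl (by simpa using h.M₂_pos.ne')))).max
      (continuousAt_const.mul (c2.rpow_const (Or.inl (by simpa using hM1.ne'))))
  have hcont : ContinuousAt (fun e : ℝ => P.A / P.aL * P.forcingLip L (P.M₂ - e) (P.M₁ + e)) 0 := by
    refine continuousAt_const.mul (tendsto_finsetSum _ fun i _ => ?_)
    exact ((continuousAt_const.mul (hc _)).add (continuousAt_const.mul (hc _))).add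
      continuousAt_const
  have hev : ∀ᶠ e in 𝓝 (0 : ℝ), P.A / P.aL * P.forcingLip L (P.M₂ - e) (P.M₁ + e) < 1 :=
    hcont.eventually (gt_mem_nhds (by simpa using h.contraction_lt))
  obtain ⟨e, ⟨h1, h2⟩, h3⟩ := ((hev.and (gt_mem_nhds h.M₂_pos)).filter_mono
    nhdsWithin_le_nhds |>.and (self_mem_nhdsWithin (s := Ioi (0 : ℝ)))).exists
  exact ⟨e, h3, h2, h1⟩

theorem exists_lowerForcing_ge (h : P.Standing L) {ε e : ℝ} (hε : 0 < ε) (he : 0 < e) :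
    ∃ r, 0 < r ∧ r ≤ e ∧ P.lowerForcing P.M₁ - ε ≤ P.lowerForcing (P.M₁ + r) := by
  have hM1 : 0 < P.M₁ := h.M₂_pos.trans_le h.M₂_le_M₁
  have hc : ∀ α : ℝ, ContinuousAt (fun e : ℝ => (P.M₁ + e) ^ α) 0 := by
    intro α
    have c2 : ContinuousAt (fun e : ℝ => P.M₁ + e) 0 := by fun_prop
    exact c2.rpow_const (Or.inl (by simpa using hM1.ne'))
  have hne : ∀ α : ℝ, 1 + (P.M₁ + 0) ^ α ≠ 0 := fun α => by
    have := Real.rpow_nonneg (show 0 ≤ P.M₁ + 0 by linarith) α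
    positivity
  have hcont : ContinuousAt (fun r : ℝ => P.lowerForcing (P.M₁ + r)) 0 := by
    refine tendsto_finsetSum _ fun i _ => ?_
    exact ((continuousAt_const.div (continuousAt_const.add (hc _)) (hne _)).add
      (continuousAt_const.div (continuousAt_const.add (hc _)) (hne _))).sub continuousAt_const
  have hev : ∀ᶠ r in 𝓝 (0 : ℝ), P.lowerForcing P.M₁ - ε < P.lowerForcing (P.M₁ + r) :=
    hcont.eventually (lt_mem_nhds (by simpa using hε))
  obtain ⟨r, ⟨h1, h2⟩, h3⟩ := ((hev.and (gt_mem_nhds he)).filter_mono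
    nhdsWithin_le_nhds |>.and (self_mem_nhdsWithin (s := Ioi (0 : ℝ)))).exists
  exact ⟨r, h3, h2.le, h1.le⟩

theorem exists_impulse_ge (h : P.Standing L) (T : ℝ) (N : ℤ) : ∃ k, N ≤ k ∧ T ≤ P.t k :=
  ((eventually_ge_atTop N).and (h.admissible.t_atTop.eventually (eventually_ge_atTop T))).exists

/-- Solutions of the integral equation on a half-line are eventually close to `[M₂, M₁]`. -/
theorem eventually_mem (h : P.Standing L) {z : ℝ → ℝ} (hz : Measurable z) (hz0 : ∀ s, 0 ≤ z s)
    {N : ℤ} (hmild : ∀ k, N ≤ k → MildOn P.a P.t P.gamma (P.forcing z) P.delta z k) {e : ℝ}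
    (he : 0 < e) (heM : e < P.M₂) : ∃ T, ∀ s, T ≤ s → z s ∈ Icc (P.M₂ - e) (P.M₁ + e) := by
  have hl := h.linear
  have hf := h.bddMeas_forcing hz hz0
  have hσ := h.maxDelay_pos
  have hBM : 0 < P.B / P.aM := div_pos hl.B_pos hl.aM_pos
  -- The lower constant depends on the forcing bound with slope B / a_M, so lowering the latter by ε
  -- costs e/2; the decaying remnant may take the other half.
  set ε := e / 2 / (P.B / P.aM) with hε
  have hε0 : 0 < ε := by positivity
  obtain ⟨r, hr0, hre, hr⟩ := h.exists_lowerForcing_ge hε0 he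
  have hidx : ∀ N s, P.t N < s → N ≤ intervalIndex P.t s := fun N s hs => by
    have := hl.strictMono.lt_iff_lt.1 (hs.trans_le (hl.mem_intervalIndex s).2)
    lia
  obtain ⟨T₁, hT₁, H₁⟩ := exists_expDecay_mul_le hl.aL_pos (P.t N)
    (P.A * |z (P.t N)| + P.A / P.aL * |P.upperForcing|) hr0
  have hup : ∀ s, T₁ + 1 ≤ s → z s ≤ P.M₁ + r := fun s hs => by
    have := hl.le_of_forcing_le h.upper_condition hf (hidx N s (by linarith))
      (hl.mem_intervalIndex s) (fun k hk _ => hmild k hk) (fun r _ => h.forcing_le hz hz0 r)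
      h.le_deltaM
    rw [← h.M₁_eq] at this
    linarith [H₁ s (by linarith)]
  -- From this impulse on, the whole delayed history obeys the upper bound M₁ + r, which is what the
  -- lower estimate of the forcing requires.
  obtain ⟨N₁, hN₁, hTN₁⟩ := h.exists_impulse_ge (T₁ + 1 + P.maxDelay) N
  set S := P.lowerForcing P.M₁ - ε with hS
  have hlc : lowerConst P.aL P.aM P.eta P.etaBar P.A P.B S P.deltaL = P.M₂ - e / 2 := by
    have : P.B / P.aM * ε = e / 2 := by rw [hε]; exact mul_div_cancel₀ _ hBM.ne'
    rw [h.M₂_eq, hS, lowerConst, lowerConst, mul_sub, this]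
    ring
  obtain ⟨T₂, hT₂, H₂⟩ := exists_expDecay_mul_le hl.aL_pos (P.t N₁)
    (P.A * |z (P.t N₁)| + (lowerConst P.aL P.aM P.eta P.etaBar P.A P.B S P.deltaL +
      P.B / P.aM * |S|)) (half_pos he)
  have hlow : ∀ s, T₂ + 1 ≤ s → P.M₂ - e ≤ z s := fun s hs => by
    have := hl.le_of_le_forcing (S := S) (D := P.deltaL) (by rw [hlc]; linarith) hf
      (hidx N₁ s (by linarith)) (hl.mem_intervalIndex s) (fun k hk _ => hmild k (hN₁.trans hk))
      (fun p hp => hr.trans (h.lowerForcing_le hz hz0 fun y hy => hup y (by linarith [hy.1])))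
      h.deltaL_le
    have := H₂ s (by linarith)
    linarith
  exact ⟨max (T₁ + 1) (T₂ + 1), fun s hs => ⟨hlow s ((le_max_right _ _).trans hs),
    (hup s ((le_max_left _ _).trans hs)).trans (by linarith)⟩⟩

/-- Global exponential stability. -/
theorem exists_rate (h : P.Standing L) {y : ℝ → ℝ} (hy : Measurable y)
    (hyM : ∀ s, y s ∈ Icc P.M₂ P.M₁)
    (hym : ∀ k, MildOn P.a P.t P.gamma (P.forcing y) P.delta y k) :
    ∃ rate : ℝ, 0 < rate ∧ ∀ (t₀ : ℝ) (ξ x : ℝ → ℝ), P.IsInitialFunction t₀ ξ →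
      P.IsSolutionFrom t₀ ξ x →
        ∃ C : ℝ, ∀ s : ℝ, t₀ ≤ s → |x s - y s| ≤ C * Real.exp (-(rate * (s - t₀))) := by
  have hl := h.linear
  have hσ := h.maxDelay_pos
  have hL := hl.aL_pos
  have hy0 : ∀ s, 0 ≤ y s := fun s => h.M₂_pos.le.trans (hyM s).1
  obtain ⟨e, he, heM, hκ⟩ := h.exists_margin
  set Λ := P.forcingLip L (P.M₂ - e) (P.M₁ + e) with hΛ
  -- At rate 0 the expression is the contraction constant on the enlarged interval, so continuity
  -- gives a positive rate. It is fixed before any initial data.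
  obtain ⟨rate, hr, hrL, hrκ⟩ : ∃ rate : ℝ, 0 < rate ∧ rate < P.aL ∧
      P.A * (Λ * Real.exp (rate * P.maxDelay)) / (P.aL - rate) < 1 := by
    have hcont : ContinuousAt (fun rate : ℝ =>
        P.A * (Λ * Real.exp (rate * P.maxDelay)) / (P.aL - rate)) 0 :=
      ContinuousAt.div (by fun_prop) (by fun_prop) (by simpa using hL.ne')
    have hev : ∀ᶠ rate in 𝓝 (0 : ℝ),
        P.A * (Λ * Real.exp (rate * P.maxDelay)) / (P.aL - rate) < 1 := by
      refine hcont.eventually (gt_mem_nhds ?_)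
      simp only [zero_mul, Real.exp_zero, mul_one, sub_zero]
      rwa [mul_div_right_comm]
    obtain ⟨r, ⟨h1, h2⟩, h3⟩ := ((hev.and (gt_mem_nhds hL)).filter_mono
      nhdsWithin_le_nhds |>.and (self_mem_nhdsWithin (s := Ioi (0 : ℝ)))).exists
    exact ⟨r, h3, h2, h1⟩
  refine ⟨rate, hr, fun t₀ ξ x hξ hx => ?_⟩
  obtain ⟨z, hz, hz0, hzx, hzm⟩ := h.mildOn_of_isSolutionFrom hξ hx
  obtain ⟨N, -, hN⟩ := h.exists_impulse_ge t₀ 0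
  have hmild : ∀ k, N ≤ k → MildOn P.a P.t P.gamma (P.forcing z) P.delta z k := fun k hk =>
    hzm k (hN.trans (hl.strictMono.monotone hk))
  obtain ⟨T, hT⟩ := h.eventually_mem hz hz0 hmild he heM
  obtain ⟨N₂, hN₂, hTN₂⟩ := h.exists_impulse_ge (T + P.maxDelay) N
  obtain ⟨C, hC⟩ := h.exists_exp_decay hz hz0 hy hy0 (fun k hk => hmild k (hN₂.trans hk))
    (fun k _ => hym k) (c := P.M₂ - e) (d := P.M₁ + e) (by linarith)
    (fun s hs => hT s (by linarith)) (fun s _ => ⟨by linarith [(hyM s).1], by linarith [(hyM s).2]⟩)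
    hr hrL hrκ
  obtain ⟨D, hD⟩ := hx.plc.exists_bound (isCompact_Icc (a := t₀) (b := P.t N₂))
    fun s hs => mem_Ici.2 (by linarith [hs.1])
  have htN : t₀ ≤ P.t N₂ := hN.trans (hl.strictMono.monotone hN₂)
  have hD0 : 0 ≤ D := (abs_nonneg _).trans (hD t₀ ⟨le_rfl, htN⟩)
  have hC0 : 0 ≤ C := by
    have := (abs_nonneg _).trans (hC (P.t N₂) le_rfl)
    simpa using this
  -- The exponential moves the reference time from t N₂ to t₀; before t N₂ the crude bound D + M₁
  -- suffices, as the weight is then at least 1.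
  refine ⟨(C + (D + P.M₁)) * Real.exp (rate * (P.t N₂ - t₀)), fun s hs => ?_⟩
  have hM1 := h.M₁_nonneg
  rw [mul_assoc, ← Real.exp_add, show rate * (P.t N₂ - t₀) + -(rate * (s - t₀)) =
    -(rate * (s - P.t N₂)) by ring]
  have hE := Real.exp_pos (-(rate * (s - P.t N₂)))
  rcases le_total (P.t N₂) s with hle | hle
  · rw [← hzx s (by linarith)]
    refine (hC s hle).trans (mul_le_mul_of_nonneg_right (by linarith) hE.le)
  · have h1 := hD s ⟨hs, hle⟩
    have h2 : 1 ≤ Real.exp (-(rate * (s - P.t N₂))) := by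
      refine Real.one_le_exp ?_
      have := mul_nonneg hr.le (sub_nonneg.2 hle)
      linarith
    have h3 : |x s - y s| ≤ D + P.M₁ := by
      refine (abs_sub _ _).trans (add_le_add h1 ?_)
      rw [abs_of_nonneg (hy0 s)]; exact (hyM s).2
    calc |x s - y s| ≤ (C + (D + P.M₁)) * 1 := by linarith
      _ ≤ _ := mul_le_mul_of_nonneg_left h2 (by positivity)

end HematopoiesisModel.Standing

/-! ### Conclusion -/

theorem theorem3p3 (m : ℕ) (hm : 0 < m) (P : HematopoiesisModel m) (hP : P.Admissible)
    (L : Fin m → ℝ)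
    (h1 : P.DecayAssumption) (h2 : P.ProductionAssumption) (h3 : P.HarvestAssumption L)
    (h4 : P.DelayAssumption) (h5 : P.ImpulseShiftAssumption) (h6 : P.ImpulseFactorAssumption)
    (h7 : P.ImpulseTimeAssumption)
    (hM₁ : 0 ≤ P.M₁) (hM₂ : 0 < P.M₂) (hdelay : P.maxDelay ≤ P.eta)
    (hcontr : 1 / P.aL * max P.A (P.gammaL + 1)⁻¹ *
      ∑ i, (P.bM i * P.KStar i + P.cM i * P.GStar i + L i) < 1) :
    ∃ xs : ℝ → ℝ,
      P.IsPositiveAlmostPeriodicSolution xs ∧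
      (∀ y : ℝ → ℝ, P.IsPositiveAlmostPeriodicSolution y → y = xs) ∧
      ∃ rate : ℝ, 0 < rate ∧
        ∀ (t₀ : ℝ) (ξ x : ℝ → ℝ), P.IsInitialFunction t₀ ξ → P.IsSolutionFrom t₀ ξ x →
          ∃ C : ℝ, ∀ s : ℝ, t₀ ≤ s → |x s - xs s| ≤ C * Real.exp (-(rate * (s - t₀))) := by
  have h : P.Standing L := ⟨hP, h1, h2, h3, h4, h5, h6, h7, hM₁, hM₂, hdelay, hcontr⟩
  obtain ⟨x, hx, hxM, hxm⟩ := h.exists_mildOn_self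
  have hpos : ∀ s, 0 < x s := fun s => hM₂.trans_le (hxM s).1
  have hsol := h.isSolution_of_mildOn hx (fun s => (hpos s).le) hxm
  refine ⟨x, ⟨hsol, h.plcAlmostPeriodic hx hxM hsol, hpos⟩, fun y hy => ?_,
    h.exists_rate hx hxM hxm⟩
  -- For a competing solution, almost periodicity is used only to bound its values at the impulse
  -- times.
  obtain ⟨C, hC⟩ := hy.2.1.bounded_at_impulses h.linear.eta_pos h.linear.eta_le fun l =>
    hy.1.plc.exists_bound isCompact_Icc (subset_univ _)
  exact h.eq_of_mildOn_self hx hxM hxm hy.1 hC
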